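/- **Conventions.** Let $n\ge 0$ and let $p$ be a convex polygon in the plane with $n+1$ vertices, labelled in the clockwise order of its boundary (for $n\le 1$, just $n+1$ distinct points). *Hypertrees.* A hypergraph on the vertices is a finite set of hyperedges, i.e. vertex subsets with at least $2$ elements. It is a hypertree if it is connected and has no simple cycle of length at least $2$. It is noncrossing if the convex hulls of any two distinct hyperedges have at most one vertex, and no other point, in common. Noncrossing hypertrees are ordered by $\sigma\le\tau$ iff every hyperedge of $\sigma$ is contained in a hyperedge of $\tau$. The basic ones are those with exactly two hyperedges. The *noncrossing hypertree complex* $C$ is the simplicial complex whose vertices are the basic noncrossing hypertrees and whose simplices are the nonempty sets of basic noncrossing hypertrees lying above a common noncrossing hypertree; its closed simplex labelled by $\tau$ is spanned by all basic noncrossing hypertrees $\beta\ge\tau$. The hyperedge poset of $\tau$ is the transitive closure of the local linear orders at the vertices: if $e\ne e'$ share the vertex $v$, then $e<e'$ when $e$ is to the left of $e'$ as seen from $v$ looking into the polygon. A proper ordering of $\tau$ is a linear extension $(e_1,\dots,e_k)$ of its hyperedge poset. *The link.* Let $NC_{n+1}$ be the lattice of noncrossing partitions of the vertices (blocks have pairwise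 disjoint convex hulls), ordered by refinement and graded by $\mathrm{rk}\,\pi = n+1-\#\text{blocks}$, with bottom $\hat 0$ and top $\hat 1$. In its orthoscheme complex (the order complex with the Euclidean metric in which the edge from $x<y$ has length $\sqrt{\mathrm{rk}\,y-\mathrm{rk}\,x}$) the long diagonal is the edge from $\hat 0$ to $\hat 1$. The *noncrossing partition link* $L$ is the link of this edge: the unit vectors based at its midpoint that are perpendicular to it and point into the complex. Each chain containing $\hat 0$ and $\hat 1$ gives a closed spherical simplex of $L$ (a partition simplex), and $L$ carries the length metric $d_L$ defined by these spherical simplices. A hyperedge $e$ is identified with the cyclic permutation $\sigma_e$ listing its elements clockwise, and a noncrossing partition $\pi$ with the product $\sigma_\pi$ of the cycles of its blocks. For a proper ordering $(e_1,\dots,e_k)$ of $\tau$, a partition simplex is labelled by it if it comes from a chain $\hat0=\pi_0<\pi_1<\dots<\pi_k=\hat1$ with $\sigma_{\pi_{i-1}}\sigma_{e_i}=\sigma_{\pi_i}$ for all $i$ (products composed from left to right). Let $\mathrm{Simplex}(\tau)\subseteq L$ be the union of the closed partition simplices labelled by the proper orderings of $\tau$. **Theorem (Topology and Geometry).** The dual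 of the poset of noncrossing hypertrees is the face lattice of $C$: the sets $V(\tau)=\{\beta \text{ basic}: \beta\ge\tau\}$ satisfy $V(\tau)\subseteq V(\sigma)\iff\sigma\le\tau$, and every simplex of $C$ has vertex set $V(\tau)$ for some $\tau$. There is a homeomorphism $h$ from the geometric realization of $C$ onto $L$ such that 1. each vertex of $C$, a basic noncrossing hypertree with hyperedges $e<e'$ in its hyperedge poset, is sent to the vertex of $L$ given by the noncrossing partition whose only nontrivial block is $e$; 2. for each noncrossing hypertree $\tau$, $h$ maps the closed simplex of $C$ labelled by $\tau$ onto $\mathrm{Simplex}(\tau)$; 3. the piecewise spherical metric of $L$ induces one on $C$: there is a piecewise spherical structure on $C$ (each simplex is given the shape of a spherical simplex spanned by linearly independent unit vectors, compatibly on common faces) such that, for each $\tau$, $h$ is an isometry from the spherical simplex labelled by $\tau$ onto $\mathrm{Simplex}(\tau)$ with the length metric defined by its partition simplices, and such that $h$ is an isometry from $C$ with its length metric onto $(L,d_L)$. -/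

import Mathlib

open scoped ENNReal

noncomputable section

namespace NCHT

/-! ### Convex polygons -/

/-- Twice the signed area of the triangle `a b c` in the plane: positive when `a, b, c` is a
counterclockwise turn, negative when it is a clockwise turn. -/
def orient (a b c : ℝ × ℝ) : ℝ :=
  (b.1 - a.1) * (c.2 - a.2) - (b.2 - a.2) * (c.1 - a.1)

/-- A convex polygon in the plane with `N` vertices, listed (from `0` to `N - 1`) in the order in
which they occur in the clockwise oriented boundary. For `N ≤ 2` this is just a list of distinct
points. -/
structure ConvexPolygon (N : ℕ) where
  /-- the position of the vertices -/
  pt : Fin N → ℝ × ℝ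
  injective : Function.Injective pt
  clockwise : ∀ i j k : Fin N, i < j → j < k → orient (pt i) (pt j) (pt k) < 0

variable {N : ℕ}

/-- The convex hull of a set of vertices of a polygon. -/
def ConvexPolygon.hull (p : ConvexPolygon N) (e : Finset (Fin N)) : Set (ℝ × ℝ) :=
  convexHull ℝ (p.pt '' e)

/-- Two sets of vertices are noncrossing when their convex hulls are disjoint. -/
def ConvexPolygon.Noncrossing (p : ConvexPolygon N) (e f : Finset (Fin N)) : Prop :=
  Disjoint (p.hull e) (p.hull f)

/-- Two sets of vertices are weakly noncrossing when their convex hulls have at most one vertex,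
but no other point, in common. -/
def ConvexPolygon.WeaklyNoncrossing (p : ConvexPolygon N) (e f : Finset (Fin N)) : Prop :=
  ∃ v, p.hull e ∩ p.hull f ⊆ {p.pt v}

/-- Standing at the vertex `v` and facing the interior of the polygon, `e` lies to the left
of `f`: the direction from `v` to any further vertex of `e` is obtained from the direction
from `v` to any further vertex of `f` by turning counterclockwise. -/
def ConvexPolygon.LeftOf (p : ConvexPolygon N) (v : Fin N) (e f : Finset (Fin N)) : Prop :=
  ∀ a ∈ e, ∀ b ∈ f, a ≠ v → b ≠ v → 0 < orient (p.pt v) (p.pt b) (p.pt a)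

/-! ### Hypergraphs and noncrossing hypertrees -/

/-- A hypergraph on the vertex set `V`: a finite collection of hyperedges, each with at least
two elements. -/
@[ext]
structure Hypergraph (V : Type) where
  /-- the hyperedges -/
  edges : Finset (Finset V)
  two_le : ∀ e ∈ edges, 2 ≤ e.card

/-- Every pair of vertices is joined by a path. -/
def Hypergraph.Connected {V : Type} (τ : Hypergraph V) : Prop :=
  ∀ v w, Relation.ReflTransGen (fun a b => ∃ e ∈ τ.edges, a ∈ e ∧ b ∈ e) v w

/-- There is no simple cycle, i.e. no cyclic sequence of `k + 2` distinct vertices `v i` and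
`k + 2` distinct hyperedges `e i` with `v i, v (i + 1) ∈ e i` (indices modulo `k + 2`). -/
def Hypergraph.IsHyperforest {V : Type} (τ : Hypergraph V) : Prop :=
  ¬ ∃ (k : ℕ) (v : Fin (k + 2) → V) (e : Fin (k + 2) → Finset V),
    Function.Injective v ∧ Function.Injective e ∧
      ∀ i, e i ∈ τ.edges ∧ v i ∈ e i ∧ v (i + 1) ∈ e i

/-- A hypertree is a connected hyperforest. -/
def Hypergraph.IsHypertree {V : Type} (τ : Hypergraph V) : Prop :=
  τ.Connected ∧ τ.IsHyperforest

/-- A hypergraph on the vertices of a convex polygon is noncrossing when its hyperedges are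
pairwise weakly noncrossing. -/
def Hypergraph.IsNoncrossing (p : ConvexPolygon N) (τ : Hypergraph (Fin N)) : Prop :=
  ∀ e ∈ τ.edges, ∀ f ∈ τ.edges, e ≠ f → p.WeaklyNoncrossing e f

/-- The noncrossing hypertrees on the vertices of a convex polygon. -/
def NCHypertree (p : ConvexPolygon N) : Type :=
  {τ : Hypergraph (Fin N) // τ.IsHypertree ∧ τ.IsNoncrossing p}

/-- The hyperedges of a noncrossing hypertree. -/
def NCHypertree.edges {p : ConvexPolygon N} (τ : NCHypertree p) : Finset (Finset (Fin N)) :=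
  τ.1.edges

theorem NCHypertree.ext {p : ConvexPolygon N} {σ τ : NCHypertree p} (h : σ.edges = τ.edges) :
    σ = τ :=
  Subtype.ext (Hypergraph.ext h)

instance (p : ConvexPolygon N) : Finite (NCHypertree p) :=
  Finite.of_injective NCHypertree.edges fun _ _ h => NCHypertree.ext h

instance (p : ConvexPolygon N) : Fintype (NCHypertree p) := Fintype.ofFinite _

theorem NCHypertree.eq_of_subset {p : ConvexPolygon N} (τ : NCHypertree p)
    {e f : Finset (Fin N)} (he : e ∈ τ.edges) (hf : f ∈ τ.edges) (h : e ⊆ f) : e = f := by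
  by_contra hne
  obtain ⟨v, hv⟩ := τ.2.2 e he f hf hne
  have h2 : 1 < e.card := τ.1.two_le e he
  obtain ⟨a, ha, b, hb, hab⟩ := Finset.one_lt_card.1 h2
  have key : ∀ c ∈ e, p.pt c = p.pt v := fun c hc =>
    hv ⟨subset_convexHull ℝ _ ⟨c, hc, rfl⟩, subset_convexHull ℝ _ ⟨c, h hc, rfl⟩⟩
  exact hab (p.injective ((key a ha).trans (key b hb).symm))

/-- The noncrossing hypertree poset: `σ ≤ τ` if and only if every hyperedge of `σ` is contained
in a hyperedge of `τ`. -/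
instance (p : ConvexPolygon N) : PartialOrder (NCHypertree p) where
  le σ τ := ∀ e ∈ σ.edges, ∃ f ∈ τ.edges, e ⊆ f
  le_refl _ e he := ⟨e, he, subset_rfl⟩
  le_trans _ _ _ h₁ h₂ e he := by
    obtain ⟨f, hf, hef⟩ := h₁ e he
    obtain ⟨g, hg, hfg⟩ := h₂ f hf
    exact ⟨g, hg, hef.trans hfg⟩
  le_antisymm σ τ h₁ h₂ := by
    have key : ∀ α β : NCHypertree p, (∀ e ∈ α.edges, ∃ f ∈ β.edges, e ⊆ f) →
        (∀ e ∈ β.edges, ∃ f ∈ α.edges, e ⊆ f) → α.edges ⊆ β.edges := by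
      intro α β h₁ h₂ e he
      obtain ⟨f, hf, hef⟩ := h₁ e he
      obtain ⟨g, hg, hfg⟩ := h₂ f hf
      obtain rfl := α.eq_of_subset he hg (hef.trans hfg)
      rwa [hef.antisymm hfg]
    exact NCHypertree.ext ((key σ τ h₁ h₂).antisymm (key τ σ h₂ h₁))

/-- The strict order of the hyperedge poset of a noncrossing hypertree: the transitive closure
of the local linear (left to right) orders of the hyperedges at each vertex. -/
def NCHypertree.EdgeLT {p : ConvexPolygon N} (τ : NCHypertree p) :
    Finset (Fin N) → Finset (Fin N) → Prop :=
  Relation.TransGen fun e f =>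
    e ∈ τ.edges ∧ f ∈ τ.edges ∧ e ≠ f ∧ ∃ v, v ∈ e ∧ v ∈ f ∧ p.LeftOf v e f

/-- A proper ordering of a noncrossing hypertree with `k` hyperedges: a listing of its hyperedges
that is a linear extension of its hyperedge poset. -/
def NCHypertree.IsProperOrdering {p : ConvexPolygon N} (τ : NCHypertree p) {k : ℕ}
    (e : Fin k → Finset (Fin N)) : Prop :=
  Function.Injective e ∧ Set.range e = (τ.edges : Set (Finset (Fin N))) ∧
    ∀ i j, τ.EdgeLT (e i) (e j) → i < j

/-! ### Simplicial complexes and path metrics -/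

/-- The geometric realization of a simplicial complex on a finite vertex set, in barycentric
coordinates. -/
def realization {V : Type} [Fintype V] (K : AbstractSimplicialComplex V) : Set (V → ℝ) :=
  {t | (∀ v, 0 ≤ t v) ∧ ∑ v, t v = 1 ∧ ∃ s ∈ K.faces, ∀ v, v ∉ s → t v = 0}

/-- The length (pseudo)metric on a space `X` that is a union of cells, where the distance of two
points of a common cell is measured by `d`: the infimum of the lengths of all finite strings of
points from `x` to `y` in which consecutive points lie in a common cell. -/
def pathDist {X : Type} (cells : Set (Set X)) (d : X → X → ℝ) (x y : X) : ℝ≥0∞ :=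
  ⨅ (m : ℕ) (z : Fin (m + 1) → X) (_ : z 0 = x ∧ z (Fin.last m) = y ∧
    ∀ i : Fin m, ∃ A ∈ cells, z i.castSucc ∈ A ∧ z i.succ ∈ A),
    ∑ i : Fin m, ENNReal.ofReal (d (z i.castSucc) (z i.succ))

/-- A piecewise spherical structure on a simplicial complex: each simplex is given the shape of a
spherical simplex (the one spanned by linearly independent unit vectors) in such a way that the
shapes agree on common faces. It is recorded through the cosines of the edge lengths,
i.e. the inner products of these unit vectors; linearly independent unit vectors with prescribed
inner products exist exactly when the Gram matrix is positive definite with unit diagonal. -/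
structure PiecewiseSpherical {V : Type} [Fintype V] (K : AbstractSimplicialComplex V) where
  /-- the cosine of the length of the edge from `v` to `w` -/
  cosLength : V → V → ℝ
  symm : ∀ v w, cosLength v w = cosLength w v
  diag : ∀ v, cosLength v v = 1
  posDef : ∀ s ∈ K.faces, ∀ t : V → ℝ, t ≠ 0 → (∀ v, v ∉ s → t v = 0) →
    0 < ∑ v, ∑ w, t v * t w * cosLength v w

namespace PiecewiseSpherical

variable {V : Type} [Fintype V] {K : AbstractSimplicialComplex V}

/-- The inner product of the vectors `∑ v, x v • u v` and `∑ v, y v • u v`, where the `u v` are the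
unit vectors spanning a spherical simplex. -/
def form (S : PiecewiseSpherical K) (x y : V → ℝ) : ℝ :=
  ∑ v, ∑ w, x v * y w * S.cosLength v w

/-- The spherical distance of two points of a common simplex, where the point with barycentric
coordinates `x` is placed at the unit vector in the direction of `∑ v, x v • u v`. -/
def angle (S : PiecewiseSpherical K) (x y : V → ℝ) : ℝ :=
  Real.arccos (S.form x y / (√(S.form x x) * √(S.form y y)))

/-- The piecewise spherical (length) metric on the realization. -/
def dist (S : PiecewiseSpherical K) (x y : realization K) : ℝ≥0∞ :=
  pathDist {A | ∃ s ∈ K.faces, A = {x : realization K | ∀ v, v ∉ s → x.1 v = 0}}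
    (fun x y => S.angle x.1 y.1) x y

end PiecewiseSpherical

/-! ### The noncrossing hypertree complex -/

/-- Basic noncrossing hypertrees: those with exactly two hyperedges. -/
def BasicNCHypertree (p : ConvexPolygon N) : Type :=
  {τ : NCHypertree p // τ.edges.card = 2}

instance (p : ConvexPolygon N) : Finite (BasicNCHypertree p) :=
  inferInstanceAs (Finite {τ : NCHypertree p // τ.edges.card = 2})

instance (p : ConvexPolygon N) : Fintype (BasicNCHypertree p) := Fintype.ofFinite _

open Classical in
/-- The vertices of the simplex labelled by the noncrossing hypertree `τ`: the basic noncrossing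
hypertrees above `τ`. -/
def NCHypertree.verts {p : ConvexPolygon N} (τ : NCHypertree p) : Finset (BasicNCHypertree p) :=
  {β | τ ≤ β.1}

/-- The noncrossing hypertree complex. Its vertices are the basic noncrossing hypertrees, and a
nonempty set of these spans a simplex when they lie above a common noncrossing hypertree. -/
def hypertreeComplex (p : ConvexPolygon N) : AbstractSimplicialComplex (BasicNCHypertree p) where
  faces := {s | s.Nonempty ∧ ∃ τ : NCHypertree p, s ⊆ τ.verts}
  isRelLowerSet_faces := fun _ hs =>
    ⟨hs.1, fun _ hts ht => ⟨ht, hs.2.imp fun _ h => subset_trans hts h⟩⟩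
  singleton_mem := fun β => ⟨Finset.singleton_nonempty β, β.1, by
    intro γ hγ
    rw [Finset.mem_singleton] at hγ
    subst hγ
    simp [NCHypertree.verts]⟩

/-- The closed simplex labelled by `τ` in the realization of the noncrossing hypertree complex. -/
def NCHypertree.closedSimplex {p : ConvexPolygon N} (τ : NCHypertree p) :
    Set (realization (hypertreeComplex p)) :=
  {x | ∀ β, β ∉ τ.verts → x.1 β = 0}

/-! ### Orthoscheme complexes and links of bounded graded posets -/

/-- The order complex of a poset. -/
def orderComplex (P : Type) [PartialOrder P] : AbstractSimplicialComplex P where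
  faces := {s | s.Nonempty ∧ IsChain (· ≤ ·) (s : Set P)}
  isRelLowerSet_faces := fun _ hs => ⟨hs.1, fun _ hts ht => ⟨ht, hs.2.mono hts⟩⟩
  singleton_mem := fun v => ⟨Finset.singleton_nonempty v, by simp⟩

/-- The corner `(1, …, 1, 0, …, 0)`, with `r` ones, of the standard orthoscheme in `ℝⁿ`. -/
def corner (n r : ℕ) : EuclideanSpace ℝ (Fin n) :=
  WithLp.toLp 2 fun i => if (i : ℕ) < r then 1 else 0

section Link

variable {P : Type} [PartialOrder P] [BoundedOrder P] [Fintype P] (n : ℕ) (rk : P → ℕ)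

/-- The map to `ℝⁿ` that is linear in barycentric coordinates and sends an element of rank `r` to
the `r`-th corner of the standard orthoscheme. For a poset graded by `rk` with top rank `n`, it is
an isometry on each simplex of the orthoscheme complex; applied to the difference of two points of
a simplex it gives the vector from one to the other. -/
def develop (c : P → ℝ) : EuclideanSpace ℝ (Fin n) :=
  ∑ x, c x • corner n (rk x)

open Classical in
/-- The midpoint of the long diagonal, the edge spanned by the two bounding elements. -/
def midpoint (P : Type) [PartialOrder P] [BoundedOrder P] : P → ℝ :=
  (1 / 2 : ℝ) • Pi.single ⊥ 1 + (1 / 2 : ℝ) • Pi.single ⊤ 1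

/-- The link of the long diagonal in the orthoscheme complex of a bounded graded poset: the unit
vectors `c` based at the midpoint of the long diagonal (written in barycentric coordinates) that
point into the orthoscheme complex and are perpendicular to the long diagonal. -/
def link : Set (P → ℝ) :=
  {c | (∃ ε : ℝ, 0 < ε ∧ midpoint P + ε • c ∈ realization (orderComplex P)) ∧
    inner ℝ (develop n rk c) (corner n (rk ⊤) - corner n (rk ⊥)) = 0 ∧
    ‖develop n rk c‖ = 1}

/-- The closed spherical simplex of the link that comes from the orthoscheme spanned by the
chain `A`, a chain containing the bounding elements. -/
def linkCell (A : Set P) : Set (link n rk) :=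
  {c | ∀ x, x ∉ A → c.1 x = 0}

/-- The spherical distance of two points in a common simplex of the link. -/
def linkAngle (c d : link n rk) : ℝ :=
  InnerProductGeometry.angle (develop n rk c.1) (develop n rk d.1)

/-- The piecewise spherical (length) metric on the link. -/
def linkDist (c d : link n rk) : ℝ≥0∞ :=
  pathDist {K | ∃ A : Set P, IsChain (· ≤ ·) A ∧ ⊥ ∈ A ∧ ⊤ ∈ A ∧ K = linkCell n rk A}
    (linkAngle n rk) c d

end Link

/-! ### The noncrossing partition link -/

/-- The noncrossing partitions of the vertices of a convex polygon: the blocks have pairwise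
disjoint convex hulls. They are ordered by refinement. -/
def NCPartition (p : ConvexPolygon N) : Type :=
  {π : Finpartition (Finset.univ : Finset (Fin N)) //
    ∀ a ∈ π.parts, ∀ b ∈ π.parts, a ≠ b → p.Noncrossing a b}

instance (p : ConvexPolygon N) : PartialOrder (NCPartition p) :=
  inferInstanceAs (PartialOrder {π : Finpartition (Finset.univ : Finset (Fin N)) //
    ∀ a ∈ π.parts, ∀ b ∈ π.parts, a ≠ b → p.Noncrossing a b})

instance (p : ConvexPolygon N) : Finite (NCPartition p) :=
  inferInstanceAs (Finite {π : Finpartition (Finset.univ : Finset (Fin N)) //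
    ∀ a ∈ π.parts, ∀ b ∈ π.parts, a ≠ b → p.Noncrossing a b})

instance (p : ConvexPolygon N) : Fintype (NCPartition p) := Fintype.ofFinite _

/-- The bounding elements are the partition into singletons and the partition with one block. -/
instance (p : ConvexPolygon N) : BoundedOrder (NCPartition p) where
  bot := ⟨⊥, by
    intro a ha b hb hab
    rw [Finpartition.mem_bot_iff] at ha hb
    obtain ⟨i, -, rfl⟩ := ha
    obtain ⟨j, -, rfl⟩ := hb
    have hij : i ≠ j := fun h => hab (by rw [h])
    simpa [ConvexPolygon.Noncrossing, ConvexPolygon.hull] using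
      fun h => hij (p.injective h)⟩
  bot_le π := (bot_le : ⊥ ≤ π.1)
  top := ⟨⊤, by
    intro a ha b hb hab
    have h := Finpartition.parts_top_subset (Finset.univ : Finset (Fin N))
    exact absurd ((Finset.mem_singleton.1 (h ha)).trans (Finset.mem_singleton.1 (h hb)).symm) hab⟩
  le_top π := (le_top : π.1 ≤ ⊤)

/-- The rank of a noncrossing partition: the number of vertices minus the number of blocks. -/
def NCPartition.rank {p : ConvexPolygon N} (π : NCPartition p) : ℕ :=
  N - π.1.parts.card

/-- The hyperedges of a noncrossing partition: its blocks that are not singletons. -/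
def NCPartition.hyperedges {p : ConvexPolygon N} (π : NCPartition p) : Finset (Finset (Fin N)) :=
  {b ∈ π.1.parts | 2 ≤ b.card}

/-- The noncrossing partition link on the vertices of a convex polygon with `n + 1` vertices: the
link of the long diagonal in the orthoscheme complex of the noncrossing partition lattice. -/
abbrev ncLink {n : ℕ} (p : ConvexPolygon (n + 1)) : Set (NCPartition p → ℝ) :=
  link n (NCPartition.rank (p := p))

/-- The irreducible permutation of a hyperedge: the cycle that lists its elements in clockwise
order. -/
def cyc (e : Finset (Fin N)) : Equiv.Perm (Fin N) :=
  (e.sort (· ≤ ·)).formPerm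

/-- The noncrossing permutation of a noncrossing partition: the product of the (disjoint) cycles of
its blocks, i.e. it acts on each block as the cycle of that block. -/
def NCPartition.perm {p : ConvexPolygon N} (π : NCPartition p) (x : Fin N) : Fin N :=
  cyc (π.1.part x) x

/-- The chain `c 0 < c 1 < ⋯ < c k` between the bounding elements of the noncrossing partition
lattice has labels `e 0, …, e (k - 1)`: for each `i` the permutation of `c (i + 1)` is the product
of the permutation of `c i` and, applied after it, the cycle of the hyperedge `e i`. (Products of
permutations are composed from left to right here.) -/
def IsLabelledChain {p : ConvexPolygon N} {k : ℕ} (c : Fin (k + 1) → NCPartition p)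
    (e : Fin k → Finset (Fin N)) : Prop :=
  StrictMono c ∧ c 0 = ⊥ ∧ c (Fin.last k) = ⊤ ∧
    ∀ (i : Fin k) (x : Fin N), (c i.succ).perm x = cyc (e i) ((c i.castSucc).perm x)

/-- The closed simplices of the noncrossing partition link whose standard name is the noncrossing
hypertree `τ` with a proper ordering of its hyperedges. -/
def NCHypertree.partitionCells {n : ℕ} {p : ConvexPolygon (n + 1)} (τ : NCHypertree p) :
    Set (Set (ncLink p)) :=
  {K | ∃ (k : ℕ) (e : Fin k → Finset (Fin (n + 1))) (c : Fin (k + 1) → NCPartition p),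
    τ.IsProperOrdering e ∧ IsLabelledChain c e ∧ K = linkCell n NCPartition.rank (Set.range c)}

end NCHT

end

/-! Geometry enters only through the cyclic order of the vertices: hulls are (weakly) noncrossing
when the sets do not interleave and are disjoint (share at most one vertex). A basic hypertree is
then a cut: from a vertex `v` the other vertices are divided into a lower and an upper side. It lies
above `τ` exactly when no hyperedge of `τ` has vertices other than `v` on both sides. Hyperedges
ordered at a common vertex are separated by a cut (`exists_vert_of_leftFrom`), and each cut is the
only one that separates a certain pair of hyperedges at its vertex (`exists_corner`). Merging that
pair removes just this cut (`exists_verts_eq_erase`), and the cuts determine the order of hypertrees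
(`verts_subset_verts_iff`); this is the face lattice.

For the link, the components of the initial segments of a proper ordering form the chain labelled by
it (`isLabelledChain`), and every chain of noncrossing partitions lies in one of these
(`exists_isLabelledChain`). The steps of a noncrossing permutation are again cuts. Giving each cut
the total coefficient of the partitions that have it as a step defines `stepWt`, a single linear map
on all link vectors; after scaling it is the inverse of the homeomorphism.

A combination of cuts and a link vector are compared as functions on the hyperedges of `τ`: the
first has a `potential`, the second has block weights, and `potential_stepWt` says that they agree.
A potential with nonnegative coefficients decreases along the local orders, so sorting the
hyperedges by it yields a proper ordering and a preimage (`exists_toTree_eq`). The partition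
simplices of `τ` are thus the regions of its simplex on which the potential sorts the hyperedges in
a given way. Injectivity holds because the weight of `d` above each partition can be read off from
superlevel sets of the potential (`le_upWt_iff`). Compactness of the link makes the continuous
bijection a homeomorphism.

For the metric, coordinates weighted by the ranks of the hyperedges make both descriptions isometric
to the same Euclidean vectors (`inner_develop_eq`, `inner_pointVec`). The count `rankIn_inter` shows
that the inner product of two cuts does not depend on `τ`, so the shapes fit together. Geodesics in
a tree simplex are subdivided where two potentials coincide, which identifies the length metrics. -/

noncomputable section

namespace NCHT

/-! ### The cyclic order of the vertices -/

section Cyclic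

variable {N : ℕ}

/-- The vertices `a`, `b`, `c` are distinct and occur in this clockwise order. -/
def cw (a b c : Fin N) : Prop :=
  (a < b ∧ b < c) ∨ (b < c ∧ c < a) ∨ (c < a ∧ a < b)

theorem cw_rot {a b c : Fin N} (h : cw a b c) : cw b c a := by
  simp only [cw] at *; omega

theorem cw_total {a b c : Fin N} (hab : a ≠ b) (hbc : b ≠ c) (hac : a ≠ c) :
    cw a b c ∨ cw a c b := by
  simp only [cw] at *; omega

theorem orient_rot (a b c : ℝ × ℝ) : orient b c a = orient a b c := by
  simp only [orient]; ring

theorem orient_swap (a b c : ℝ × ℝ) : orient a c b = -orient a b c := by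
  simp only [orient]; ring

theorem orient_self_left (a b : ℝ × ℝ) : orient a b a = 0 := by
  simp only [orient]; ring

theorem orient_self_right (a b : ℝ × ℝ) : orient a b b = 0 := by
  simp only [orient]; ring

/-- Affinity in the last point makes the sides of a line convex, which is how convex hulls are
controlled below. -/
theorem orient_combo (a b x y : ℝ × ℝ) (s t : ℝ) (h : s + t = 1) :
    orient a b (s • x + t • y) = s * orient a b x + t * orient a b y := by
  simp only [orient, Prod.fst_add, Prod.snd_add, Prod.smul_fst, Prod.smul_snd, smul_eq_mul]
  linear_combination ((b.1 - a.1) * a.2 - (b.2 - a.2) * a.1) * h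

namespace ConvexPolygon

variable (p : ConvexPolygon N)

theorem orient_neg_of_cw {a b c : Fin N} (h : cw a b c) :
    orient (p.pt a) (p.pt b) (p.pt c) < 0 := by
  rcases h with h | h | h
  · exact p.clockwise _ _ _ h.1 h.2
  · rw [← orient_rot]; exact p.clockwise _ _ _ h.1 h.2
  · rw [← orient_rot, ← orient_rot]; exact p.clockwise _ _ _ h.1 h.2

theorem orient_pos_of_cw {a b c : Fin N} (h : cw a c b) :
    0 < orient (p.pt a) (p.pt b) (p.pt c) := by
  rw [orient_swap]; linarith [p.orient_neg_of_cw h]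

theorem orient_pos_iff {a b c : Fin N} :
    0 < orient (p.pt a) (p.pt b) (p.pt c) ↔ cw a c b := by
  refine ⟨fun h => ?_, p.orient_pos_of_cw⟩
  have h1 : a ≠ b := by
    rintro rfl; rw [← orient_rot, orient_self_left] at h; exact lt_irrefl _ h
  have h2 : a ≠ c := by rintro rfl; rw [orient_self_left] at h; exact lt_irrefl _ h
  have h3 : b ≠ c := by rintro rfl; rw [orient_self_right] at h; exact lt_irrefl _ h
  rcases cw_total h1 h3 h2 with h4 | h4
  · linarith [p.orient_neg_of_cw h4]
  · exact h4

theorem orient_ne_zero {a b c : Fin N} (h1 : a ≠ b) (h2 : b ≠ c) (h3 : a ≠ c) :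
    orient (p.pt a) (p.pt b) (p.pt c) ≠ 0 := by
  rcases cw_total h1 h2 h3 with h | h
  · exact (p.orient_neg_of_cw h).ne
  · exact (p.orient_pos_of_cw h).ne'

theorem pt_mem_hull {e : Finset (Fin N)} {a : Fin N} (ha : a ∈ e) : p.pt a ∈ p.hull e :=
  subset_convexHull ℝ _ ⟨a, ha, rfl⟩

/-- Two diagonals whose ends interleave meet in a point that is not a vertex. -/
theorem exists_mem_hull_of_cross {e f : Finset (Fin N)} {a b c d : Fin N} (ha : a ∈ e)
    (hc : c ∈ e) (hb : b ∈ f) (hd : d ∈ f) (h1 : cw a b c) (h2 : cw c d a) :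
    ∃ z, z ∈ p.hull e ∧ z ∈ p.hull f ∧ ∀ v, z ≠ p.pt v := by
  have hac : a ≠ c := by rintro rfl; simp only [cw] at h1; omega
  have hbd : b ≠ d := by rintro rfl; simp only [cw] at h1 h2; omega
  set A := p.pt a with hA
  set B := p.pt b with hB
  set C := p.pt c with hC
  set D := p.pt d with hD
  have o1 : 0 < orient A C B := p.orient_pos_of_cw h1
  have o2 : orient A C D < 0 := p.orient_neg_of_cw (cw_rot (cw_rot h2))
  have o3 : 0 < orient B D C :=
    p.orient_pos_of_cw (by simp only [cw] at *; omega)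
  have o4 : orient B D A < 0 := p.orient_neg_of_cw (by simp only [cw] at *; omega)
  have hsum : orient A C B - orient A C D = orient B D C - orient B D A := by
    simp only [orient]; ring
  set S := orient A C B - orient A C D with hS
  have hS0 : 0 < S := by linarith
  -- The intersection point written on both diagonals: each end is weighted by the area that the
  -- opposite end spans with the other diagonal, and `S` normalizes both.
  have e1 : (-orient A C D / S) • B + (orient A C B / S) • D =
      (orient B D C / S) • A + (-orient B D A / S) • C := by
    have h : (-orient A C D) • B + (orient A C B) • D =
        (orient B D C) • A + (-orient B D A) • C := by
      ext <;> simp only [Prod.fst_add, Prod.snd_add, Prod.smul_fst, Prod.smul_snd, smul_eq_mul,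
        orient] <;> ring
    have h' := congrArg (fun z => S⁻¹ • z) h
    simp only [smul_add, smul_smul] at h'
    simpa only [div_eq_inv_mul] using h'
  have w1 : -orient A C D / S + orient A C B / S = 1 := by
    rw [← add_div, div_eq_one_iff_eq hS0.ne']; linarith
  have w2 : orient B D C / S + -orient B D A / S = 1 := by
    rw [← add_div, div_eq_one_iff_eq hS0.ne']; linarith
  have zero1 : orient A C ((orient B D C / S) • A + (-orient B D A / S) • C) = 0 := by
    rw [orient_combo _ _ _ _ _ _ w2, orient_self_left, orient_self_right]; ring
  have zero2 : orient B D ((-orient A C D / S) • B + (orient A C B / S) • D) = 0 := by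
    rw [orient_combo _ _ _ _ _ _ w1, orient_self_left, orient_self_right]; ring
  refine ⟨(-orient A C D / S) • B + (orient A C B / S) • D, ?_, ?_, ?_⟩
  · rw [e1]
    exact (convex_convexHull ℝ _) (p.pt_mem_hull ha) (p.pt_mem_hull hc) (div_nonneg o3.le hS0.le)
      (div_nonneg (by linarith) hS0.le) w2
  · exact (convex_convexHull ℝ _) (p.pt_mem_hull hb) (p.pt_mem_hull hd) (div_nonneg (by linarith) hS0.le)
      (div_nonneg o1.le hS0.le) w1
  -- A vertex at this point would be on both lines; no three vertices are collinear, so it would be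
  -- an end of both diagonals.
  · intro v hv
    rw [← e1, hv] at zero1
    rw [hv] at zero2
    have hv1 : v = a ∨ v = c := by
      by_contra! h
      exact p.orient_ne_zero hac h.2.symm h.1.symm zero1
    have hv2 : v = b ∨ v = d := by
      by_contra! h
      exact p.orient_ne_zero hbd h.2.symm h.1.symm zero2
    simp only [cw] at h1 h2
    omega

theorem hull_subset_nonneg {e : Finset (Fin N)} {a b : Fin N}
    (he : ∀ x ∈ e, 0 ≤ orient (p.pt a) (p.pt b) (p.pt x)) :
    p.hull e ⊆ {z | 0 ≤ orient (p.pt a) (p.pt b) z} := by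
  refine convexHull_min ?_ ?_
  · rintro _ ⟨x, hx, rfl⟩; exact he x hx
  · intro x hx y hy s t hs ht hst
    simp only [Set.mem_ofPred_eq] at *
    rw [orient_combo _ _ _ _ _ _ hst]
    positivity

/-- A set of vertices on one closed side of a line is separated from a set on the open other
side. -/
theorem noncrossing_of_orient {e f : Finset (Fin N)} {a b : Fin N}
    (he : ∀ x ∈ e, 0 ≤ orient (p.pt a) (p.pt b) (p.pt x))
    (hf : ∀ x ∈ f, orient (p.pt a) (p.pt b) (p.pt x) < 0) :
    p.Noncrossing e f := by
  have h2 : p.hull f ⊆ {z | orient (p.pt a) (p.pt b) z < 0} := by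
    refine convexHull_min ?_ ?_
    · rintro _ ⟨x, hx, rfl⟩; exact hf x hx
    · intro x hx y hy s t hs ht hst
      simp only [Set.mem_ofPred_eq] at *
      rw [orient_combo _ _ _ _ _ _ hst]
      rcases hs.eq_or_lt with rfl | hs
      · obtain rfl : t = 1 := by linarith
        linarith
      · nlinarith [mul_neg_of_pos_of_neg hs hx, mul_nonpos_of_nonneg_of_nonpos ht hy.le]
  refine Set.disjoint_left.2 fun z h1 h3 => ?_
  have h4 : 0 ≤ orient (p.pt a) (p.pt b) z := p.hull_subset_nonneg he h1
  exact absurd h4 (not_le.2 (h2 h3))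

/-- A set of vertices on one closed side of a line and a set on the other side of which only one
vertex is on the line. -/
theorem hull_inter_subset_of_orient {e f : Finset (Fin N)} {a b v : Fin N}
    (hv0 : orient (p.pt a) (p.pt b) (p.pt v) ≤ 0)
    (he : ∀ x ∈ e, 0 ≤ orient (p.pt a) (p.pt b) (p.pt x))
    (hf : ∀ x ∈ f, x = v ∨ orient (p.pt a) (p.pt b) (p.pt x) < 0) :
    p.hull e ∩ p.hull f ⊆ {p.pt v} := by
  have h2 : p.hull f ⊆ {z | z = p.pt v ∨ orient (p.pt a) (p.pt b) z < 0} := by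
    refine convexHull_min ?_ ?_
    · rintro _ ⟨x, hx, rfl⟩
      exact (hf x hx).imp (fun h => by rw [h]) id
    -- An open half-plane together with one point of its closure is convex: a combination that uses
    -- an interior point is interior.
    · have key : ∀ x y : ℝ × ℝ, (x = p.pt v ∨ orient (p.pt a) (p.pt b) x < 0) →
          orient (p.pt a) (p.pt b) y < 0 → ∀ s t : ℝ, 0 ≤ s → 0 ≤ t → s + t = 1 →
          (s • x + t • y = p.pt v ∨ orient (p.pt a) (p.pt b) (s • x + t • y) < 0) := by
        intro x y hx hy s t hs ht hst
        have hx' : orient (p.pt a) (p.pt b) x ≤ 0 := by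
          rcases hx with rfl | hx
          · exact hv0
          · exact hx.le
        rcases ht.eq_or_lt with rfl | ht
        · have : s = 1 := by linarith
          subst this
          simpa using hx
        · right
          rw [orient_combo _ _ _ _ _ _ hst]
          nlinarith [mul_neg_of_pos_of_neg ht hy, mul_nonpos_of_nonneg_of_nonpos hs hx']
      intro x hx y hy s t hs ht hst
      simp only [Set.mem_ofPred_eq] at *
      rcases hy with rfl | hy
      · rcases hx with rfl | hx
        · left; rw [← add_smul, hst, one_smul]
        · rw [add_comm]
          exact key _ _ (Or.inl rfl) hx t s ht hs (by linarith)
      · exact key _ _ hx hy s t hs ht hst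
  rintro z ⟨hz1, hz2⟩
  rcases h2 hz2 with h | h
  · exact h
  · exact absurd (p.hull_subset_nonneg he hz1) (not_le.2 h)

end ConvexPolygon

/-! ### Gaps, and noncrossing as the absence of interleaving. -/

/-- The clockwise distance from `b` to `x`. -/
def cdist (b x : Fin N) : ℕ :=
  if b ≤ x then (x : ℕ) - b else (x : ℕ) + N - b

/-- The first element of a set in clockwise order starting from a given vertex. -/
theorem exists_cw_first {e : Finset (Fin N)} (he : e.Nonempty) (b : Fin N) :
    ∃ v ∈ e, ∀ x ∈ e, v = b ∨ x = v ∨ cw b v x := by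
  obtain ⟨v, hv, h⟩ := Finset.exists_min_image e (cdist b) he
  refine ⟨v, hv, fun x hx => ?_⟩
  have := h x hx
  simp only [cdist, cw] at *
  split_ifs at * <;> omega

/-- The last element of a set in clockwise order starting from a given vertex. -/
theorem exists_cw_last {e : Finset (Fin N)} (he : e.Nonempty) (b : Fin N) :
    ∃ v ∈ e, ∀ x ∈ e, x = b ∨ x = v ∨ cw b x v := by
  obtain ⟨v, hv, h⟩ := Finset.exists_max_image e (cdist b) he
  refine ⟨v, hv, fun x hx => ?_⟩
  have := h x hx
  simp only [cdist, cw] at *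
  split_ifs at * <;> omega

/-- Two sets of vertices interleave when a diagonal of the first crosses a diagonal of the
second. -/
def Interleave (e f : Finset (Fin N)) : Prop :=
  ∃ a ∈ e, ∃ b ∈ f, ∃ c ∈ e, ∃ d ∈ f, cw a b c ∧ cw c d a

theorem Interleave.symm {e f : Finset (Fin N)} (h : Interleave e f) : Interleave f e := by
  obtain ⟨a, ha, b, hb, c, hc, d, hd, h1, h2⟩ := h
  exact ⟨b, hb, c, hc, d, hd, a, ha, by simp only [cw] at *; omega, by simp only [cw] at *; omega⟩

/-- A vertex outside of `e` lies in a gap of `e`. -/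
theorem exists_gap {e : Finset (Fin N)} {b : Fin N} (he : 2 ≤ e.card) (hb : b ∉ e) :
    ∃ v ∈ e, ∃ u ∈ e, cw u b v ∧ ∀ x ∈ e, x = v ∨ x = u ∨ cw v x u := by
  have hne : e.Nonempty := Finset.card_pos.1 (by omega)
  obtain ⟨v, hv, h1⟩ := exists_cw_first hne b
  obtain ⟨u, hu, h2⟩ := exists_cw_last hne b
  have hx : ∀ x ∈ e, x ≠ b := fun x hx h => hb (h ▸ hx)
  obtain ⟨y, hy, hyv⟩ := Finset.exists_mem_ne (s := e) (by omega) v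
  have h3 := h1 y hy
  have h4 := h2 y hy
  have h5 := h2 v hv
  have := hx v hv
  have := hx u hu
  have := hx y hy
  refine ⟨v, hv, u, hu, by simp only [cw] at *; omega, fun x hxe => ?_⟩
  have h6 := h1 x hxe
  have h7 := h2 x hxe
  have := hx x hxe
  simp only [cw] at *
  omega

namespace ConvexPolygon

variable (p : ConvexPolygon N)

theorem Noncrossing.symm {p : ConvexPolygon N} {e f : Finset (Fin N)} (h : p.Noncrossing e f) :
    p.Noncrossing f e :=
  Disjoint.symm h

theorem Noncrossing.not_interleave {p : ConvexPolygon N} {e f : Finset (Fin N)}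
    (h : p.Noncrossing e f) : ¬ Interleave e f := by
  rintro ⟨a, ha, b, hb, c, hc, d, hd, h1, h2⟩
  obtain ⟨z, hz1, hz2, -⟩ := p.exists_mem_hull_of_cross ha hc hb hd h1 h2
  exact Set.disjoint_left.1 h hz1 hz2

theorem WeaklyNoncrossing.not_interleave {p : ConvexPolygon N} {e f : Finset (Fin N)}
    (h : p.WeaklyNoncrossing e f) : ¬ Interleave e f := by
  rintro ⟨a, ha, b, hb, c, hc, d, hd, h1, h2⟩
  obtain ⟨z, hz1, hz2, hz⟩ := p.exists_mem_hull_of_cross ha hc hb hd h1 h2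
  obtain ⟨v, hv⟩ := h
  exact hz v (hv ⟨hz1, hz2⟩)

theorem WeaklyNoncrossing.eq_of_mem {p : ConvexPolygon N} {e f : Finset (Fin N)}
    (h : p.WeaklyNoncrossing e f) {a b : Fin N} (hae : a ∈ e) (haf : a ∈ f) (hbe : b ∈ e)
    (hbf : b ∈ f) : a = b := by
  obtain ⟨v, hv⟩ := h
  have key : ∀ c, c ∈ e → c ∈ f → p.pt c = p.pt v := fun c h1 h2 =>
    hv ⟨subset_convexHull ℝ _ ⟨c, h1, rfl⟩, subset_convexHull ℝ _ ⟨c, h2, rfl⟩⟩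
  exact p.injective ((key a hae haf).trans (key b hbe hbf).symm)

/-- A vertex of `f` outside `e` lies in a gap of `e`; without interleaving all of `f` stays in that
closed gap, so the chord across the gap separates the hulls. At most one end of the chord belongs to
`f`, and only there can the hulls meet. -/
theorem weaklyNoncrossing_of_not_interleave {e f : Finset (Fin N)} (he : 2 ≤ e.card)
    (hf : 2 ≤ f.card) (h : ¬ Interleave e f)
    (h1 : ∀ a ∈ e, a ∈ f → ∀ b ∈ e, b ∈ f → a = b) : p.WeaklyNoncrossing e f := by
  obtain ⟨b, hb, hbe⟩ : ∃ b ∈ f, b ∉ e := by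
    by_contra! hsub
    obtain ⟨x, hx, y, hy, hxy⟩ := Finset.one_lt_card.1 hf
    exact hxy (h1 x (hsub x hx) hx y (hsub y hy) hy)
  obtain ⟨v, hv, u, hu, hg, hall⟩ := exists_gap he hbe
  have hvu : v ≠ u := by rintro rfl; simp only [cw] at hg; omega
  have hd : ∀ d ∈ f, d = v ∨ d = u ∨ cw u d v := by
    intro d hdf
    by_contra! hc
    refine h ⟨u, hu, b, hb, v, hv, d, hdf, hg, ?_⟩
    have := cw_total hvu (Ne.symm hc.2.1) (Ne.symm hc.1)
    simp only [cw] at *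
    omega
  have hpos : ∀ x ∈ e, 0 ≤ orient (p.pt v) (p.pt u) (p.pt x) := by
    intro x hx
    rcases hall x hx with rfl | rfl | h2
    · rw [orient_self_left]
    · rw [orient_self_right]
    · exact (p.orient_pos_of_cw h2).le
  by_cases hvf : v ∈ f
  · refine ⟨v, p.hull_inter_subset_of_orient (orient_self_left _ _).le hpos fun x hx => ?_⟩
    rcases hd x hx with rfl | rfl | h2
    · exact Or.inl rfl
    · exact Or.inl (h1 _ hu hx _ hv hvf)
    · exact Or.inr (p.orient_neg_of_cw (cw_rot (cw_rot h2)))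
  · refine ⟨u, p.hull_inter_subset_of_orient (orient_self_right _ _).le hpos fun x hx => ?_⟩
    rcases hd x hx with rfl | rfl | h2
    · exact absurd hx hvf
    · exact Or.inl rfl
    · exact Or.inr (p.orient_neg_of_cw (cw_rot (cw_rot h2)))

/-- The same separation by a chord; disjointness keeps `f` off the ends of the chord, hence strictly
on one side. -/
theorem noncrossing_of_not_interleave_of_two_le {e f : Finset (Fin N)} (he : 2 ≤ e.card)
    (hf : f.Nonempty) (h : ¬ Interleave e f) (h1 : Disjoint e f) : p.Noncrossing e f := by
  obtain ⟨b, hb⟩ := hf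
  have hne : ∀ d ∈ f, d ∉ e := fun d hd hde => Finset.disjoint_left.1 h1 hde hd
  obtain ⟨v, hv, u, hu, hg, hall⟩ := exists_gap he (hne b hb)
  refine p.noncrossing_of_orient (a := v) (b := u) ?_ ?_
  · intro x hx
    rcases hall x hx with rfl | rfl | h2
    · rw [orient_self_left]
    · rw [orient_self_right]
    · exact (p.orient_pos_of_cw h2).le
  · intro d hdf
    refine p.orient_neg_of_cw ?_
    by_contra hc
    have h3 : d ≠ u := fun h => hne d hdf (h ▸ hu)
    have h4 : d ≠ v := fun h => hne d hdf (h ▸ hv)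
    refine h ⟨u, hu, b, hb, v, hv, d, hdf, hg, ?_⟩
    simp only [cw] at *
    omega

theorem noncrossing_of_not_interleave {e f : Finset (Fin N)} (he : e.Nonempty)
    (hf : f.Nonempty) (h : ¬ Interleave e f) (h1 : Disjoint e f) : p.Noncrossing e f := by
  by_cases he2 : 2 ≤ e.card
  · exact p.noncrossing_of_not_interleave_of_two_le he2 hf h h1
  by_cases hf2 : 2 ≤ f.card
  · exact (p.noncrossing_of_not_interleave_of_two_le hf2 he (fun hi => h hi.symm) h1.symm).symm
  have := he.card_pos
  have := hf.card_pos
  obtain ⟨x, rfl⟩ := Finset.card_eq_one.1 (show e.card = 1 by omega)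
  obtain ⟨y, rfl⟩ := Finset.card_eq_one.1 (show f.card = 1 by omega)
  have hxy : x ≠ y := by simpa using h1
  simpa [Noncrossing, hull] using fun h => hxy (p.injective h)

end ConvexPolygon

end Cyclic

end NCHT
end

noncomputable section

namespace NCHT

/-! ### Connectivity in hypergraphs -/

section Connectivity

/-- A discrete intermediate value principle: with `P` a side of a diagonal it finds the hyperedge of
a path that jumps over the diagonal. -/
theorem exists_step {V : Type} {r : V → V → Prop} {x y : V} (h : Relation.ReflTransGen r x y)
    {P : V → Prop} (hx : P x) (hy : ¬ P y) :
    ∃ a b, Relation.ReflTransGen r x a ∧ r a b ∧ P a ∧ ¬ P b := by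
  induction h with
  | refl => exact absurd hx hy
  | @tail b c hb hbc ih =>
    by_cases hPb : P b
    · exact ⟨b, c, hb, hbc, hPb, hy⟩
    · exact ih hPb

variable {V : Type} {E F : Finset (Finset V)} {a b c v : V}

/-- The vertices `a` and `b` are joined by a path of hyperedges in `E`. -/
def Conn (E : Finset (Finset V)) : V → V → Prop :=
  Relation.ReflTransGen fun a b => ∃ e ∈ E, a ∈ e ∧ b ∈ e

/-- The vertices `a` and `b` are joined by a path of hyperedges in `E` that does not stop
at `v`. -/
def ConnAvoid (E : Finset (Finset V)) (v : V) : V → V → Prop :=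
  Relation.ReflTransGen fun a b => a ≠ v ∧ b ≠ v ∧ ∃ e ∈ E, a ∈ e ∧ b ∈ e

theorem Conn.symm (h : Conn E a b) : Conn E b a := by
  induction h with
  | refl => exact Relation.ReflTransGen.refl
  | tail _ h ih =>
    obtain ⟨e, he, h1, h2⟩ := h
    exact Relation.ReflTransGen.head ⟨e, he, h2, h1⟩ ih

theorem ConnAvoid.symm (h : ConnAvoid E v a b) : ConnAvoid E v b a := by
  induction h with
  | refl => exact Relation.ReflTransGen.refl
  | tail _ h ih =>
    obtain ⟨h1, h2, e, he, h3, h4⟩ := h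
    exact Relation.ReflTransGen.head ⟨h2, h1, e, he, h4, h3⟩ ih

theorem Conn.trans (h : Conn E a b) (h' : Conn E b c) : Conn E a c :=
  Relation.ReflTransGen.trans h h'

theorem Conn.single {e : Finset V} (he : e ∈ E) (ha : a ∈ e) (hb : b ∈ e) : Conn E a b :=
  Relation.ReflTransGen.single ⟨e, he, ha, hb⟩

theorem Conn.mono (h : Conn E a b) (hEF : E ⊆ F) : Conn F a b := by
  induction h with
  | refl => exact Relation.ReflTransGen.refl
  | tail _ h ih =>
    obtain ⟨e, he, h1, h2⟩ := h
    exact ih.tail ⟨e, hEF he, h1, h2⟩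

theorem ConnAvoid.mono (h : ConnAvoid E v a b) (hEF : E ⊆ F) : ConnAvoid F v a b := by
  induction h with
  | refl => exact Relation.ReflTransGen.refl
  | tail _ h ih =>
    obtain ⟨h1, h2, e, he, h3, h4⟩ := h
    exact ih.tail ⟨h1, h2, e, hEF he, h3, h4⟩

theorem ConnAvoid.conn (h : ConnAvoid E v a b) : Conn E a b := by
  induction h with
  | refl => exact Relation.ReflTransGen.refl
  | tail _ h ih =>
    obtain ⟨_, _, h1⟩ := h
    exact ih.tail h1

theorem ConnAvoid.ne (h : ConnAvoid E v a b) (ha : a ≠ v) : b ≠ v := by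
  induction h with
  | refl => exact ha
  | tail _ h _ => exact h.2.1

theorem conn_empty (h : Conn (∅ : Finset (Finset V)) a b) : a = b := by
  induction h with
  | refl => rfl
  | tail _ h _ => obtain ⟨e, he, -⟩ := h; simp at he

/-- A path into `v` has a last hyperedge. -/
theorem Conn.exists_last (h : Conn E a v) (hav : a ≠ v) :
    ∃ e ∈ E, v ∈ e ∧ ∃ y ∈ e, y ≠ v ∧ ConnAvoid E v a y := by
  induction h using Relation.ReflTransGen.head_induction_on with
  | refl => exact absurd rfl hav
  | @head a c h1 _ ih =>
    obtain ⟨e, he, hae, hce⟩ := h1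
    by_cases hcv : c = v
    · exact ⟨e, he, hcv ▸ hce, a, hae, hav, Relation.ReflTransGen.refl⟩
    · obtain ⟨f, hf, hvf, y, hy, hyv, hcy⟩ := ih hcv
      exact ⟨f, hf, hvf, y, hy, hyv,
        Relation.ReflTransGen.head ⟨hav, hcv, e, he, hae, hce⟩ hcy⟩

open Fin.NatCast Fin.CommRing in
/-- Along a cycle, the two vertices of one of its hyperedges are joined by the others. -/
theorem conn_of_cycle {k : ℕ} {w : Fin (k + 2) → V} {e : Fin (k + 2) → Finset V}
    (h : ∀ i, w i ∈ e i ∧ w (i + 1) ∈ e i) (i : Fin (k + 2)) (hE : ∀ j, j ≠ i → e j ∈ E) :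
    Conn E (w (i + 1)) (w i) := by
  have key : ∀ m : ℕ, m ≤ k + 1 → Conn E (w (i + 1)) (w (i + 1 + (Nat.cast m : Fin (k + 2)))) := by
    intro m
    induction m with
    | zero => intro _; simp only [Nat.cast_zero, add_zero]; exact Relation.ReflTransGen.refl
    | succ m ih =>
      intro hm
      refine (ih (by omega)).trans ?_
      have h1 := h (i + 1 + (Nat.cast m : Fin (k + 2)))
      rw [Nat.cast_succ, ← add_assoc]
      refine Conn.single (hE _ fun h2 => ?_) h1.1 h1.2
      have h3 : (Nat.cast (m + 1) : Fin (k + 2)) = 0 := by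
        rw [add_assoc, add_comm 1, ← Nat.cast_succ] at h2
        simpa using h2
      have h4 := congrArg Fin.val h3
      rw [Fin.val_natCast, Nat.mod_eq_of_lt (by omega)] at h4
      simp at h4
  have h1 := key (k + 1) le_rfl
  have h2 : i + 1 + (Nat.cast (k + 1) : Fin (k + 2)) = i := by
    have h3 : (Nat.cast (k + 1) : Fin (k + 2)) + 1 = 0 := by
      rw [← Nat.cast_succ]; exact Fin.natCast_self (k + 2)
    rw [add_assoc, add_comm 1, h3, add_zero]
  rwa [h2] at h1

/-! ### Hyperforests in terms of connectivity. -/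

variable [DecidableEq V]

/-- A path that avoids `v` and meets `e` can be followed until it first meets `e`. -/
theorem ConnAvoid.exists_first_mem {e : Finset V} (h : ConnAvoid E v a b) (hb : b ∈ e) :
    ∃ z ∈ e, ConnAvoid (E.erase e) v a z := by
  induction h using Relation.ReflTransGen.head_induction_on with
  | refl => exact ⟨b, hb, Relation.ReflTransGen.refl⟩
  | @head a c h1 _ ih =>
    obtain ⟨h1, h2, f, hf, haf, hcf⟩ := h1
    by_cases hae : a ∈ e
    · exact ⟨a, hae, Relation.ReflTransGen.refl⟩
    · obtain ⟨z, hz, hcz⟩ := ih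
      refine ⟨z, hz, Relation.ReflTransGen.head
        ⟨h1, h2, f, Finset.mem_erase.2 ⟨?_, hf⟩, haf, hcf⟩ hcz⟩
      rintro rfl
      exact hae haf

/-- In a hyperforest two vertices of a hyperedge are not joined by other hyperedges. -/
theorem Hypergraph.IsHyperforest.eq_of_conn {τ : Hypergraph V} (hτ : τ.IsHyperforest)
    {e : Finset V} (he : e ∈ τ.edges) (ha : a ∈ e) (hb : b ∈ e)
    (h : Conn (τ.edges.erase e) a b) : a = b := by
  classical
  by_contra hab
  -- A shortest walk from `a` to `b` in the other hyperedges repeats neither a vertex nor a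
  -- hyperedge, since it could be shortened; together with `e` it is a simple cycle.
  let P : ℕ → Prop := fun m => ∃ v : ℕ → V, v 0 = a ∧ v m = b ∧
    ∀ i < m, ∃ f ∈ τ.edges.erase e, v i ∈ f ∧ v (i + 1) ∈ f
  have hP : ∃ m, P m := by
    clear hab hb
    induction h with
    | refl => exact ⟨0, fun _ => a, rfl, rfl, by simp⟩
    | @tail c d _ hcd ih =>
      obtain ⟨m, v, h0, hm, hv⟩ := ih
      refine ⟨m + 1, fun i => if i ≤ m then v i else d, by simp [h0], by simp, fun i hi => ?_⟩
      rcases Nat.lt_succ_iff_lt_or_eq.1 hi with hi | rfl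
      · simpa [hi.le, Nat.succ_le_of_lt hi] using hv i hi
      · simpa [hm] using hcd
  obtain ⟨v, h0, hm, hv⟩ := Nat.find_spec hP
  set m := Nat.find hP with hmdef
  have hmin : ∀ l, P l → m ≤ l := fun l hl => Nat.find_min' hP hl
  have hm0 : m ≠ 0 := by rintro h; rw [h, h0] at hm; exact hab hm
  have shortcut : ∀ i j, i < j → j < m → (∃ f ∈ τ.edges.erase e, v i ∈ f ∧ v (j + 1) ∈ f) →
      False := by
    intro i j hij hjm hf
    have : P (m - (j - i)) := by
      refine ⟨fun t => if t ≤ i then v t else v (t + (j - i)), by simp [h0], ?_, fun t ht => ?_⟩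
      · have h1 : ¬ m - (j - i) ≤ i := by omega
        have h2 : m - (j - i) + (j - i) = m := by omega
        simp [h1, h2, hm]
      · rcases lt_trichotomy t i with h | rfl | h
        · simpa [h.le, Nat.succ_le_of_lt h] using hv t (by omega)
        · have h2 : t + 1 + (j - t) = j + 1 := by omega
          simpa [h2] using hf
        · have h1 : ¬ t ≤ i := by omega
          have h2 : ¬ t + 1 ≤ i := by omega
          have h3 : t + 1 + (j - i) = t + (j - i) + 1 := by omega
          simpa [h1, h2, h3] using hv (t + (j - i)) (by omega)
    have := hmin _ this
    omega
  have hvinj : ∀ i j, i < j → j ≤ m → v i ≠ v j := by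
    intro i j hij hjm h
    rcases hjm.eq_or_lt with rfl | hjm
    · have := hmin i ⟨v, h0, h.trans hm, fun t ht => hv t (by omega)⟩
      omega
    · obtain ⟨f, hf, h1, h2⟩ := hv j hjm
      exact shortcut i j hij hjm ⟨f, hf, h ▸ h1, h2⟩
  choose! f hf hf1 hf2 using hv
  have hfinj : ∀ i j, i < j → j < m → f i ≠ f j := by
    intro i j hij hjm h
    exact shortcut i j hij hjm ⟨f i, hf i (by omega), hf1 i (by omega), h ▸ hf2 j hjm⟩
  -- The cycle consists of the `m` hyperedges of the walk and of `e`, so its length is `m + 1 = k +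
  -- 2`.
  obtain ⟨k, hk⟩ : ∃ k, m = k + 1 := ⟨m - 1, by omega⟩
  refine hτ ⟨k, fun i => v i, fun i => if (i : ℕ) < m then f i else e, ?_, ?_, ?_⟩
  · intro i j hij
    by_contra hne
    rcases lt_or_gt_of_ne hne with h | h
    · exact hvinj i j h (by omega) hij
    · exact hvinj j i h (by omega) hij.symm
  · intro i j hij
    have h1 : ∀ i : Fin (k + 2), (i : ℕ) < m → f i ≠ e := fun i hi =>
      (Finset.mem_erase.1 (hf i hi)).1
    by_contra hne
    by_cases hi : (i : ℕ) < m <;> by_cases hj : (j : ℕ) < m <;> simp only [hi, hj, if_true,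
      if_false] at hij
    · rcases lt_or_gt_of_ne hne with h | h
      · exact hfinj i j h hj hij
      · exact hfinj j i h hi hij.symm
    · exact h1 i hi hij
    · exact h1 j hj hij.symm
    · omega
  · intro i
    by_cases hi : (i : ℕ) < m
    · have h1 : ((i + 1 : Fin (k + 2)) : ℕ) = i + 1 := by
        rw [Fin.val_add_one_of_lt]
        rw [Fin.lt_def]; simp; omega
      simp only [hi, if_true, h1]
      exact ⟨(Finset.mem_erase.1 (hf i hi)).2, hf1 i hi, hf2 i hi⟩
    · have h1 : i = Fin.last (k + 1) := by ext; simp; omega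
      subst h1
      simp [hk] at hi ⊢
      exact ⟨he, by rw [← hk, hm]; exact hb, by rw [h0]; exact ha⟩

/-- Converse of `eq_of_conn`: a hyperedge of a cycle contains two distinct vertices that the rest of
the cycle joins. -/
theorem Hypergraph.isHyperforest_of_eq_of_conn {τ : Hypergraph V}
    (h : ∀ e ∈ τ.edges, ∀ a ∈ e, ∀ b ∈ e, Conn (τ.edges.erase e) a b → a = b) :
    τ.IsHyperforest := by
  rintro ⟨k, w, e, hw, he, hc⟩
  have h1 := h (e 0) (hc 0).1 (w (0 + 1)) (hc 0).2.2 (w 0) (hc 0).2.1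
    (conn_of_cycle (fun i => (hc i).2) 0 fun j hj =>
      Finset.mem_erase.2 ⟨fun h => hj (he h), (hc j).1⟩)
  have h2 := hw h1
  simp at h2

/-- A hypergraph is a hyperforest when its hyperedges can be added one at a time without closing
a cycle. -/
theorem Hypergraph.isHyperforest_of_order {τ : Hypergraph V} {k : ℕ} (e : Fin k → Finset V)
    (hτ : ∀ f ∈ τ.edges, ∃ i, e i = f)
    (h : ∀ j, ∀ a ∈ e j, ∀ b ∈ e j, Conn (Finset.image e {i | i < j}) a b → a = b) :
    τ.IsHyperforest := by
  rintro ⟨l, w, f, hw, hf, hc⟩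
  choose idx hidx using fun t => hτ (f t) (hc t).1
  -- The hyperedge of the cycle that is added last closes a path of earlier ones.
  obtain ⟨t, -, ht⟩ := Finset.exists_max_image Finset.univ idx Finset.univ_nonempty
  have h1 := h (idx t) (w (t + 1)) (by rw [hidx]; exact (hc t).2.2) (w t)
    (by rw [hidx]; exact (hc t).2.1) (conn_of_cycle (fun i => (hc i).2) t fun j hj => ?_)
  · have h2 := hw h1
    simp at h2
  · refine Finset.mem_image.2 ⟨idx j, ?_, hidx j⟩
    simp only [Finset.mem_filter, Finset.mem_univ, true_and]
    refine lt_of_le_of_ne (ht j (Finset.mem_univ _)) fun h2 => hj (hf ?_)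
    rw [← hidx j, h2, hidx t]

end Connectivity

end NCHT
end

noncomputable section

namespace NCHT

/-! ### Cuts of noncrossing hypertrees -/

section Cuts

variable {N : ℕ} {p : ConvexPolygon N}

instance (a b c : Fin N) : Decidable (cw a b c) := by
  unfold cw; infer_instance

/-- The vertices from `v` clockwise to `u`. -/
def arc (v u : Fin N) : Finset (Fin N) := {x | x = v ∨ x = u ∨ cw v x u}

/-- The vertices from the one after `u` clockwise to `v`. -/
def coarc (v u : Fin N) : Finset (Fin N) := {x | x = v ∨ cw u x v}

theorem mem_arc {v u x : Fin N} : x ∈ arc v u ↔ x = v ∨ x = u ∨ cw v x u := by simp [arc]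

theorem mem_coarc {v u x : Fin N} : x ∈ coarc v u ↔ x = v ∨ cw u x v := by simp [coarc]

theorem mem_arc_or_mem_coarc {v u : Fin N} (h : u ≠ v) (x : Fin N) : x ∈ arc v u ∨ x ∈ coarc v u := by
  rw [mem_arc, mem_coarc]; simp only [cw]; omega

theorem eq_of_mem_arc_of_mem_coarc {v u x : Fin N} (h1 : x ∈ arc v u) (h2 : x ∈ coarc v u) :
    x = v := by
  rw [mem_arc] at h1; rw [mem_coarc] at h2; simp only [cw] at *; omega

/-- Every hyperedge lies on one side of the line through `v` that separates `u` from the next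
vertex. -/
def IsCut (E : Finset (Finset (Fin N))) (v u : Fin N) : Prop :=
  ∀ e ∈ E, e ⊆ arc v u ∨ e ⊆ coarc v u

/-- The two sides share only `v`, so any other vertex of `e` decides its side. -/
theorem IsCut.subset_arc_iff {E : Finset (Finset (Fin N))} {v u y : Fin N} (h : IsCut E v u)
    {e : Finset (Fin N)} (he : e ∈ E) (hy : y ∈ e) (hyv : y ≠ v) :
    e ⊆ arc v u ↔ y ∈ arc v u := by
  refine ⟨fun h1 => h1 hy, fun h1 => (h e he).resolve_right fun h2 => ?_⟩
  exact hyv (eq_of_mem_arc_of_mem_coarc h1 (h2 hy))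

/-- A path can change sides only at `v`. -/
theorem IsCut.mem_arc_iff_of_connAvoid {E : Finset (Finset (Fin N))} {v u a b : Fin N}
    (h : IsCut E v u) (hab : ConnAvoid E v a b) : a ∈ arc v u ↔ b ∈ arc v u := by
  induction hab with
  | refl => rfl
  | tail _ hbc ih =>
    obtain ⟨h1, h2, e, he, hb, hc⟩ := hbc
    rw [ih, ← h.subset_arc_iff he hb h1, h.subset_arc_iff he hc h2]

/-- From `v`, the set `e` is entirely to the left of `f`. -/
def LeftFrom (v : Fin N) (e f : Finset (Fin N)) : Prop :=
  ∀ a ∈ e, ∀ b ∈ f, a ≠ v → b ≠ v → cw v a b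

theorem leftOf_iff {v : Fin N} {e f : Finset (Fin N)} : p.LeftOf v e f ↔ LeftFrom v e f := by
  simp only [ConvexPolygon.LeftOf, LeftFrom, p.orient_pos_iff]

theorem exists_ne_of_two_le {e : Finset (Fin N)} (he : 2 ≤ e.card) (v : Fin N) :
    ∃ a ∈ e, a ≠ v :=
  Finset.exists_mem_ne (by omega) v

namespace NCHypertree

variable (τ : NCHypertree p)

theorem two_le {e : Finset (Fin N)} (he : e ∈ τ.edges) : 2 ≤ e.card := τ.1.two_le e he

theorem conn (a b : Fin N) : Conn τ.edges a b := τ.2.1.1 a b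

theorem not_interleave {e f : Finset (Fin N)} (he : e ∈ τ.edges) (hf : f ∈ τ.edges)
    (hef : e ≠ f) : ¬ Interleave e f :=
  (τ.2.2 e he f hf hef).not_interleave

theorem eq_of_mem {e f : Finset (Fin N)} (he : e ∈ τ.edges) (hf : f ∈ τ.edges)
    (hef : e ≠ f) {a b : Fin N} (h1 : a ∈ e) (h2 : a ∈ f) (h3 : b ∈ e) (h4 : b ∈ f) : a = b :=
  (τ.2.2 e he f hf hef).eq_of_mem h1 h2 h3 h4

theorem eq_of_conn {e : Finset (Fin N)} (he : e ∈ τ.edges) {a b : Fin N} (ha : a ∈ e)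
    (hb : b ∈ e) (h : Conn (τ.edges.erase e) a b) : a = b :=
  τ.2.1.2.eq_of_conn he ha hb h

variable {τ}

/-- Noncrossing hyperedges at a common vertex occupy disjoint sectors, so one pair of vertices
decides their order. -/
theorem leftFrom_of_cw {v a b : Fin N} {e f : Finset (Fin N)} (he : e ∈ τ.edges)
    (hf : f ∈ τ.edges) (hef : e ≠ f) (hve : v ∈ e) (hvf : v ∈ f) (ha : a ∈ e) (hb : b ∈ f)
    (h : cw v a b) : LeftFrom v e f := by
  intro a' ha' b' hb' hav hbv
  by_contra hc
  have hab : a' ≠ b' := by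
    rintro rfl
    exact hav (τ.eq_of_mem he hf hef ha' hb' hve hvf)
  have hab2 : a ≠ b' := by
    rintro rfl
    exact hbv (τ.eq_of_mem he hf hef ha hb' hve hvf)
  have hn := τ.not_interleave he hf hef
  by_cases h1 : cw v a b'
  · exact hn ⟨a, ha, b', hb', a', ha', v, hvf, by simp only [cw] at *; omega,
      by simp only [cw] at *; omega⟩
  · exact hn ⟨a, ha, b, hb, v, hve, b', hb', by simp only [cw] at *; omega,
      by simp only [cw] at *; omega⟩

theorem leftFrom_or {v : Fin N} {e f : Finset (Fin N)} (he : e ∈ τ.edges)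
    (hf : f ∈ τ.edges) (hef : e ≠ f) (hve : v ∈ e) (hvf : v ∈ f) :
    LeftFrom v e f ∨ LeftFrom v f e := by
  obtain ⟨a, ha, hav⟩ := exists_ne_of_two_le (τ.two_le he) v
  obtain ⟨b, hb, hbv⟩ := exists_ne_of_two_le (τ.two_le hf) v
  have hab : a ≠ b := by
    rintro rfl
    exact hav (τ.eq_of_mem he hf hef ha hb hve hvf)
  rcases cw_total hav.symm hab hbv.symm with h | h
  · exact Or.inl (leftFrom_of_cw he hf hef hve hvf ha hb h)
  · exact Or.inr (leftFrom_of_cw hf he hef.symm hvf hve hb ha h)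

theorem not_leftFrom_both {v : Fin N} {e f : Finset (Fin N)} (he : e ∈ τ.edges)
    (hf : f ∈ τ.edges) (h1 : LeftFrom v e f) (h2 : LeftFrom v f e) : False := by
  obtain ⟨a, ha, hav⟩ := exists_ne_of_two_le (τ.two_le he) v
  obtain ⟨b, hb, hbv⟩ := exists_ne_of_two_le (τ.two_le hf) v
  have h3 := h1 a ha b hb hav hbv
  have h4 := h2 b hb a ha hbv hav
  simp only [cw] at *
  omega

theorem ne_of_leftFrom {v : Fin N} {e f : Finset (Fin N)} (he : e ∈ τ.edges)
    (h1 : LeftFrom v e f) : e ≠ f := by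
  rintro rfl
  exact not_leftFrom_both he he h1 h1

end NCHypertree

/-! ### Basic noncrossing hypertrees are cuts -/

theorem two_le_card_arc {v u : Fin N} (h : u ≠ v) : 2 ≤ (arc v u).card :=
  Finset.one_lt_card.2 ⟨u, by simp [mem_arc], v, by simp [mem_arc], h⟩

theorem two_le_card_coarc {v u : Fin N} (h : ∃ x, cw u x v) : 2 ≤ (coarc v u).card := by
  obtain ⟨x, hx⟩ := h
  refine Finset.one_lt_card.2 ⟨x, mem_coarc.2 (Or.inr hx), v, mem_coarc.2 (Or.inl rfl), ?_⟩
  rintro rfl; simp only [cw] at hx; omega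

theorem ne_of_exists_cw {v u : Fin N} (h : ∃ x, cw u x v) : u ≠ v := by
  obtain ⟨x, hx⟩ := h
  rintro rfl; simp only [cw] at hx; omega

theorem arc_ne_coarc {v u u' : Fin N} (h : u ≠ v) (h' : u' ≠ v) : arc v u ≠ coarc v u' := by
  intro h1
  have h2 : u ∈ coarc v u' := h1 ▸ mem_arc.2 (Or.inr (Or.inl rfl))
  have h3 : u' ∉ arc v u := by rw [h1, mem_coarc]; simp only [cw]; omega
  rw [mem_arc] at h3
  rw [mem_coarc] at h2
  simp only [cw] at *
  omega

variable (p) in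
/-- The basic noncrossing hypertree given by a cut. -/
def mkBasic {v u : Fin N} (h : ∃ x, cw u x v) : BasicNCHypertree p :=
  ⟨⟨⟨{arc v u, coarc v u}, by
    intro e he
    rcases Finset.mem_insert.1 he with rfl | he
    · exact two_le_card_arc (ne_of_exists_cw h)
    · rw [Finset.mem_singleton.1 he]; exact two_le_card_coarc h⟩, by
    have hv : ∀ e ∈ ({arc v u, coarc v u} : Finset (Finset (Fin N))), v ∈ e := by
      intro e he
      rcases Finset.mem_insert.1 he with rfl | he
      · simp [mem_arc]
      · rw [Finset.mem_singleton.1 he]; simp [mem_coarc]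
    have hint : ∀ e ∈ ({arc v u, coarc v u} : Finset (Finset (Fin N))),
        ∀ f ∈ ({arc v u, coarc v u} : Finset (Finset (Fin N))), e ≠ f →
        ∀ x ∈ e, x ∈ f → x = v := by
      intro e he f hf hef x hxe hxf
      simp only [Finset.mem_insert, Finset.mem_singleton] at he hf
      rcases he with rfl | rfl <;> rcases hf with rfl | rfl
      · exact absurd rfl hef
      · exact eq_of_mem_arc_of_mem_coarc hxe hxf
      · exact eq_of_mem_arc_of_mem_coarc hxf hxe
      · exact absurd rfl hef
    refine ⟨⟨?_, ?_⟩, ?_⟩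
    · have key : ∀ a, Conn ({arc v u, coarc v u} : Finset (Finset (Fin N))) a v := by
        intro a
        rcases mem_arc_or_mem_coarc (ne_of_exists_cw h) a with ha | ha
        · exact Conn.single (by simp) ha (mem_arc.2 (Or.inl rfl))
        · exact Conn.single (e := coarc v u) (by simp) ha (mem_coarc.2 (Or.inl rfl))
      exact fun a b => (key a).trans (key b).symm
    · refine Hypergraph.isHyperforest_of_eq_of_conn ?_
      intro e he a ha b hb hab
      by_contra hne
      have key : ∀ a ∈ e, ∀ b, Conn (Finset.erase {arc v u, coarc v u} e) a b → a ≠ b →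
          a = v := by
        intro a ha b hab hne
        rcases Relation.ReflTransGen.cases_head hab with h1 | ⟨c, ⟨f, hf, haf, -⟩, -⟩
        · exact absurd h1 hne
        · rw [Finset.mem_erase] at hf
          exact hint e he f hf.2 hf.1.symm a ha haf
      exact hne ((key a ha b hab hne).trans (key b hb a hab.symm (Ne.symm hne)).symm)
    · intro e he f hf hef
      refine p.weaklyNoncrossing_of_not_interleave ?_ ?_ ?_ ?_
      · rcases Finset.mem_insert.1 he with rfl | he
        · exact two_le_card_arc (ne_of_exists_cw h)
        · rw [Finset.mem_singleton.1 he]; exact two_le_card_coarc h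
      · rcases Finset.mem_insert.1 hf with rfl | hf
        · exact two_le_card_arc (ne_of_exists_cw h)
        · rw [Finset.mem_singleton.1 hf]; exact two_le_card_coarc h
      · have key : ¬ Interleave (arc v u) (coarc v u) := by
          rintro ⟨a, ha, b, hb, c, hc, d, hd, h1, h2⟩
          rw [mem_arc] at ha hc
          rw [mem_coarc] at hb hd
          simp only [cw] at *
          omega
        simp only [Finset.mem_insert, Finset.mem_singleton] at he hf
        rcases he with rfl | rfl <;> rcases hf with rfl | rfl
        · exact absurd rfl hef
        · exact key
        · exact fun h => key h.symm
        · exact absurd rfl hef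
      · exact fun a ha ha' b hb hb' =>
          (hint e he f hf hef a ha ha').trans (hint e he f hf hef b hb hb').symm⟩,
    Finset.card_pair (arc_ne_coarc (ne_of_exists_cw h) (ne_of_exists_cw h))⟩

theorem mkBasic_edges {v u : Fin N} (h : ∃ x, cw u x v) :
    (mkBasic p h).1.edges = {arc v u, coarc v u} := rfl

theorem NCHypertree.exists_edge_mem (τ : NCHypertree p) {a b : Fin N} (hab : a ≠ b) :
    ∃ e ∈ τ.edges, a ∈ e := by
  rcases Relation.ReflTransGen.cases_head (τ.conn a b) with h | ⟨c, ⟨e, he, ha, -⟩, -⟩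
  · exact absurd h hab
  · exact ⟨e, he, ha⟩

/-- Every vertex other than `v` lies in one of the two hyperedges, so the last vertex `u` of `e`,
seen from `v`, marks where `e` ends and `f` begins. -/
theorem NCHypertree.exists_arc_of_leftFrom {τ : NCHypertree p} {v : Fin N}
    {e f : Finset (Fin N)} (hE : τ.edges = {e, f}) (hve : v ∈ e) (hvf : v ∈ f)
    (h : LeftFrom v e f) : ∃ u, (∃ x, cw u x v) ∧ e = arc v u ∧ f = coarc v u := by
  have he : e ∈ τ.edges := by simp [hE]
  have hf : f ∈ τ.edges := by simp [hE]
  obtain ⟨u, hu, hlast⟩ := exists_cw_last ⟨v, hve⟩ v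
  obtain ⟨a, ha, hav⟩ := exists_ne_of_two_le (τ.two_le he) v
  obtain ⟨b, hb, hbv⟩ := exists_ne_of_two_le (τ.two_le hf) v
  have huv : u ≠ v := by
    rintro rfl
    have := hlast a ha
    simp only [cw] at this
    omega
  have hmem : ∀ x, x ≠ v → x ∈ e ∨ x ∈ f := by
    intro x hx
    obtain ⟨g, hg, hxg⟩ := τ.exists_edge_mem hx
    rw [hE, Finset.mem_insert, Finset.mem_singleton] at hg
    rcases hg with rfl | rfl
    · exact Or.inl hxg
    · exact Or.inr hxg
  refine ⟨u, ⟨b, cw_rot (h u hu b hb huv hbv)⟩, ?_, ?_⟩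
  · ext x
    rw [mem_arc]
    refine ⟨hlast x, ?_⟩
    rintro (rfl | rfl | hx)
    · exact hve
    · exact hu
    · by_contra hxe
      have hxv : x ≠ v := by rintro rfl; exact hxe hve
      have := h u hu x ((hmem x hxv).resolve_left hxe) huv hxv
      simp only [cw] at *
      omega
  · ext x
    rw [mem_coarc]
    constructor
    · intro hx
      by_cases hxv : x = v
      · exact Or.inl hxv
      · exact Or.inr (cw_rot (h u hu x hx huv hxv))
    · rintro (rfl | hx)
      · exact hvf
      · by_contra hxf
        have hxv : x ≠ v := by rintro rfl; exact hxf hvf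
        have := hlast x ((hmem x hxv).resolve_right hxf)
        simp only [cw] at *
        omega

/-- Connectivity forces the two hyperedges to meet, and their order at the common vertex tells which
one is the arc. -/
theorem BasicNCHypertree.exists_cut (β : BasicNCHypertree p) :
    ∃ v u : Fin N, (∃ x, cw u x v) ∧ β.1.edges = {arc v u, coarc v u} := by
  obtain ⟨τ, hτ⟩ := β
  obtain ⟨e, f, hef, hE⟩ := Finset.card_eq_two.1 hτ
  have he : e ∈ τ.edges := by simp [hE]
  have hf : f ∈ τ.edges := by simp [hE]
  obtain ⟨v, hve, hvf⟩ : ∃ v, v ∈ e ∧ v ∈ f := by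
    by_contra! hdis
    obtain ⟨a, ha⟩ := Finset.card_pos.1 (show 0 < e.card by have := τ.two_le he; omega)
    obtain ⟨b, hb⟩ := Finset.card_pos.1 (show 0 < f.card by have := τ.two_le hf; omega)
    obtain ⟨x, y, -, ⟨g, hg, hxg, hyg⟩, hxe, hye⟩ :=
      exists_step (τ.conn a b) (P := (· ∈ e)) ha (fun h => hdis b h hb)
    rw [hE, Finset.mem_insert, Finset.mem_singleton] at hg
    rcases hg with rfl | rfl
    · exact hye hyg
    · exact hdis x hxe hxg
  rcases NCHypertree.leftFrom_or he hf hef hve hvf with h | h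
  · obtain ⟨u, hu, rfl, rfl⟩ := NCHypertree.exists_arc_of_leftFrom hE hve hvf h
    exact ⟨v, u, hu, hE⟩
  · obtain ⟨u, hu, rfl, rfl⟩ :=
      NCHypertree.exists_arc_of_leftFrom (hE.trans (Finset.pair_comm _ _)) hvf hve h
    exact ⟨v, u, hu, hE.trans (Finset.pair_comm _ _)⟩

namespace BasicNCHypertree

variable (β : BasicNCHypertree p)

/-- The common vertex of the two hyperedges of a basic noncrossing hypertree. -/
def src : Fin N := β.exists_cut.choose

/-- The last vertex of the lower hyperedge of a basic noncrossing hypertree. -/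
def tgt : Fin N := β.exists_cut.choose_spec.choose

theorem exists_cw : ∃ x, cw β.tgt x β.src := β.exists_cut.choose_spec.choose_spec.1

theorem edges_eq : β.1.edges = {arc β.src β.tgt, coarc β.src β.tgt} :=
  β.exists_cut.choose_spec.choose_spec.2

theorem tgt_ne : β.tgt ≠ β.src := ne_of_exists_cw β.exists_cw

/-- The lower hyperedge of a basic noncrossing hypertree. -/
def lower : Finset (Fin N) := arc β.src β.tgt

/-- The upper hyperedge of a basic noncrossing hypertree. -/
def upper : Finset (Fin N) := coarc β.src β.tgt

theorem src_mem_lower : β.src ∈ β.lower := mem_arc.2 (Or.inl rfl)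

theorem tgt_mem_lower : β.tgt ∈ β.lower := mem_arc.2 (Or.inr (Or.inl rfl))

theorem src_mem_upper : β.src ∈ β.upper := mem_coarc.2 (Or.inl rfl)

variable {β}

theorem eq_src {x : Fin N} (h1 : x ∈ β.lower) (h2 : x ∈ β.upper) : x = β.src :=
  eq_of_mem_arc_of_mem_coarc h1 h2

theorem mem_lower_or_mem_upper (x : Fin N) : x ∈ β.lower ∨ x ∈ β.upper :=
  mem_arc_or_mem_coarc β.tgt_ne x

theorem src_tgt_of_edges {v u : Fin N} (h : ∃ x, cw u x v)
    (hE : β.1.edges = {arc v u, coarc v u}) : β.src = v ∧ β.tgt = u := by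
  have h0 := β.edges_eq
  rw [hE] at h0
  have huv := ne_of_exists_cw h
  have h1 : arc v u ≠ coarc v u := arc_ne_coarc huv huv
  have h2 : arc v u = β.lower ∨ arc v u = β.upper := by
    have : arc v u ∈ ({arc β.src β.tgt, coarc β.src β.tgt} : Finset _) := by simp [← h0]
    simpa [lower, upper] using this
  have h3 : coarc v u = β.lower ∨ coarc v u = β.upper := by
    have : coarc v u ∈ ({arc β.src β.tgt, coarc β.src β.tgt} : Finset _) := by simp [← h0]
    simpa [lower, upper] using this
  have hv1 : v ∈ arc v u := mem_arc.2 (Or.inl rfl)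
  have hv2 : v ∈ coarc v u := mem_coarc.2 (Or.inl rfl)
  have hsrc : β.src = v := by
    rcases h2 with h2 | h2 <;> rcases h3 with h3 | h3
    · exact absurd (h2.trans h3.symm) h1
    · exact (eq_src (h2 ▸ hv1) (h3 ▸ hv2)).symm
    · exact (eq_src (h3 ▸ hv2) (h2 ▸ hv1)).symm
    · exact absurd (h2.trans h3.symm) h1
  refine ⟨hsrc, ?_⟩
  have ht := β.tgt_ne
  rw [hsrc] at ht
  rcases h2 with h2 | h2
  · rw [lower, hsrc] at h2
    have h4 : u ∈ arc v β.tgt := h2 ▸ mem_arc.2 (Or.inr (Or.inl rfl))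
    have h5 : β.tgt ∈ arc v u := h2 ▸ mem_arc.2 (Or.inr (Or.inl rfl))
    rw [mem_arc] at h4 h5
    simp only [cw] at *
    omega
  · rw [upper, hsrc] at h2
    exact absurd h2 (arc_ne_coarc huv ht)

theorem ext_src_tgt {γ : BasicNCHypertree p} (h1 : β.src = γ.src) (h2 : β.tgt = γ.tgt) :
    β = γ := by
  apply Subtype.ext
  apply NCHypertree.ext
  rw [β.edges_eq, γ.edges_eq, h1, h2]

theorem lower_mem : β.lower ∈ β.1.edges := by rw [β.edges_eq, lower]; simp

theorem upper_mem : β.upper ∈ β.1.edges := by rw [β.edges_eq, upper]; simp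

theorem leftFrom_lower_upper : LeftFrom β.src β.lower β.upper := by
  intro a ha b hb h1 h2
  rw [lower, mem_arc] at ha
  rw [upper, mem_coarc] at hb
  simp only [cw] at *
  omega

end BasicNCHypertree

theorem src_mkBasic {v u : Fin N} (h : ∃ x, cw u x v) : (mkBasic p h).src = v :=
  (BasicNCHypertree.src_tgt_of_edges h (mkBasic_edges h)).1

theorem tgt_mkBasic {v u : Fin N} (h : ∃ x, cw u x v) : (mkBasic p h).tgt = u :=
  (BasicNCHypertree.src_tgt_of_edges h (mkBasic_edges h)).2

/-! ### Separating the hyperedges of a hypertree by cuts. -/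

namespace NCHypertree

variable {τ : NCHypertree p} {β γ : BasicNCHypertree p}

theorem mem_verts_iff_le : β ∈ τ.verts ↔ τ ≤ β.1 := by
  simp [verts]

/-- From here on a vertex of the simplex of `τ` is treated as a cut that respects every hyperedge of
`τ`. -/
theorem mem_verts : β ∈ τ.verts ↔ IsCut τ.edges β.src β.tgt := by
  rw [mem_verts_iff_le]
  refine forall₂_congr fun e _ => ?_
  rw [β.edges_eq]
  simp

theorem subset_or (h : β ∈ τ.verts) {e : Finset (Fin N)} (he : e ∈ τ.edges) :
    e ⊆ β.lower ∨ e ⊆ β.upper :=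
  mem_verts.1 h e he

theorem subset_lower_iff (h : β ∈ τ.verts) {e : Finset (Fin N)} (he : e ∈ τ.edges) {y : Fin N}
    (hy : y ∈ e) (hyv : y ≠ β.src) : e ⊆ β.lower ↔ y ∈ β.lower :=
  (mem_verts.1 h).subset_arc_iff he hy hyv

theorem not_subset_both {e : Finset (Fin N)} (he : e ∈ τ.edges) (h1 : e ⊆ β.lower)
    (h2 : e ⊆ β.upper) : False := by
  obtain ⟨a, ha, hne⟩ := exists_ne_of_two_le (τ.two_le he) β.src
  exact hne (BasicNCHypertree.eq_src (h1 ha) (h2 ha))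

/-- Hyperedges that share the vertex `v` and differ in order at `v` are separated by a cut. -/
theorem exists_vert_of_leftFrom {e f : Finset (Fin N)} {v : Fin N} (he : e ∈ τ.edges)
    (hf : f ∈ τ.edges) (hve : v ∈ e) (hvf : v ∈ f) (h : LeftFrom v e f) :
    ∃ β ∈ τ.verts, β.src = v ∧ e ⊆ β.lower ∧ f ⊆ β.upper := by
  classical
  have hef := ne_of_leftFrom he h
  -- `Y` is the part of the hypertree that hangs on `e` once `v` is removed. The cut is placed right
  -- after the last vertex `u` of `Y`.
  let Y : Fin N → Prop := fun y => ∃ a ∈ e, a ≠ v ∧ ConnAvoid τ.edges v a y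
  have hYv : ∀ y, Y y → y ≠ v := fun y ⟨a, _, hav, hy⟩ => hy.ne hav
  have hYe : ∀ a ∈ e, a ≠ v → Y a := fun a ha hav =>
    ⟨a, ha, hav, Relation.ReflTransGen.refl⟩
  have hYs : ∀ y z, Y y → z ≠ v → (∃ g ∈ τ.edges, y ∈ g ∧ z ∈ g) → Y z := by
    rintro y z ⟨a, ha, hav, hy⟩ hz hg
    exact ⟨a, ha, hav, hy.tail ⟨hy.ne hav, hz, hg⟩⟩
  obtain ⟨a₁, ha₁, ha₁v⟩ := exists_ne_of_two_le (τ.two_le he) v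
  obtain ⟨b₁, hb₁, hb₁v⟩ := exists_ne_of_two_le (τ.two_le hf) v
  obtain ⟨u, hu, hlast⟩ := exists_cw_last (e := Finset.univ.filter Y)
    ⟨a₁, by simpa using hYe a₁ ha₁ ha₁v⟩ v
  simp only [Finset.mem_filter, Finset.mem_univ, true_and] at hu hlast
  have huv := hYv u hu
  have hYlast : ∀ y, Y y → y = u ∨ cw v y u := fun y hy => (hlast y hy).resolve_left (hYv y hy)
  obtain ⟨a₀, ha₀, ha₀v, hconn⟩ := hu
  have hYsub : ∀ x, ConnAvoid τ.edges v a₀ x → Y x := fun x hx => ⟨a₀, ha₀, ha₀v, hx⟩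
  -- the vertices of `f` come after `u`
  have hfu : ∀ b ∈ f, b ≠ v → cw u b v := by
    intro b hb hbv
    by_contra hc
    have hnY : ¬ Y b := by
      rintro ⟨a, ha, hav, hab⟩
      obtain ⟨z, hz, haz⟩ := hab.exists_first_mem hb
      have h1 : Conn (τ.edges.erase f) v z :=
        (Conn.single (Finset.mem_erase.2 ⟨hef, he⟩) hve ha).trans haz.conn
      exact haz.ne hav (τ.eq_of_conn hf hvf hz h1).symm
    have hbu : b ≠ u := by rintro rfl; exact hnY (hYsub _ hconn)
    have hvbu : cw v b u := by simp only [cw] at *; omega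
    -- The path in `Y` from `a₀` to `u` would have to jump over `b`, with a hyperedge that crosses
    -- the diagonal of `f` from `v` to `b`.
    obtain ⟨x, y, hx, ⟨hxv, hyv, g, hg, hxg, hyg⟩, h1, h2⟩ := exists_step hconn
      (P := fun x => cw v x b) (h a₀ ha₀ b hb ha₀v hbv) (by simp only [cw] at *; omega)
    have hyb : y ≠ b := by
      rintro rfl
      exact hnY (hYs x y (hYsub x hx) hyv ⟨g, hg, hxg, hyg⟩)
    have hgf : g ≠ f := by
      rintro rfl
      exact hnY (hYs x b (hYsub x hx) hbv ⟨g, hg, hxg, hb⟩)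
    exact τ.not_interleave hg hf hgf ⟨x, hxg, b, hb, y, hyg, v, hvf,
      by simp only [cw] at *; omega, by simp only [cw] at *; omega⟩
  have hcw : ∃ x, cw u x v := ⟨b₁, hfu b₁ hb₁ hb₁v⟩
  refine ⟨mkBasic p hcw, ?_, src_mkBasic hcw, ?_, ?_⟩
  · rw [mem_verts, src_mkBasic, tgt_mkBasic]
    -- A hyperedge `g` with vertices strictly on both sides avoids `Y`, because `b` comes after the
    -- last vertex of `Y`. Then `g` crosses `e` or a hyperedge on the path in `Y` from `a₀` to `u`.
    intro g hg
    by_contra! hc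
    obtain ⟨⟨b, hb, hb'⟩, ⟨a, ha, ha'⟩⟩ := And.intro
      (Finset.not_subset.1 hc.1) (Finset.not_subset.1 hc.2)
    rw [mem_arc] at hb'
    rw [mem_coarc] at ha'
    have hbv : b ≠ v := by tauto
    have hav : a ≠ v := by tauto
    have hnYb : ¬ Y b := fun hY => by have := hYlast b hY; tauto
    have hnYg : ∀ x ∈ g, ¬ Y x := fun x hx hY => hnYb (hYs x b hY hbv ⟨g, hg, hx, hb⟩)
    have hau : a ≠ u := by rintro rfl; exact hnYg _ ha (hYsub _ hconn)
    have hbu : b ≠ u := by tauto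
    by_cases h1 : cw a a₀ b
    · refine τ.not_interleave he hg ?_ ⟨a₀, ha₀, b, hb, v, hve, a, ha,
        by simp only [cw] at *; omega, by simp only [cw] at *; omega⟩
      rintro rfl
      exact hnYg a₀ ha₀ (hYe a₀ ha₀ ha₀v)
    · obtain ⟨x, y, hx, ⟨hxv, hyv, k, hk, hxk, hyk⟩, h2, h3⟩ := exists_step hconn
        (P := fun x => ¬ cw a x b) h1 (by simp only [cw] at *; omega)
      have hYx := hYsub x hx
      have hYy := hYs x y hYx hyv ⟨k, hk, hxk, hyk⟩
      have hxa : x ≠ a := by rintro rfl; exact hnYg _ ha hYx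
      have hxb : x ≠ b := by rintro rfl; exact hnYg _ hb hYx
      refine τ.not_interleave hk hg ?_ ⟨y, hyk, b, hb, x, hxk, a, ha,
        by simp only [cw] at *; omega, by simp only [cw] at *; omega⟩
      rintro rfl
      exact hnYg x hxk hYx
  · rw [BasicNCHypertree.lower, src_mkBasic, tgt_mkBasic]
    intro a ha
    rw [mem_arc]
    by_cases hav : a = v
    · exact Or.inl hav
    · exact Or.inr (hYlast a (hYe a ha hav))
  · rw [BasicNCHypertree.upper, src_mkBasic, tgt_mkBasic]
    intro b hb
    rw [mem_coarc]
    by_cases hbv : b = v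
    · exact Or.inl hbv
    · exact Or.inr (hfu b hb hbv)

/-- Every cut is the only one that separates a certain pair of hyperedges. -/
theorem exists_corner (h : β ∈ τ.verts) : ∃ e ∈ τ.edges, ∃ f ∈ τ.edges, β.src ∈ e ∧ β.src ∈ f ∧
    e ⊆ β.lower ∧ f ⊆ β.upper ∧
    ∀ γ ∈ τ.verts, γ ≠ β → (e ⊆ γ.lower ↔ f ⊆ γ.lower) := by
  -- Let `w` be the vertex right after `β.tgt`. The required hyperedges are those at `β.src` through
  -- which `β.tgt` and `w` are attached to it. A cut at another vertex has both on the side of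
  -- `β.src`, and a different cut at `β.src` does not pass between the consecutive vertices `β.tgt`
  -- and `w`.
  obtain ⟨b, hb⟩ := β.exists_cw
  obtain ⟨w, hw, hfirst⟩ := exists_cw_first (e := {x | cw β.tgt x β.src}) ⟨b, by simpa⟩ β.tgt
  simp only [Finset.mem_filter, Finset.mem_univ, true_and] at hw hfirst
  have hnext : ∀ x, ¬ cw β.tgt x w := by
    intro x hx
    have := hfirst x (by simp only [cw] at *; omega)
    simp only [cw] at *
    omega
  have hwv : w ≠ β.src := by rintro h; rw [h] at hw; simp only [cw] at hw; omega
  obtain ⟨e, he, hve, y, hy, hyv, huy⟩ := (τ.conn β.tgt β.src).exists_last β.tgt_ne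
  obtain ⟨f, hf, hvf, z, hz, hzv, hwz⟩ := (τ.conn w β.src).exists_last hwv
  have hcut := mem_verts.1 h
  refine ⟨e, he, f, hf, hve, hvf, ?_, ?_, ?_⟩
  · rw [subset_lower_iff h he hy hyv]
    exact (hcut.mem_arc_iff_of_connAvoid huy).1 β.tgt_mem_lower
  · refine (subset_or h hf).resolve_left ?_
    rw [subset_lower_iff h hf hz hzv]
    intro h1
    have h2 := (hcut.mem_arc_iff_of_connAvoid hwz).2 h1
    exact hwv (eq_of_mem_arc_of_mem_coarc h2 (mem_coarc.2 (Or.inr hw)))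
  · intro γ hγ hγβ
    by_cases hs : γ.src = β.src
    · have hγc := mem_verts.1 hγ
      have ht : γ.tgt ≠ β.tgt := fun h => hγβ (BasicNCHypertree.ext_src_tgt hs h)
      rw [subset_lower_iff hγ he hy (hs ▸ hyv), subset_lower_iff hγ hf hz (hs ▸ hzv)]
      rw [hs] at hγc
      rw [BasicNCHypertree.lower, hs, ← hγc.mem_arc_iff_of_connAvoid huy,
        ← hγc.mem_arc_iff_of_connAvoid hwz, mem_arc, mem_arc]
      have h1 := hnext γ.tgt
      have h2 := γ.tgt_ne
      have h3 := β.tgt_ne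
      rw [hs] at h2
      simp only [cw] at *
      omega
    · rw [subset_lower_iff hγ he hve (Ne.symm hs), subset_lower_iff hγ hf hvf (Ne.symm hs)]

/-- If `v` is not the vertex of the cut, it fixes the side of both hyperedges; if it is, the lower
side is an initial sector of the left to right order at `v`. -/
theorem subset_lower_of_leftFrom {e f : Finset (Fin N)} {v : Fin N} (he : e ∈ τ.edges)
    (hf : f ∈ τ.edges) (hve : v ∈ e) (hvf : v ∈ f) (h : LeftFrom v e f) (hβ : β ∈ τ.verts)
    (hfβ : f ⊆ β.lower) : e ⊆ β.lower := by
  by_cases hv : v = β.src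
  · subst hv
    obtain ⟨a, ha, hav⟩ := exists_ne_of_two_le (τ.two_le he) β.src
    obtain ⟨b, hb, hbv⟩ := exists_ne_of_two_le (τ.two_le hf) β.src
    rw [subset_lower_iff hβ he ha hav, BasicNCHypertree.lower, mem_arc]
    have h1 := h a ha b hb hav hbv
    have h2 := hfβ hb
    rw [BasicNCHypertree.lower, mem_arc] at h2
    simp only [cw] at *
    omega
  · rw [subset_lower_iff hβ he hve hv]
    exact hfβ hvf

end NCHypertree

end Cuts

end NCHT
end

noncomputable section

namespace NCHT

/-! ### The face lattice of the noncrossing hypertree complex -/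

section FaceLattice

variable {N : ℕ} {p : ConvexPolygon N}

namespace NCHypertree

variable {τ : NCHypertree p} {β γ : BasicNCHypertree p}

/-- Vertices that are not in a common hyperedge are separated by a cut. -/
theorem exists_vert_separating {a b : Fin N} (hab : a ≠ b)
    (h : ¬ ∃ e ∈ τ.edges, a ∈ e ∧ b ∈ e) :
    ∃ β ∈ τ.verts, ∀ e : Finset (Fin N), a ∈ e → b ∈ e → ¬ (e ⊆ β.lower ∨ e ⊆ β.upper) := by
  -- A path from `a` to `b` ends with `e`, first meets `e` at `z`, and arrives at `z` through `f`. A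
  -- cut at `z` between `e` and `f` therefore has `a` and `b` on different sides.
  obtain ⟨e, he, hbe, y, hy, hyb, hay⟩ := (τ.conn a b).exists_last hab
  obtain ⟨z, hz, haz⟩ := hay.exists_first_mem hy
  have hzb : z ≠ b := haz.ne hab
  have haz' : a ≠ z := by rintro rfl; exact h ⟨e, he, hz, hbe⟩
  obtain ⟨f, hf, hzf, x, hx, hxz, hax⟩ := haz.conn.exists_last haz'
  rw [Finset.mem_erase] at hf
  have hax' : ConnAvoid τ.edges z a x := hax.mono (Finset.erase_subset _ _)
  have main : ∀ β ∈ τ.verts, β.src = z → ¬ (e ⊆ β.lower ↔ f ⊆ β.lower) →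
      ∀ g : Finset (Fin N), a ∈ g → b ∈ g → ¬ (g ⊆ β.lower ∨ g ⊆ β.upper) := by
    intro β hβ hs hsep g hag hbg hg
    apply hsep
    have hcut := mem_verts.1 hβ
    rw [subset_lower_iff hβ he hbe (hs ▸ hzb.symm), subset_lower_iff hβ hf.2 hx (hs ▸ hxz)]
    rw [← hs] at hax'
    have h1 := hcut.mem_arc_iff_of_connAvoid hax'
    change a ∈ β.lower ↔ x ∈ β.lower at h1
    rw [← h1]
    rcases hg with hg | hg
    · exact iff_of_true (hg hbg) (hg hag)
    · refine iff_of_false (fun h => ?_) (fun h => ?_)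
      · exact hzb ((BasicNCHypertree.eq_src h (hg hbg)).trans hs).symm
      · exact haz' ((BasicNCHypertree.eq_src h (hg hag)).trans hs)
  rcases leftFrom_or he hf.2 hf.1.symm hz hzf with hl | hl
  · obtain ⟨β, hβ, hs, h1, h2⟩ := exists_vert_of_leftFrom he hf.2 hz hzf hl
    exact ⟨β, hβ, main β hβ hs fun h => not_subset_both hf.2 (h.1 h1) h2⟩
  · obtain ⟨β, hβ, hs, h1, h2⟩ := exists_vert_of_leftFrom hf.2 he hzf hz hl
    exact ⟨β, hβ, main β hβ hs fun h => not_subset_both he (h.2 h1) h2⟩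

/-- A cut of `τ` that separates two vertices of a hyperedge of `σ` would not be a cut of `σ`, so any
two such vertices share a hyperedge of `τ`. Pairwise is enough: a third vertex outside the hyperedge
shared by `a` and `b` would join them by other hyperedges. -/
theorem verts_subset_verts_iff {σ τ : NCHypertree p} : τ.verts ⊆ σ.verts ↔ σ ≤ τ := by
  constructor
  · intro h e he
    have hpair : ∀ a ∈ e, ∀ b ∈ e, a ≠ b → ∃ f ∈ τ.edges, a ∈ f ∧ b ∈ f := by
      intro a ha b hb hab
      by_contra hc
      obtain ⟨β, hβ, hsep⟩ := exists_vert_separating hab hc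
      exact hsep e ha hb (subset_or (h hβ) he)
    obtain ⟨a, ha, b, hb, hab⟩ := Finset.one_lt_card.1 (σ.two_le he)
    obtain ⟨f, hf, haf, hbf⟩ := hpair a ha b hb hab
    refine ⟨f, hf, fun c hc => ?_⟩
    by_contra hcf
    have hac : a ≠ c := by rintro rfl; exact hcf haf
    have hbc : b ≠ c := by rintro rfl; exact hcf hbf
    obtain ⟨g, hg, hag, hcg⟩ := hpair a ha c hc hac
    obtain ⟨k, hk, hbk, hck⟩ := hpair b hb c hc hbc
    have hgf : g ≠ f := by rintro rfl; exact hcf hcg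
    have hkf : k ≠ f := by rintro rfl; exact hcf hck
    exact hab (τ.eq_of_conn hf haf hbf
      ((Conn.single (Finset.mem_erase.2 ⟨hgf, hg⟩) hag hcg).trans
        (Conn.single (Finset.mem_erase.2 ⟨hkf, hk⟩) hck hbk)))
  · intro h β hβ
    rw [mem_verts_iff_le] at *
    exact h.trans hβ

/-- Two hyperedges that are adjacent at a vertex can be merged. -/
theorem exists_verts_eq_erase [DecidableEq (BasicNCHypertree p)] (hβ : β ∈ τ.verts) :
    ∃ τ' : NCHypertree p, τ'.verts = τ.verts.erase β := by
  obtain ⟨e, he, f, hf, hve, hvf, heβ, hfβ, honly⟩ := exists_corner hβ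
  set v := β.src with hv
  have hef : e ≠ f := by rintro rfl; exact not_subset_both he heβ hfβ
  have hleft : LeftFrom v e f := by
    intro a ha b hb hav hbv
    exact β.leftFrom_lower_upper a (heβ ha) b (hfβ hb) hav hbv
  -- Merging the pair at the corner of `β` loses only this cut, since all other cuts have `e` and
  -- `f` on the same side.
  set E' : Finset (Finset (Fin N)) := insert (e ∪ f) ((τ.edges.erase e).erase f) with hE'
  have hold : ∀ {h}, h ∈ (τ.edges.erase e).erase f → h ∈ τ.edges ∧ h ≠ e ∧ h ≠ f := by
    intro h hh
    rw [Finset.mem_erase, Finset.mem_erase] at hh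
    exact ⟨hh.2.2, hh.2.1, hh.1⟩
  -- all vertices of `e ∪ f` are joined by `e` and `f`
  have hunion : ∀ {F : Finset (Finset (Fin N))}, e ∈ F → f ∈ F → ∀ {a b}, a ∈ e ∪ f →
      b ∈ e ∪ f → Conn F a b := by
    intro F heF hfF
    have key : ∀ a ∈ e ∪ f, Conn F a v := by
      intro a ha
      rcases Finset.mem_union.1 ha with ha | ha
      · exact Conn.single heF ha hve
      · exact Conn.single hfF ha hvf
    intro a b ha hb
    exact (key _ ha).trans (key _ hb).symm
  have hconn : ∀ {F F' : Finset (Finset (Fin N))}, (∀ g ∈ F, ∃ g' ∈ F', g ⊆ g') → ∀ {a b},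
      Conn F a b → Conn F' a b := by
    intro F F' hFF a b hab
    induction hab with
    | refl => exact Relation.ReflTransGen.refl
    | tail _ h ih =>
      obtain ⟨g, hg, h1, h2⟩ := h
      obtain ⟨g', hg', hs⟩ := hFF g hg
      exact ih.tail ⟨g', hg', hs h1, hs h2⟩
  have hnew : ∀ {h}, h ∈ τ.edges → h ≠ e → h ≠ f → ∀ {a b},
      Conn (E'.erase h) a b → Conn (τ.edges.erase h) a b := by
    intro h hh hhe hhf a b hab
    have heh : e ∈ τ.edges.erase h := Finset.mem_erase.2 ⟨hhe.symm, he⟩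
    have hfh : f ∈ τ.edges.erase h := Finset.mem_erase.2 ⟨hhf.symm, hf⟩
    induction hab with
    | refl => exact Relation.ReflTransGen.refl
    | tail _ h' ih =>
      obtain ⟨g, hg, h1, h2⟩ := h'
      refine ih.trans ?_
      rw [Finset.mem_erase, hE', Finset.mem_insert] at hg
      rcases hg.2 with rfl | hg2
      · exact hunion heh hfh h1 h2
      · exact Conn.single (Finset.mem_erase.2 ⟨hg.1, (hold hg2).1⟩) h1 h2
  have hle : ∀ g ∈ τ.edges, ∃ g' ∈ E', g ⊆ g' := by
    intro g hg
    by_cases hge : g = e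
    · exact ⟨e ∪ f, Finset.mem_insert_self _ _, hge ▸ Finset.subset_union_left⟩
    by_cases hgf : g = f
    · exact ⟨e ∪ f, Finset.mem_insert_self _ _, hgf ▸ Finset.subset_union_right⟩
    · exact ⟨g, Finset.mem_insert_of_mem (by simp [hge, hgf, hg]), subset_rfl⟩
  -- A hyperedge crossing `e ∪ f` must pass through `v` between `e` and `f`. The cut separating it
  -- from `e` and the cut separating it from `f` both separate `e` from `f`, so both equal `β`; but
  -- then it lies on both sides of `β`.
  have hint : ∀ {h}, h ∈ τ.edges → h ≠ e → h ≠ f → ¬ Interleave (e ∪ f) h := by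
    rintro h hh hhe hhf hi
    -- it suffices to exclude a diagonal from `e` to `f`
    obtain ⟨a, b, c, d, ha, hb, hc, hd, h1, h2⟩ : ∃ a b c d, a ∈ e ∧ b ∈ h ∧ c ∈ f ∧ d ∈ h ∧
        cw a b c ∧ cw c d a := by
      obtain ⟨a, ha, b, hb, c, hc, d, hd, h1, h2⟩ := hi
      rcases Finset.mem_union.1 ha with ha | ha <;> rcases Finset.mem_union.1 hc with hc | hc
      · exact absurd ⟨a, ha, b, hb, c, hc, d, hd, h1, h2⟩ (τ.not_interleave he hh hhe.symm)
      · exact ⟨a, b, c, d, ha, hb, hc, hd, h1, h2⟩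
      · exact ⟨c, d, a, b, hc, hd, ha, hb, h2, h1⟩
      · exact absurd ⟨a, ha, b, hb, c, hc, d, hd, h1, h2⟩ (τ.not_interleave hf hh hhf.symm)
    have hne := τ.not_interleave he hh hhe.symm
    have hnf := τ.not_interleave hf hh hhf.symm
    have hav : a ≠ v := by rintro rfl; exact hnf ⟨_, hvf, b, hb, c, hc, d, hd, h1, h2⟩
    have hcv : c ≠ v := by rintro rfl; exact hne ⟨a, ha, b, hb, _, hve, d, hd, h1, h2⟩
    have hac : cw v a c := hleft a ha c hc hav hcv
    have hdv : d = v := by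
      by_contra hdv
      by_cases h3 : cw v d a
      · exact hne ⟨a, ha, b, hb, v, hve, d, hd, by simp only [cw] at *; omega,
          by simp only [cw] at *; omega⟩
      · exact hnf ⟨v, hvf, b, hb, c, hc, d, hd, by simp only [cw] at *; omega,
          by simp only [cw] at *; omega⟩
    subst hdv
    have hbd : b ≠ v := by rintro rfl; simp only [cw] at h1 h2; omega
    have hl1 : LeftFrom v e h := leftFrom_of_cw he hh hhe.symm hve hd ha hb
      (by simp only [cw] at *; omega)
    have hl2 : LeftFrom v h f := leftFrom_of_cw hh hf hhf hd hvf hb hc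
      (by simp only [cw] at *; omega)
    obtain ⟨γ, hγ, hγs, hγ1, hγ2⟩ := exists_vert_of_leftFrom he hh hve hd hl1
    obtain ⟨δ, hδ, hδs, hδ1, hδ2⟩ := exists_vert_of_leftFrom hh hf hd hvf hl2
    have e1 : γ = β := by
      by_contra hne
      exact not_subset_both hh
        (subset_lower_of_leftFrom hh hf hd hvf hl2 hγ ((honly γ hγ hne).1 hγ1)) hγ2
    have e2 : δ = β := by
      by_contra hne
      exact not_subset_both hf
        ((honly δ hδ hne).1 (subset_lower_of_leftFrom he hh hve hd hl1 hδ hδ1)) hδ2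
    subst e1
    subst e2
    exact not_subset_both hh hδ1 hγ2
  have hcommon : ∀ {h}, h ∈ τ.edges → h ≠ e → h ≠ f → ∀ a ∈ e ∪ f, a ∈ h → ∀ b ∈ e ∪ f, b ∈ h →
      a = b := by
    intro h hh hhe hhf a ha hah b hb hbh
    exact τ.eq_of_conn hh hah hbh (hunion (Finset.mem_erase.2 ⟨hhe.symm, he⟩)
      (Finset.mem_erase.2 ⟨hhf.symm, hf⟩) ha hb)
  have htwo : 2 ≤ (e ∪ f).card :=
    (τ.two_le he).trans (Finset.card_le_card Finset.subset_union_left)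
  have hweak : ∀ {h}, h ∈ τ.edges → h ≠ e → h ≠ f → p.WeaklyNoncrossing (e ∪ f) h :=
    fun hh hhe hhf => p.weaklyNoncrossing_of_not_interleave htwo (τ.two_le hh)
      (hint hh hhe hhf) (hcommon hh hhe hhf)
  refine ⟨⟨⟨E', ?_⟩, ⟨?_, ?_⟩, ?_⟩, ?_⟩
  · intro g hg
    rcases Finset.mem_insert.1 hg with rfl | hg
    · exact htwo
    · exact τ.two_le (hold hg).1
  · exact fun a b => hconn hle (τ.conn a b)
  · refine Hypergraph.isHyperforest_of_eq_of_conn ?_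
    intro g hg a ha b hb hab
    change Conn (E'.erase g) a b at hab
    by_cases hgn : g = e ∪ f
    · subst hgn
      have h1 : E'.erase (e ∪ f) ⊆ (τ.edges.erase e).erase f := by
        intro k hk
        rw [Finset.mem_erase, hE', Finset.mem_insert] at hk
        exact hk.2.resolve_left hk.1
      have h2 := hab.mono h1
      have h3 : Conn (τ.edges.erase e) a b := h2.mono (Finset.erase_subset _ _)
      have h4 : Conn (τ.edges.erase f) a b :=
        h2.mono (Finset.erase_subset_erase _ (Finset.erase_subset _ _))
      have hfe : f ∈ τ.edges.erase e := Finset.mem_erase.2 ⟨hef.symm, hf⟩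
      have key : ∀ {a b}, a ∈ e → b ∈ f → Conn (τ.edges.erase e) a b →
          Conn (τ.edges.erase f) a b → a = b := by
        intro a b ha hb h3 h4
        obtain rfl := τ.eq_of_conn he ha hve (h3.trans (Conn.single hfe hb hvf))
        exact τ.eq_of_conn hf hvf hb h4
      rcases Finset.mem_union.1 ha with ha | ha <;> rcases Finset.mem_union.1 hb with hb | hb
      · exact τ.eq_of_conn he ha hb h3
      · exact key ha hb h3 h4
      · exact (key hb ha h3.symm h4.symm).symm
      · exact τ.eq_of_conn hf ha hb h4
    · obtain ⟨h1, h2, h3⟩ := hold ((Finset.mem_insert.1 hg).resolve_left hgn)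
      exact τ.eq_of_conn h1 ha hb (hnew h1 h2 h3 hab)
  · intro g hg k hk hgk
    rcases Finset.mem_insert.1 hg with rfl | hg <;> rcases Finset.mem_insert.1 hk with rfl | hk
    · exact absurd rfl hgk
    · obtain ⟨h1, h2, h3⟩ := hold hk
      exact hweak h1 h2 h3
    · obtain ⟨h1, h2, h3⟩ := hold hg
      obtain ⟨w, hw⟩ := hweak h1 h2 h3
      exact ⟨w, by rwa [Set.inter_comm]⟩
    · exact τ.2.2 g (hold hg).1 k (hold hk).1 hgk
  · ext γ
    refine Iff.trans mem_verts (Iff.trans ?_ Finset.mem_erase.symm)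
    constructor
    · intro h
      have hγ : γ ∈ τ.verts := by
        rw [mem_verts]
        intro g hg
        obtain ⟨g', hg', hs⟩ := hle g hg
        exact (h g' hg').imp hs.trans hs.trans
      refine ⟨?_, hγ⟩
      rintro rfl
      rcases h (e ∪ f) (Finset.mem_insert_self _ _) with h1 | h1
      · exact not_subset_both hf (Finset.subset_union_right.trans h1) hfβ
      · exact not_subset_both he heβ (Finset.subset_union_left.trans h1)
    · rintro ⟨hne, hγ⟩ g hg
      rcases Finset.mem_insert.1 hg with rfl | hg
      · have h1 := honly γ hγ hne
        by_cases h2 : e ⊆ γ.lower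
        · exact Or.inl (Finset.union_subset h2 (h1.1 h2))
        · exact Or.inr (Finset.union_subset ((subset_or hγ he).resolve_left h2)
            ((subset_or hγ hf).resolve_left fun h => h2 (h1.2 h)))
      · exact subset_or hγ (hold hg).1

theorem exists_verts_eq {s : Finset (BasicNCHypertree p)} (hs : s ⊆ τ.verts) :
    ∃ τ' : NCHypertree p, τ'.verts = s := by
  classical
  obtain ⟨n, hn⟩ : ∃ n, n = (τ.verts \ s).card := ⟨_, rfl⟩
  induction n generalizing τ with
  | zero =>
    exact ⟨τ, (Finset.sdiff_eq_empty_iff_subset.1 (Finset.card_eq_zero.1 hn.symm)).antisymm hs⟩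
  | succ n ih =>
    obtain ⟨β, hβ⟩ := Finset.card_pos.1 (show 0 < (τ.verts \ s).card by omega)
    rw [Finset.mem_sdiff] at hβ
    obtain ⟨τ', hτ'⟩ := exists_verts_eq_erase hβ.1
    refine ih (τ := τ') ?_ ?_
    · rw [hτ']
      exact fun γ hγ => Finset.mem_erase.2 ⟨fun h => hβ.2 (h ▸ hγ), hs hγ⟩
    · rw [hτ', Finset.erase_sdiff_comm, Finset.card_erase_of_mem (Finset.mem_sdiff.2 hβ)]
      omega

end NCHypertree

end FaceLattice

end NCHT
end

noncomputable section

namespace NCHT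

/-! ### Noncrossing partitions and their permutations -/

section Partitions

variable {N : ℕ} {p : ConvexPolygon N}

section Cyc

variable {e : Finset (Fin N)} {x y z : Fin N}

theorem cyc_of_notMem (h : x ∉ e) : cyc e x = x :=
  List.formPerm_apply_of_notMem (by simpa using h)

/-- The cycle of `e` moves each element of `e` to the next one. -/
theorem cyc_spec (hx : x ∈ e) :
    cyc e x ∈ e ∧ (∀ z ∈ e, ¬ cw x z (cyc e x)) ∧ (cyc e x = x → ∀ z ∈ e, z = x) := by
  set l := e.sort (· ≤ ·) with hl
  have hnd : l.Nodup := Finset.sort_nodup _ _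
  have hmono : StrictMono l.get := List.sortedLT_iff_strictMono_get.1 (Finset.sortedLT_sort e)
  have hmem : ∀ {z}, z ∈ e → ∃ (j : ℕ) (hj : j < l.length), l[j] = z := by
    intro z hz
    exact List.mem_iff_getElem.1 ((Finset.mem_sort _).2 hz)
  have hlt : ∀ (i j : ℕ) (hi : i < l.length) (hj : j < l.length), i < j → l[i] < l[j] :=
    fun i j hi hj hij => @hmono ⟨i, hi⟩ ⟨j, hj⟩ hij
  obtain ⟨i, hi, rfl⟩ := hmem hx
  have hc : cyc e l[i] = l[(i + 1) % l.length]'(Nat.mod_lt _ (by omega)) :=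
    List.formPerm_apply_getElem l hnd i hi
  have hcases : ((i + 1) % l.length = i + 1 ∧ i + 1 < l.length) ∨
      ((i + 1) % l.length = 0 ∧ i + 1 = l.length) := by
    rcases Nat.lt_or_ge (i + 1) l.length with h | h
    · exact Or.inl ⟨Nat.mod_eq_of_lt h, h⟩
    · have : i + 1 = l.length := by omega
      exact Or.inr ⟨by rw [this, Nat.mod_self], this⟩
  refine ⟨?_, ?_, ?_⟩
  · rw [hc]; exact (Finset.mem_sort (· ≤ ·)).1 (List.getElem_mem _)
  · intro z hz
    obtain ⟨j, hj, rfl⟩ := hmem hz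
    rw [hc]
    have h1 := hlt i j hi hj
    have h2 := hlt j i hj hi
    rcases hcases with ⟨h, h'⟩ | ⟨h, h'⟩
    · have h3 := hlt (i + 1) j h' hj
      have h4 := hlt i (i + 1) hi h' (by omega)
      simp only [h, cw]
      rcases lt_trichotomy i j with h5 | rfl | h5
      · rcases Nat.lt_or_ge (i + 1) j with h6 | h6
        · have := h3 h6; omega
        · have : j = i + 1 := by omega
          subst this; omega
      · omega
      · have := h2 h5; omega
    · have h3 := hlt 0 j (by omega) hj
      have h4 := hlt 0 i (by omega) hi
      simp only [h, cw]
      rcases Nat.eq_zero_or_pos j with rfl | h5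
      · omega
      · have := h3 h5
        rcases lt_trichotomy i j with h6 | rfl | h6
        · omega
        · omega
        · have := h2 h6; omega
  · intro h z hz
    obtain ⟨j, hj, rfl⟩ := hmem hz
    rw [hc] at h
    have h1 := (List.Nodup.getElem_inj_iff hnd).1 h
    have : l.length = 1 := by omega
    congr 1
    omega

end Cyc

/-! ### Blocks and the noncrossing permutation. -/

namespace NCPartition

/-- Two vertices are in the same block. -/
def Rel (π : NCPartition p) (x y : Fin N) : Prop := π.1.part x = π.1.part y

variable {π ρ : NCPartition p} {x y z : Fin N}

theorem Rel.refl (π : NCPartition p) (x : Fin N) : π.Rel x x := rfl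

theorem Rel.symm (h : π.Rel x y) : π.Rel y x := Eq.symm h

theorem Rel.trans (h : π.Rel x y) (h' : π.Rel y z) : π.Rel x z := Eq.trans h h'

theorem mem_part_iff : y ∈ π.1.part x ↔ π.Rel x y := by
  rw [π.1.mem_part_iff_part_eq_part (Finset.mem_univ _) (Finset.mem_univ _)]
  exact eq_comm

theorem part_mem (π : NCPartition p) (x : Fin N) : π.1.part x ∈ π.1.parts :=
  π.1.part_mem.2 (Finset.mem_univ x)

theorem exists_part_eq {b : Finset (Fin N)} (hb : b ∈ π.1.parts) : ∃ x, b = π.1.part x := by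
  obtain ⟨x, hx⟩ := π.1.nonempty_of_mem_parts hb
  exact ⟨x, (π.1.part_eq_of_mem hb hx).symm⟩

theorem le_iff : π ≤ ρ ↔ ∀ x y, π.Rel x y → ρ.Rel x y := by
  constructor
  · intro h x y hxy
    obtain ⟨c, hc, hle⟩ := (show π.1 ≤ ρ.1 from h) (part_mem π x)
    have h1 : x ∈ c := hle (mem_part_iff.2 (Rel.refl π x))
    have h2 : y ∈ c := hle (mem_part_iff.2 hxy)
    exact (ρ.1.part_eq_of_mem hc h1).trans (ρ.1.part_eq_of_mem hc h2).symm
  · intro h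
    change π.1 ≤ ρ.1
    intro b hb
    obtain ⟨x, rfl⟩ := exists_part_eq hb
    exact ⟨_, part_mem ρ x, fun y hy => mem_part_iff.2 (h x y (mem_part_iff.1 hy))⟩

theorem ext_rel (h : ∀ x y, π.Rel x y ↔ ρ.Rel x y) : π = ρ :=
  le_antisymm (le_iff.2 fun x y => (h x y).1) (le_iff.2 fun x y => (h x y).2)

theorem rel_bot_iff : (⊥ : NCPartition p).Rel x y ↔ x = y := by
  rw [← mem_part_iff]
  have h : (⊥ : NCPartition p).1.part x = {x} :=
    Finpartition.part_eq_of_mem _ (Finpartition.mem_bot_iff.2 ⟨x, Finset.mem_univ x, rfl⟩)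
      (Finset.mem_singleton_self x)
  rw [h, Finset.mem_singleton, eq_comm]

theorem rel_top (x y : Fin N) : (⊤ : NCPartition p).Rel x y := by
  have key : ∀ x, (⊤ : NCPartition p).1.part x = Finset.univ := fun x =>
    Finset.mem_singleton.1 (Finpartition.parts_top_subset _ (part_mem ⊤ x))
  exact (key x).trans (key y).symm

theorem rel_of_cross (π : NCPartition p) {a b c d : Fin N} (hac : π.Rel a c) (hbd : π.Rel b d)
    (h1 : cw a b c) (h2 : cw c d a) : π.Rel a b := by
  by_contra hab
  refine (π.2 _ (part_mem π a) _ (part_mem π b) hab).not_interleave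
    ⟨a, mem_part_iff.2 (Rel.refl π a), b, mem_part_iff.2 (Rel.refl π b), c, mem_part_iff.2 hac, d,
      mem_part_iff.2 hbd, h1, h2⟩

variable (p) in
open Classical in
/-- The noncrossing partition whose blocks are the classes of an equivalence relation. -/
def ofSetoid (s : Setoid (Fin N))
    (hs : ∀ a b c d, s a c → s b d → cw a b c → cw c d a → s a b) : NCPartition p :=
  ⟨Finpartition.ofSetoid s, by
    intro b hb c hc hbc
    obtain ⟨x, hx⟩ := Finpartition.nonempty_of_mem_parts _ hb
    obtain ⟨y, hy⟩ := Finpartition.nonempty_of_mem_parts _ hc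
    have hdis := Finpartition.disjoint _ hb hc hbc
    rw [← Finpartition.part_eq_of_mem _ hb hx, ← Finpartition.part_eq_of_mem _ hc hy] at *
    refine p.noncrossing_of_not_interleave ⟨x, hx⟩ ⟨y, hy⟩ ?_ hdis
    rintro ⟨a, ha, b, hb, c, hc, d, hd, h1, h2⟩
    rw [Finpartition.mem_part_ofSetoid_iff_rel] at ha hb hc hd
    have h3 := hs a b c d (s.trans (s.symm ha) hc) (s.trans (s.symm hb) hd) h1 h2
    refine Finset.disjoint_left.1 hdis (Finpartition.mem_part_ofSetoid_iff_rel.2 ha) ?_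
    change a ∈ (Finpartition.ofSetoid s).part y
    rw [Finpartition.mem_part_ofSetoid_iff_rel]
    exact s.trans hb (s.symm h3)⟩

theorem rel_ofSetoid {s : Setoid (Fin N)}
    {hs : ∀ a b c d, s a c → s b d → cw a b c → cw c d a → s a b} :
    (ofSetoid p s hs).Rel x y ↔ s x y := by
  classical
  rw [← mem_part_iff]
  exact Finpartition.mem_part_ofSetoid_iff_rel

/-- The noncrossing permutation moves each vertex to the next one of its block. -/
theorem perm_spec (π : NCPartition p) (x : Fin N) :
    π.Rel x (π.perm x) ∧ (∀ z, π.Rel x z → ¬ cw x z (π.perm x)) ∧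
      (π.perm x = x → ∀ z, π.Rel x z → z = x) := by
  obtain ⟨h1, h2, h3⟩ := cyc_spec (mem_part_iff.2 (Rel.refl π x))
  exact ⟨mem_part_iff.1 h1, fun z hz => h2 z (mem_part_iff.2 hz),
    fun h z hz => h3 h z (mem_part_iff.2 hz)⟩

/-- Of two different candidates for the next vertex of the block, one would come strictly before the
other. -/
theorem perm_eq (h1 : π.Rel x y) (h2 : ∀ z, π.Rel x z → ¬ cw x z y)
    (h3 : y = x → ∀ z, π.Rel x z → z = x) : π.perm x = y := by
  obtain ⟨k1, k2, k3⟩ := π.perm_spec x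
  have a1 := h2 _ k1
  have a2 := k2 _ h1
  by_contra hne
  by_cases hy : y = x
  · exact hne ((h3 hy _ k1).trans hy.symm)
  · by_cases hz : π.perm x = x
    · exact hy (k3 hz _ h1)
    · rcases cw_total (Ne.symm hy) (Ne.symm hne) (Ne.symm hz) with h | h
      · exact a2 h
      · exact a1 h

theorem perm_injective (π : NCPartition p) : Function.Injective π.perm := by
  intro x y hxy
  obtain ⟨k1, k2, k3⟩ := π.perm_spec x
  obtain ⟨l1, l2, l3⟩ := π.perm_spec y
  have hr : π.Rel x y := by rw [← hxy] at l1; exact k1.trans l1.symm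
  rw [← hxy] at l1 l2 l3
  have a1 := k2 y hr
  have a2 := l2 x hr.symm
  by_contra hne
  by_cases hx : π.perm x = x
  · exact hne (k3 hx y hr).symm
  · by_cases hy : π.perm x = y
    · exact hne (l3 hy x hr.symm)
    · simp only [cw] at *; omega

/-- The noncrossing permutation is transitive on each block. -/
theorem rel_induction {P : Fin N → Prop} (hx : P x) (h : ∀ z, π.Rel x z → P z → P (π.perm z))
    (hxy : π.Rel x y) : P y := by
  have hcyc : (cyc (π.1.part x)).IsCycleOn {a | a ∈ (π.1.part x).sort (· ≤ ·)} :=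
    List.Nodup.isCycleOn_formPerm (Finset.sort_nodup _ _)
  have hmem : ∀ {z}, z ∈ {a | a ∈ (π.1.part x).sort (· ≤ ·)} ↔ π.Rel x z := by
    intro z
    rw [Set.mem_ofPred_eq, Finset.mem_sort, mem_part_iff]
  obtain ⟨i, -, rfl⟩ := hcyc.exists_pow_eq' (Set.toFinite _) (hmem.2 (Rel.refl π x)) (hmem.2 hxy)
  clear hxy
  have : π.Rel x ((cyc (π.1.part x) ^ i) x) ∧ P ((cyc (π.1.part x) ^ i) x) := by
    induction i with
    | zero => exact ⟨rfl, hx⟩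
    | succ i ih =>
      rw [pow_succ', Equiv.Perm.mul_apply]
      have h1 : cyc (π.1.part x) ((cyc (π.1.part x) ^ i) x) =
          π.perm ((cyc (π.1.part x) ^ i) x) := by
        rw [perm, ← show π.1.part x = _ from ih.1]
      rw [h1]
      exact ⟨ih.1.trans (π.perm_spec _).1, h _ ih.1 ih.2⟩
  exact this.2

/-- The blocks are the orbits of the permutation. -/
theorem eq_of_perm_eq (h : ∀ x, π.perm x = ρ.perm x) : π = ρ := by
  have key : ∀ {π ρ : NCPartition p}, (∀ x, π.perm x = ρ.perm x) → π ≤ ρ := by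
    intro π ρ h
    rw [le_iff]
    intro x y hxy
    refine rel_induction (P := fun y => ρ.Rel x y) (Rel.refl ρ x) (fun z _ hz => ?_) hxy
    rw [h]
    exact hz.trans (ρ.perm_spec z).1
  exact le_antisymm (key h) (key fun x => (h x).symm)

theorem perm_bot (x : Fin N) : (⊥ : NCPartition p).perm x = x :=
  perm_eq (Rel.refl _ _) (fun z hz => by rw [rel_bot_iff] at hz; subst hz; simp only [cw]; omega)
    fun _ z hz => (rel_bot_iff.1 hz).symm

/-! ### Merging blocks. -/

/-- The blocks of `π'` are those of `π`, except that all blocks that meet `e` are merged. -/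
def IsMerge (π π' : NCPartition p) (e : Finset (Fin N)) : Prop :=
  ∀ x y, π'.Rel x y ↔ π.Rel x y ∨ (∃ a ∈ e, π.Rel x a) ∧ ∃ b ∈ e, π.Rel y b

/-- Merging the blocks that meet `e` multiplies the permutation by the cycle of `e`, provided that
from each vertex of `e` its block comes before all other vertices of `e`. -/
theorem IsMerge.perm_eq {π' : NCPartition p} {e : Finset (Fin N)} (h : IsMerge π π' e)
    (hG : ∀ a ∈ e, ∀ b ∈ e, b ≠ a → ∀ z, π.Rel a z → z = a ∨ cw a z b) (x : Fin N) :
    π'.perm x = cyc e (π.perm x) := by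
  obtain ⟨k1, k2, k3⟩ := π.perm_spec x
  set y := π.perm x with hy
  -- By `hG` the old block of a vertex `y` of `e` is run through, from `y` to its last vertex `x`,
  -- before the next vertex of `e` is reached. So only the predecessors of vertices of `e` get a new
  -- successor.
  by_cases hye : y ∈ e
  · obtain ⟨c1, c2, c3⟩ := cyc_spec hye
    set y' := cyc e y with hy'
    refine NCPartition.perm_eq ((h x y').2 (Or.inr ⟨⟨y, hye, k1⟩, y', c1, Rel.refl _ _⟩)) ?_ ?_
    · have main : ∀ z, π.Rel x z → ¬ cw x z y' := by
        intro z hz hcw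
        have a1 := k2 z hz
        by_cases hyy : y' = y
        · exact a1 (hyy ▸ hcw)
        · have a2 := hG y hye y' c1 hyy x k1.symm
          have a3 := hG y hye y' c1 hyy z (k1.symm.trans hz)
          by_cases hxy : y = x
          · have := k3 hxy z hz
            simp only [cw] at *; omega
          · simp only [cw] at *; omega
      intro z hz
      rcases (h x z).1 hz with hz | ⟨-, b, hb, hzb⟩
      · exact main z hz
      by_cases hby : b = y
      · subst hby; exact main z (k1.trans hzb.symm)
      intro hcw
      have hyy : y' ≠ y := fun h => hby (c3 h b hb)
      have a1 := c2 b hb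
      have a2 := hG y hye y' c1 hyy x k1.symm
      have a3 := hG b hb y hye (Ne.symm hby) z hzb.symm
      simp only [cw] at *
      omega
    · intro hyx z hz
      have hyy : y' = y := by
        by_contra hyy
        have a2 := hG y hye y' c1 hyy x k1.symm
        simp only [cw] at *
        omega
      rcases (h x z).1 hz with hz | ⟨-, b, hb, hzb⟩
      · exact k3 (hyy.symm.trans hyx) z hz
      · have := c3 hyy b hb
        subst this
        exact k3 (hyy.symm.trans hyx) z (k1.trans hzb.symm)
  · rw [cyc_of_notMem hye]
    refine NCPartition.perm_eq ((h x y).2 (Or.inl k1)) ?_ ?_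
    · intro z hz
      rcases (h x z).1 hz with hz | ⟨⟨a, ha, hxa⟩, b, hb, hzb⟩
      · exact k2 z hz
      by_cases hab : b = a
      · subst hab; exact k2 z (hxa.trans hzb.symm)
      have a1 := hG a ha b hb hab x hxa.symm
      have a2 := hG a ha b hb hab y (hxa.symm.trans k1)
      have a3 := hG b hb a ha (Ne.symm hab) z hzb.symm
      have a4 := k2 a hxa
      have hya : y ≠ a := by rintro h; exact hye (h ▸ ha)
      simp only [cw] at *
      omega
    · intro hyx z hz
      rcases (h x z).1 hz with hz | ⟨⟨a, ha, hxa⟩, b, hb, hzb⟩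
      · exact k3 hyx z hz
      · have := k3 hyx a hxa
        exact absurd (this ▸ ha) (hyx ▸ hye)

theorem card_parts_le (π : NCPartition p) : π.1.parts.card ≤ N := by
  simpa using π.1.card_parts_le_card

/-- Merging `k` blocks increases the rank by `k - 1`. -/
theorem IsMerge.rank_eq {π' : NCPartition p} {e : Finset (Fin N)} (h : IsMerge π π' e)
    (he : e.Nonempty) (hinj : ∀ a ∈ e, ∀ b ∈ e, π.Rel a b → a = b) :
    π'.rank = π.rank + (e.card - 1) := by
  classical
  obtain ⟨a, ha⟩ := he
  have hparts : π'.1.parts = insert (π'.1.part a) (π.1.parts \ e.image π.1.part) := by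
    ext b
    rw [Finset.mem_insert, Finset.mem_sdiff, Finset.mem_image]
    have hsame : ∀ x, (¬ ∃ a ∈ e, π.Rel x a) → π'.1.part x = π.1.part x := by
      intro x hx
      ext y
      rw [mem_part_iff, mem_part_iff, h x y]
      exact ⟨fun h => h.resolve_right fun h => hx h.1, Or.inl⟩
    constructor
    · intro hb
      obtain ⟨x, rfl⟩ := exists_part_eq hb
      by_cases hx : ∃ a ∈ e, π.Rel x a
      · exact Or.inl ((h x a).2 (Or.inr ⟨hx, a, ha, Rel.refl _ _⟩))
      · right
        rw [hsame x hx]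
        refine ⟨part_mem π x, ?_⟩
        rintro ⟨c, hc, hcx⟩
        exact hx ⟨c, hc, hcx.symm⟩
    · rintro (rfl | ⟨hb, hne⟩)
      · exact part_mem π' a
      · obtain ⟨x, rfl⟩ := exists_part_eq hb
        rw [← hsame x fun ⟨c, hc, hcx⟩ => hne ⟨c, hc, hcx.symm⟩]
        exact part_mem π' x
  have hnot : π'.1.part a ∉ π.1.parts \ e.image π.1.part := by
    rw [Finset.mem_sdiff]
    rintro ⟨h1, h2⟩
    have h3 := π.1.part_eq_of_mem h1 (mem_part_iff.2 (Rel.refl π' a))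
    exact h2 (Finset.mem_image.2 ⟨a, ha, h3⟩)
  have hsub : e.image π.1.part ⊆ π.1.parts := by
    intro b hb
    obtain ⟨c, -, rfl⟩ := Finset.mem_image.1 hb
    exact part_mem π c
  have hcard : (e.image π.1.part).card = e.card :=
    Finset.card_image_of_injOn fun x hx y hy hxy => hinj x hx y hy hxy
  have h1 : π'.1.parts.card = π.1.parts.card - e.card + 1 := by
    rw [hparts, Finset.card_insert_of_notMem hnot, Finset.card_sdiff_of_subset hsub, hcard]
  have h2 := Finset.card_le_card hsub
  have h3 := π.card_parts_le
  have h4 := Finset.card_pos.2 ⟨a, ha⟩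
  simp only [rank]
  omega

theorem rank_bot : (⊥ : NCPartition p).rank = 0 := by
  have : (⊥ : NCPartition p).1.parts.card = N := by
    change (⊥ : Finpartition (Finset.univ : Finset (Fin N))).parts.card = N
    rw [Finpartition.card_bot]; simp
  simp [rank, this]

end NCPartition

end Partitions

end NCHT
end

noncomputable section

namespace NCHT

/-! ### Proper orderings and labelled chains -/

section Chains

variable {N : ℕ} {p : ConvexPolygon N}

theorem conn_insert_iff {V : Type} [DecidableEq V] {E : Finset (Finset V)} {e : Finset V}
    {x y : V} : Conn (insert e E) x y ↔
      Conn E x y ∨ (∃ a ∈ e, Conn E x a) ∧ ∃ b ∈ e, Conn E y b := by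
  constructor
  · intro h
    induction h with
    | refl => exact Or.inl Relation.ReflTransGen.refl
    | @tail b c _ hbc ih =>
      obtain ⟨f, hf, hb, hc⟩ := hbc
      rcases Finset.mem_insert.1 hf with rfl | hf
      · right
        rcases ih with ih | ⟨ih, -⟩
        · exact ⟨⟨b, hb, ih⟩, c, hc, Relation.ReflTransGen.refl⟩
        · exact ⟨ih, c, hc, Relation.ReflTransGen.refl⟩
      · have h1 : Conn E b c := Conn.single hf hb hc
        rcases ih with ih | ⟨ih, d, hd, hbd⟩
        · exact Or.inl (ih.trans h1)
        · exact Or.inr ⟨ih, d, hd, h1.symm.trans hbd⟩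
  · rintro (h | ⟨⟨a, ha, hxa⟩, b, hb, hyb⟩)
    · exact h.mono (Finset.subset_insert _ _)
    · exact ((hxa.mono (Finset.subset_insert _ _)).trans
        (Conn.single (Finset.mem_insert_self _ _) ha hb)).trans
        (hyb.mono (Finset.subset_insert _ _)).symm

/-! ### Components of sets of hyperedges, and lower sets. -/

namespace NCHypertree

variable (τ : NCHypertree p)

/-- The noncrossing partition into the connected components of a set of hyperedges. -/
def comp {D : Finset (Finset (Fin N))} (hD : D ⊆ τ.edges) : NCPartition p :=
  NCPartition.ofSetoid p
    ⟨Conn D, fun _ => Relation.ReflTransGen.refl, Conn.symm, Conn.trans⟩ (by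
      intro a b c d hac hbd h1 h2
      change Conn D a b
      change Conn D a c at hac
      change Conn D b d at hbd
      -- The path from `a` to `c` contains a hyperedge that crosses the diagonal from `b` to `d`,
      -- and the path from `b` to `d` one that crosses this hyperedge.
      by_contra hab
      obtain ⟨x, y, hax, ⟨g, hg, hxg, hyg⟩, hx, hy⟩ := exists_step hac
        (P := fun x => cw d x b) (by simp only [cw] at *; omega) (by simp only [cw] at *; omega)
      change Conn D a x at hax
      have hay : Conn D a y := hax.trans (Conn.single hg hxg hyg)
      have hne : ∀ {x z}, Conn D a x → Conn D b z → x ≠ z := by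
        rintro x z hx hz rfl
        exact hab (hx.trans hz.symm)
      have hyb := hne hay Relation.ReflTransGen.refl
      have hyd := hne hay hbd
      obtain ⟨z, w, hbz, ⟨k, hk, hzk, hwk⟩, hz, hw⟩ := exists_step hbd
        (P := fun z => cw x z y) (by simp only [cw] at *; omega) (by simp only [cw] at *; omega)
      change Conn D b z at hbz
      have hbw : Conn D b w := hbz.trans (Conn.single hk hzk hwk)
      have hxw := hne hax hbw
      have hyw := hne hay hbw
      refine τ.not_interleave (hD hg) (hD hk) ?_ ⟨x, hxg, z, hzk, y, hyg, w, hwk, hz,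
        by simp only [cw] at *; omega⟩
      rintro rfl
      exact hab ((hax.trans (Conn.single hg hxg hzk)).trans hbz.symm))

variable {τ} {D : Finset (Finset (Fin N))} {hD : D ⊆ τ.edges} {e f : Finset (Fin N)}

theorem rel_comp {x y : Fin N} : (τ.comp hD).Rel x y ↔ Conn D x y :=
  NCPartition.rel_ofSetoid

theorem isMerge_comp {D' : Finset (Finset (Fin N))} (hD' : D' ⊆ τ.edges) (h : D' = insert e D) :
    NCPartition.IsMerge (τ.comp hD) (τ.comp hD') e := by
  subst h
  intro x y
  simp only [rel_comp]
  exact conn_insert_iff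

theorem eq_of_conn_of_notMem (hD : D ⊆ τ.edges) (he : e ∈ τ.edges) (heD : e ∉ D) {a b : Fin N}
    (ha : a ∈ e) (hb : b ∈ e) (h : Conn D a b) : a = b :=
  τ.eq_of_conn he ha hb (h.mono fun _ hf =>
    Finset.mem_erase.2 ⟨fun h => heD (h ▸ hf), hD hf⟩)

/-- Acyclicity means that each added hyperedge merges blocks that are all distinct. -/
theorem rank_comp (hD : D ⊆ τ.edges) : (τ.comp hD).rank = ∑ e ∈ D, (e.card - 1) := by
  classical
  induction D using Finset.induction_on with
  | empty =>
    have : τ.comp hD = ⊥ := by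
      refine NCPartition.ext_rel fun x y => ?_
      rw [rel_comp, NCPartition.rel_bot_iff]
      refine ⟨conn_empty, ?_⟩
      rintro rfl
      exact Relation.ReflTransGen.refl
    rw [this, NCPartition.rank_bot, Finset.sum_empty]
  | insert e D he ih =>
    have hD' : D ⊆ τ.edges := (Finset.subset_insert _ _).trans hD
    have heτ : e ∈ τ.edges := hD (Finset.mem_insert_self _ _)
    rw [(isMerge_comp (hD := hD') hD rfl).rank_eq
      (Finset.card_pos.1 (by have := τ.two_le heτ; omega)) ?_, ih hD', Finset.sum_insert he,
      add_comm]
    intro a ha b hb hab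
    exact eq_of_conn_of_notMem hD' heτ he ha hb (rel_comp.1 hab)

/-- A set of hyperedges of `τ` that is closed downwards in the local orders. -/
def IsLower (τ : NCHypertree p) (D : Finset (Finset (Fin N))) : Prop :=
  D ⊆ τ.edges ∧ ∀ d ∈ D, ∀ f ∈ τ.edges, f ∉ D → ∀ v, v ∈ d → v ∈ f → LeftFrom v d f

/-- From a vertex `a` of a hyperedge `e`, the vertices joined to `a` by hyperedges that are lower
than `e` come before the other vertices of `e`. -/
theorem cw_of_conn (hD : D ⊆ τ.edges) (he : e ∈ τ.edges) (heD : e ∉ D)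
    (hleft : ∀ d ∈ D, ∀ v, v ∈ d → v ∈ e → LeftFrom v d e) {a b z : Fin N} (ha : a ∈ e)
    (hb : b ∈ e) (hba : b ≠ a) (hz : Conn D a z) : z = a ∨ cw a z b := by
  -- The path leaves `a` through a hyperedge of `D`, to the left of `e`. To get past `b` it needs a
  -- hyperedge that crosses the diagonal of `e` from `a` to `b`.
  by_contra! hc
  have hzb : z ≠ b := by
    rintro rfl
    exact hba (eq_of_conn_of_notMem hD he heD ha hb hz).symm
  obtain ⟨d, hd, had, y, hy, hya, hzy⟩ := hz.symm.exists_last hc.1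
  have h1 := hleft d hd a had ha y hy b hb hya hba
  obtain ⟨x, w, hyx, ⟨hxa, hwa, g, hg, hxg, hwg⟩, hx, hw⟩ := exists_step hzy.symm
    (P := fun x => cw a x b) h1 hc.2
  have hyw : ConnAvoid D a y w := hyx.tail ⟨hxa, hwa, g, hg, hxg, hwg⟩
  have hwb : w ≠ b := by
    rintro rfl
    exact hba (eq_of_conn_of_notMem hD he heD ha hb
      ((Conn.single hd had hy).trans hyw.conn)).symm
  refine τ.not_interleave (hD hg) he (by rintro rfl; exact heD hg) ⟨x, hxg, b, hb, w, hwg, a, ha,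
    by simp only [cw] at *; omega, by simp only [cw] at *; omega⟩

/-- The noncrossing permutation of a lower set of hyperedges gives cuts of the hypertree. -/
theorem IsLower.subset_or (hL : IsLower τ D) {u : Fin N} (hf : f ∈ τ.edges)
    (hu : (τ.comp hL.1).perm u ≠ u) :
    f ⊆ arc ((τ.comp hL.1).perm u) u ∨ f ⊆ coarc ((τ.comp hL.1).perm u) u := by
  obtain ⟨k1, k2, k3⟩ := (τ.comp hL.1).perm_spec u
  set v := (τ.comp hL.1).perm u with hv
  rw [rel_comp] at k1
  have k2' : ∀ z, Conn D u z → ¬ cw u z v := fun z hz => k2 z (rel_comp.2 hz)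
  -- a failure of the cut property, described by two vertices of `f`
  by_contra! hc
  obtain ⟨⟨b, hb, hb'⟩, ⟨a, ha, ha'⟩⟩ := And.intro
    (Finset.not_subset.1 hc.1) (Finset.not_subset.1 hc.2)
  rw [mem_arc] at hb'
  rw [mem_coarc] at ha'
  have hb2 : cw u b v := by simp only [cw] at *; omega
  have ha2 : a = u ∨ cw v a u := by simp only [cw] at *; omega
  have hnb : ¬ Conn D u b := fun h => k2' b h hb2
  -- A hyperedge of `D` with vertices on both sides meets or crosses the block of `u`, which would
  -- put `b` in this block between `u` and its successor `v`.
  have hfD : f ∉ D := by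
    intro hfD
    by_cases hau : Conn D u a
    · exact hnb (hau.trans (Conn.single hfD ha hb))
    · have hau' : a ≠ u := by rintro rfl; exact hau Relation.ReflTransGen.refl
      exact hau ((rel_comp (hD := hL.1)).1 ((τ.comp hL.1).rel_of_cross (a := u) (b := b) (c := v)
        (d := a) (rel_comp.2 k1) (rel_comp.2 (Conn.single hfD hb ha)) hb2
        (by simp only [cw] at *; omega)) |>.trans (Conn.single hfD hb ha))
  -- Lowness of `D` is needed here: seen from `a`, its whole component would come before `b`, but
  -- `v` comes after `b`.
  have hna : ¬ Conn D u a := by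
    intro hua
    have hG : ∀ z, Conn D a z → z = a ∨ cw a z b := fun z hz =>
      cw_of_conn hL.1 hf hfD (fun d hd w hwd hwf => hL.2 d hd f hf hfD w hwd hwf) ha hb
        (by rintro rfl; exact hnb hua) hz
    have h1 := hG u hua.symm
    have h2 := hG v (hua.symm.trans k1)
    simp only [cw] at *
    omega
  have ha3 : cw v a u := ha2.resolve_left (by rintro rfl; exact hna Relation.ReflTransGen.refl)
  obtain ⟨x, y, hux, ⟨g, hg, hxg, hyg⟩, hx, hy⟩ := exists_step k1
    (P := fun x => cw a x b) (by simp only [cw] at *; omega) (by simp only [cw] at *; omega)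
  have hxy : Conn D u y := Relation.ReflTransGen.tail hux ⟨g, hg, hxg, hyg⟩
  have hya : y ≠ a := by rintro rfl; exact hna hxy
  have hyb : y ≠ b := by rintro rfl; exact hnb hxy
  exact τ.not_interleave (hL.1 hg) hf (by rintro rfl; exact hfD hg) ⟨x, hxg, b, hb, y, hyg, a, ha,
    by simp only [cw] at *; omega, by simp only [cw] at *; omega⟩

/-- At a vertex `z`, the cut given by a lower set `D` separates the hyperedges in `D` from the
others. -/
theorem IsLower.subset_arc_iff (hL : IsLower τ D) {u z : Fin N} (he : e ∈ τ.edges) (hz : z ∈ e)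
    (hu : (τ.comp hL.1).perm u = z) (huz : u ≠ z) : e ⊆ arc z u ↔ e ∈ D := by
  obtain ⟨k1, k2, -⟩ := (τ.comp hL.1).perm_spec u
  rw [hu, rel_comp] at k1
  rw [hu] at k2
  constructor
  · intro h
    by_contra heD
    obtain ⟨b, hb, hbz⟩ := exists_ne_of_two_le (τ.two_le he) z
    have h1 := cw_of_conn hL.1 he heD (fun d hd w hwd hwf => hL.2 d hd e he heD w hwd hwf) hz hb
      hbz k1.symm
    have h2 := h hb
    rw [mem_arc] at h2
    simp only [cw] at *
    omega
  · intro heD x hx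
    have h1 := k2 x (rel_comp.2 (k1.trans (Conn.single heD hz hx)))
    rw [mem_arc]
    simp only [cw] at *
    omega

/-! ### The chain of a proper ordering. -/

variable {k : ℕ} {e : Fin k → Finset (Fin N)}

/-- The first `i` hyperedges of an ordering. -/
def initial (e : Fin k → Finset (Fin N)) (i : ℕ) : Finset (Finset (Fin N)) :=
  Finset.image e {j | (j : ℕ) < i}

theorem mem_initial {i : ℕ} {f : Finset (Fin N)} :
    f ∈ initial e i ↔ ∃ j : Fin k, (j : ℕ) < i ∧ e j = f := by
  simp [initial]

theorem IsProperOrdering.mem (h : τ.IsProperOrdering e) (i : Fin k) : e i ∈ τ.edges := by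
  have : e i ∈ (τ.edges : Set (Finset (Fin N))) := h.2.1 ▸ Set.mem_range_self i
  exact this

theorem IsProperOrdering.exists_eq (h : τ.IsProperOrdering e) {f : Finset (Fin N)}
    (hf : f ∈ τ.edges) : ∃ i, e i = f := by
  have : f ∈ Set.range e := h.2.1 ▸ hf
  exact this

theorem IsProperOrdering.mem_initial_iff (h : τ.IsProperOrdering e) {j : Fin k} {i : ℕ} :
    e j ∈ initial e i ↔ (j : ℕ) < i := by
  rw [mem_initial]
  refine ⟨?_, fun h => ⟨j, h, rfl⟩⟩
  rintro ⟨l, hl, hlj⟩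
  rwa [← h.1 hlj]

theorem edgeLT_of_leftFrom {e f : Finset (Fin N)} {v : Fin N} (he : e ∈ τ.edges)
    (hf : f ∈ τ.edges) (hve : v ∈ e) (hvf : v ∈ f) (h : LeftFrom v e f) : τ.EdgeLT e f :=
  Relation.TransGen.single ⟨he, hf, ne_of_leftFrom he h, v, hve, hvf, leftOf_iff.2 h⟩

theorem IsProperOrdering.isLower (h : τ.IsProperOrdering e) (i : ℕ) :
    IsLower τ (initial e i) := by
  refine ⟨fun f hf => ?_, fun d hd f hf hfD v hvd hvf => ?_⟩
  · obtain ⟨j, -, rfl⟩ := mem_initial.1 hf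
    exact h.mem j
  · obtain ⟨j, hj, rfl⟩ := mem_initial.1 hd
    obtain ⟨l, rfl⟩ := h.exists_eq hf
    rw [h.mem_initial_iff] at hfD
    have hjl : e j ≠ e l := fun hh => hfD (h.1 hh ▸ hj)
    refine (leftFrom_or (h.mem j) hf hjl hvd hvf).resolve_right fun hl => ?_
    have := h.2.2 l j (edgeLT_of_leftFrom hf (h.mem j) hvf hvd hl)
    rw [Fin.lt_def] at this
    omega

/-- The chain of noncrossing partitions given by a proper ordering. -/
def IsProperOrdering.chain (h : τ.IsProperOrdering e) (i : Fin (k + 1)) : NCPartition p :=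
  τ.comp (h.isLower i).1

theorem initial_succ (e : Fin k → Finset (Fin N)) (i : Fin k) :
    initial e (i + 1) = insert (e i) (initial e i) := by
  ext f
  rw [Finset.mem_insert, mem_initial, mem_initial]
  constructor
  · rintro ⟨j, hj, rfl⟩
    rcases Nat.lt_succ_iff_lt_or_eq.1 hj with hj | hj
    · exact Or.inr ⟨j, hj, rfl⟩
    · exact Or.inl (by rw [Fin.ext hj])
  · rintro (rfl | ⟨j, hj, rfl⟩)
    · exact ⟨i, by omega, rfl⟩
    · exact ⟨j, by omega, rfl⟩

theorem IsProperOrdering.initial_last (h : τ.IsProperOrdering e) : initial e k = τ.edges := by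
  ext f
  rw [mem_initial]
  refine ⟨?_, fun hf => ?_⟩
  · rintro ⟨j, -, rfl⟩; exact h.mem j
  · obtain ⟨j, rfl⟩ := h.exists_eq hf
    exact ⟨j, j.2, rfl⟩

theorem IsProperOrdering.isMerge (h : τ.IsProperOrdering e) (i : Fin k) :
    NCPartition.IsMerge (h.chain i.castSucc) (h.chain i.succ) (e i) :=
  isMerge_comp _ (initial_succ e i)

/-- Initial segments are lower sets, so `cw_of_conn` supplies the clockwise condition under which
merging along `e i` multiplies the permutation by the cycle of `e i`. -/
theorem IsProperOrdering.isLabelledChain (h : τ.IsProperOrdering e) :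
    IsLabelledChain h.chain e := by
  refine ⟨?_, ?_, ?_, ?_⟩
  · rw [Fin.strictMono_iff_lt_succ]
    intro i
    refine lt_of_le_of_ne (NCPartition.le_iff.2 fun x y hxy => ((h.isMerge i) x y).2 (Or.inl hxy))
      fun heq => ?_
    obtain ⟨a, ha, b, hb, hab⟩ := Finset.one_lt_card.1 (τ.two_le (h.mem i))
    have h1 : (h.chain i.succ).Rel a b := ((h.isMerge i) a b).2
      (Or.inr ⟨⟨a, ha, NCPartition.Rel.refl _ _⟩, b, hb, NCPartition.Rel.refl _ _⟩)
    rw [← heq] at h1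
    refine hab (eq_of_conn_of_notMem (h.isLower i).1 (h.mem i) ?_ ha hb (rel_comp.1 h1))
    rw [h.mem_initial_iff]
    exact lt_irrefl _
  · refine NCPartition.ext_rel fun x y => ?_
    rw [chain, rel_comp, NCPartition.rel_bot_iff]
    have : initial e ((0 : Fin (k + 1)) : ℕ) = ∅ := by simp [initial]
    rw [this]
    refine ⟨conn_empty, ?_⟩
    rintro rfl
    exact Relation.ReflTransGen.refl
  · refine NCPartition.ext_rel fun x y => ?_
    rw [chain, rel_comp, Fin.val_last, h.initial_last]
    exact iff_of_true (τ.conn x y) (NCPartition.rel_top x y)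
  · intro i x
    refine (h.isMerge i).perm_eq (fun a ha b hb hba z hz => ?_) x
    have hi : e i ∉ initial e i := by rw [h.mem_initial_iff]; exact lt_irrefl _
    exact cw_of_conn (h.isLower i).1 (h.mem i) hi
      (fun d hd v hvd hve => (h.isLower i).2 d hd _ (h.mem i) hi v hvd hve) ha hb hba
      (rel_comp.1 hz)

/-- A chain labelled by a proper ordering is determined by the ordering. -/
theorem IsProperOrdering.eq_chain (h : τ.IsProperOrdering e) {c : Fin (k + 1) → NCPartition p}
    (hc : IsLabelledChain c e) : c = h.chain := by
  funext i
  obtain ⟨-, h0, -, hs⟩ := h.isLabelledChain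
  induction i using Fin.induction with
  | zero => rw [hc.2.1, h0]
  | succ i ih =>
    refine NCPartition.eq_of_perm_eq fun x => ?_
    rw [hc.2.2.2, ih, hs]

/-- A weight that decreases along the local orders is decreasing for some proper ordering. -/
theorem exists_isProperOrdering (φ : Finset (Fin N) → ℝ)
    (hφ : ∀ e ∈ τ.edges, ∀ f ∈ τ.edges, ∀ v, v ∈ e → v ∈ f → LeftFrom v e f → φ f ≤ φ e) :
    ∃ (k : ℕ) (e : Fin k → Finset (Fin N)), τ.IsProperOrdering e ∧ Antitone (φ ∘ e) := by
  classical
  -- The number of cuts with a given hyperedge on the lower side drops strictly along the local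
  -- orders: cuts above `f` are above `e`, and one cut separates them. As a tie-breaker after `φ` it
  -- turns sorting into a linear extension.
  let κ : Finset (Fin N) → ℤ := fun e => ((τ.verts.filter fun β => e ⊆ β.lower).card : ℤ)
  have hκ : ∀ e ∈ τ.edges, ∀ f ∈ τ.edges, ∀ v, v ∈ e → v ∈ f → LeftFrom v e f → κ f < κ e := by
    intro e he f hf v hve hvf h
    obtain ⟨β, hβ, -, h1, h2⟩ := exists_vert_of_leftFrom he hf hve hvf h
    refine Nat.cast_lt.2 (Finset.card_lt_card (Finset.ssubset_iff_of_subset ?_ |>.2 ?_))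
    · intro γ hγ
      rw [Finset.mem_filter] at *
      exact ⟨hγ.1, subset_lower_of_leftFrom he hf hve hvf h hγ.1 hγ.2⟩
    · refine ⟨β, Finset.mem_filter.2 ⟨hβ, h1⟩, fun h3 => ?_⟩
      exact not_subset_both hf (Finset.mem_filter.1 h3).2 h2
  let e₀ : Fin τ.edges.card → Finset (Fin N) := fun i => (τ.edges.equivFin.symm i : Finset (Fin N))
  let w : Finset (Fin N) → ℝ ×ₗ ℤ := fun e => toLex (-φ e, -κ e)
  let σ := Tuple.sort (w ∘ e₀)
  have hmono : Monotone ((w ∘ e₀) ∘ σ) := Tuple.monotone_sort _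
  have hmem : ∀ i, e₀ i ∈ τ.edges := fun i => (τ.edges.equivFin.symm i).2
  have hw : ∀ e f, τ.EdgeLT e f → w e < w f := by
    intro e f h
    have hstep : ∀ e f, (e ∈ τ.edges ∧ f ∈ τ.edges ∧ e ≠ f ∧
        ∃ v, v ∈ e ∧ v ∈ f ∧ p.LeftOf v e f) → w e < w f := by
      rintro e f ⟨he, hf, -, v, hve, hvf, hl⟩
      have hl := leftOf_iff.1 hl
      rw [Prod.Lex.toLex_lt_toLex']
      refine ⟨neg_le_neg (hφ e he f hf v hve hvf hl), fun _ => neg_lt_neg (hκ e he f hf v hve hvf hl)⟩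
    induction h with
    | single h => exact hstep _ _ h
    | tail _ h ih => exact ih.trans (hstep _ _ h)
  refine ⟨_, e₀ ∘ σ, ⟨?_, ?_, ?_⟩, ?_⟩
  · exact (Subtype.val_injective.comp (Equiv.injective _)).comp σ.injective
  · rw [Set.range_comp, σ.surjective.range_eq, Set.image_univ]
    ext f
    constructor
    · rintro ⟨i, rfl⟩; exact hmem i
    · intro hf
      exact ⟨τ.edges.equivFin ⟨f, hf⟩, by simp [e₀]⟩
  · intro i j hij
    by_contra hc
    exact absurd (hw _ _ hij) (not_lt.2 (hmono (not_lt.1 hc)))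
  · intro i j hij
    have h1 := hmono hij
    have h2 : (w (e₀ (σ i))) ≤ w (e₀ (σ j)) := h1
    rw [Prod.Lex.toLex_le_toLex] at h2
    rcases h2 with h2 | h2
    · exact (neg_lt_neg_iff.1 h2).le
    · exact (neg_inj.1 h2.1).symm.le

end NCHypertree

end Chains

end NCHT
end

noncomputable section

namespace NCHT

/-! ### Chains of noncrossing partitions are labelled by noncrossing hypertrees -/

section Labels

variable {N : ℕ} {p : ConvexPolygon N}

namespace NCPartition

variable {π ρ : NCPartition p}

/-- Between comparable noncrossing partitions there is one obtained from the lower one by merging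
two blocks. -/
theorem exists_isMerge_of_lt (h : π < ρ) : ∃ (π' : NCPartition p) (a b : Fin N), π < π' ∧
    π' ≤ ρ ∧ ¬ π.Rel a b ∧ IsMerge π π' {a, b} ∧
    (∀ z, π.Rel a z → z = a ∨ cw a z b) ∧ ∀ z, π.Rel b z → z = b ∨ cw b z a := by
  have hle := le_iff.1 h.le
  obtain ⟨x, y, hxy, hnxy⟩ : ∃ x y, ρ.Rel x y ∧ ¬ π.Rel x y := by
    by_contra! hc
    exact h.not_ge (le_iff.2 hc)
  -- At `v` the permutation of `ρ` leaves the block of `π`. The blocks of `v` and `q` are merged,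
  -- and the label joins `q` to the `π`-successor `a` of `v`: the block of `a` then runs from `a` to
  -- `v` before `q` is reached.
  obtain ⟨v, q, hxv, hq, hvq⟩ : ∃ v q, ρ.Rel x v ∧ q = ρ.perm v ∧ ¬ π.Rel v q := by
    by_contra! hc
    exact hnxy (rel_induction (P := fun y => π.Rel x y) (Rel.refl π x)
      (fun z hz hz' => hz'.trans (hc z _ hz rfl)) hxy)
  obtain ⟨r1, r2, -⟩ := ρ.perm_spec v
  obtain ⟨s1, s2, s3⟩ := π.perm_spec v
  rw [← hq] at r1 r2
  set a := π.perm v with ha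
  have hqv : q ≠ v := by rintro rfl; exact hvq (Rel.refl _ _)
  have haq : ¬ π.Rel a q := fun h => hvq (s1.trans h)
  have hne : a ≠ q := by rintro rfl; exact haq (Rel.refl _ _)
  have hav : a = v ∨ cw v q a := by
    have := r2 a (hle _ _ s1)
    simp only [cw] at *
    omega
  have hGa : ∀ z, π.Rel a z → z = a ∨ cw a z q := by
    intro z hz
    have h1 := s2 z (s1.trans hz)
    have h2 := s3
    have h4 : z ≠ q := by rintro rfl; exact haq hz
    rcases hav with hav | hav
    · exact Or.inl ((s3 hav z (s1.trans hz)).trans hav.symm)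
    · simp only [cw] at *; omega
  have hGq : ∀ z, π.Rel q z → z = q ∨ cw q z a := by
    intro z hz
    have h1 := r2 z (r1.trans (hle _ _ hz))
    have h2 : z ≠ v := by rintro rfl; exact hvq hz.symm
    have h3 : z ≠ a := by rintro rfl; exact haq hz.symm
    rcases hav with hav | hav
    · rw [hav]; simp only [cw] at *; omega
    · by_contra hc
      refine hvq (π.rel_of_cross s1 hz hav ?_)
      simp only [cw] at *; omega
  let M : Fin N → Prop := fun x => ∃ c ∈ ({a, q} : Finset (Fin N)), π.Rel x c
  have hM : ∀ {x}, M x ↔ π.Rel x v ∨ π.Rel x q := by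
    intro x
    simp only [M, Finset.mem_insert, Finset.mem_singleton, exists_eq_or_imp, exists_eq_left]
    exact or_congr_left ⟨fun h => h.trans s1.symm, fun h => h.trans s1⟩
  have hMr : ∀ {x y}, π.Rel x y → M x → M y := fun hxy ⟨c, hc, hxc⟩ => ⟨c, hc, hxy.symm.trans hxc⟩
  have hMρ : ∀ {x}, M x → ρ.Rel v x := by
    intro x hx
    rcases hM.1 hx with h | h
    · exact (hle _ _ h).symm
    · exact r1.trans (hle _ _ h).symm
  -- a pair of related vertices does not separate the two blocks
  have key : ∀ x₁ x₂ x₃ x₄, π.Rel x₁ v → π.Rel x₃ q → π.Rel x₂ x₄ → ¬ M x₂ →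
      cw x₁ x₂ x₃ → cw x₃ x₄ x₁ → False := by
    intro x₁ x₂ x₃ x₄ h1 h3 h24 hM2 c1 c2
    have hM4 : ¬ M x₄ := fun h => hM2 (hMr h24.symm h)
    have n2 : ∀ y, π.Rel y v ∨ π.Rel y q → x₂ ≠ y := by rintro y hy rfl; exact hM2 (hM.2 hy)
    have n4 : ∀ y, π.Rel y v ∨ π.Rel y q → x₄ ≠ y := by rintro y hy rfl; exact hM4 (hM.2 hy)
    have hρ1 : ρ.Rel x₁ v := hle _ _ h1
    -- Noncrossing of `ρ` puts `x₂` into the block of `v` and `q`, and noncrossing of `π` puts `v`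
    -- and `q` on different sides of the diagonal from `x₂` to `x₄`. So `x₂` lies between `v` and
    -- its successor `q`.
    have hρ : ρ.Rel x₁ x₂ := ρ.rel_of_cross (hρ1.trans (r1.trans (hle _ _ h3).symm))
      (hle _ _ h24) c1 c2
    have g2 := r2 x₂ (hρ1.symm.trans hρ)
    have m1 := n2 v (Or.inl rfl)
    have m2 := n4 v (Or.inl rfl)
    have m3 := n2 q (Or.inr rfl)
    have m4 := n4 q (Or.inr rfl)
    have p1 : cw x₄ v x₂ := by
      by_contra hc
      refine hM2 (hM.2 (Or.inl ?_))
      exact ((π.rel_of_cross h1 h24 (b := x₂) (d := x₄) (by simp only [cw] at *; omega)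
        (by simp only [cw] at *; omega)).symm).trans h1
    have p2 : cw x₂ q x₄ := by
      by_contra hc
      refine hM4 (hM.2 (Or.inr ?_))
      exact ((π.rel_of_cross h3 h24.symm (b := x₄) (d := x₂) (by simp only [cw] at *; omega)
        (by simp only [cw] at *; omega)).symm).trans h3
    apply g2
    simp only [cw] at *; omega
  let s : Setoid (Fin N) := ⟨fun x y => π.Rel x y ∨ M x ∧ M y, fun x => Or.inl rfl,
    fun h => h.imp Rel.symm And.symm, by
      rintro x y z (h1 | h1) (h2 | h2)
      · exact Or.inl (h1.trans h2)
      · exact Or.inr ⟨hMr h1.symm h2.1, h2.2⟩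
      · exact Or.inr ⟨h1.1, hMr h2 h1.2⟩
      · exact Or.inr ⟨h1.1, h2.2⟩⟩
  have key2 : ∀ x₁ x₂ x₃ x₄, M x₁ → M x₃ → π.Rel x₂ x₄ → ¬ M x₂ →
      cw x₁ x₂ x₃ → cw x₃ x₄ x₁ → False := by
    intro x₁ x₂ x₃ x₄ h1 h3 h24 hM2 c1 c2
    have same : π.Rel x₁ x₃ → False := fun h13 =>
      hM2 (hMr (π.rel_of_cross h13 h24 c1 c2) h1)
    rcases hM.1 h1 with k1 | k1 <;> rcases hM.1 h3 with k3 | k3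
    · exact same (k1.trans k3.symm)
    · exact key _ _ _ _ k1 k3 h24 hM2 c1 c2
    · exact key _ _ _ _ k3 k1 h24.symm (fun h => hM2 (hMr h24.symm h)) c2 c1
    · exact same (k1.trans k3.symm)
  have hs : ∀ a b c d, s a c → s b d → cw a b c → cw c d a → s a b := by
    intro x₁ x₂ x₃ x₄ h13 h24 c1 c2
    by_contra hc
    have hc1 : ¬ π.Rel x₁ x₂ := fun h => hc (Or.inl h)
    have hc2 : ¬ (M x₁ ∧ M x₂) := fun h => hc (Or.inr h)
    rcases h13 with h13 | h13 <;> rcases h24 with h24 | h24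
    · exact hc1 (π.rel_of_cross h13 h24 c1 c2)
    · refine key2 x₂ x₃ x₄ x₁ h24.1 h24.2 h13.symm (fun h => hc2 ⟨hMr h13.symm h, h24.1⟩) ?_ ?_ <;>
        simp only [cw] at * <;> omega
    · exact key2 x₁ x₂ x₃ x₄ h13.1 h13.2 h24 (fun h => hc2 ⟨h13.1, h⟩) c1 c2
    · exact hc2 ⟨h13.1, h24.1⟩
  refine ⟨ofSetoid p s hs, a, q, lt_of_le_of_ne (le_iff.2 fun x y h => rel_ofSetoid.2 (Or.inl h))
    fun heq => ?_, le_iff.2 fun x y h => ?_, haq, fun x y => rel_ofSetoid, hGa, hGq⟩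
  · refine haq ?_
    rw [heq]
    exact rel_ofSetoid.2 (Or.inr ⟨⟨a, by simp, rfl⟩, q, by simp, rfl⟩)
  · rcases rel_ofSetoid.1 h with h | h
    · exact hle _ _ h
    · exact (hMρ h.1).symm.trans (hMρ h.2)

/-- Every chain extends to a chain in which consecutive elements differ by the merging of two
blocks. -/
theorem exists_merging_chain {A : Set (NCPartition p)} (hA : IsChain (· ≤ ·) A) :
    ∃ (k : ℕ) (c : Fin (k + 1) → NCPartition p) (a b : Fin k → Fin N), StrictMono c ∧
      c 0 = ⊥ ∧ c (Fin.last k) = ⊤ ∧ A ⊆ Set.range c ∧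
      ∀ i : Fin k, ¬ (c i.castSucc).Rel (a i) (b i) ∧
        IsMerge (c i.castSucc) (c i.succ) {a i, b i} ∧
        (∀ z, (c i.castSucc).Rel (a i) z → z = a i ∨ cw (a i) z (b i)) ∧
        ∀ z, (c i.castSucc).Rel (b i) z → z = b i ∨ cw (b i) z (a i) := by
  classical
  -- A maximal chain has nothing strictly between consecutive elements, so the merging given by
  -- `exists_isMerge_of_lt` is already the upper one.
  obtain ⟨F, hAF⟩ := hA.exists_subset_flag
  have : Fintype F := Fintype.ofFinite _
  have hbot : (⊥ : NCPartition p) ∈ F := Flag.mem_iff_forall_le_or_ge.2 fun _ _ => Or.inl bot_le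
  have htop : (⊤ : NCPartition p) ∈ F := Flag.mem_iff_forall_le_or_ge.2 fun _ _ => Or.inr le_top
  obtain ⟨k, hk⟩ : ∃ k, Fintype.card F = k + 1 :=
    ⟨Fintype.card F - 1, by have := Fintype.card_pos_iff.2 ⟨(⟨⊥, hbot⟩ : F)⟩; omega⟩
  let φ : Fin (k + 1) ≃o F := Fintype.orderIsoFinOfCardEq F hk
  have hmono : StrictMono fun i => (φ i : NCPartition p) := fun i j hij => φ.strictMono hij
  have hstep : ∀ i : Fin k, ∃ a b : Fin N, ¬ (φ i.castSucc : NCPartition p).Rel a b ∧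
      IsMerge (φ i.castSucc : NCPartition p) (φ i.succ : NCPartition p) {a, b} ∧
      (∀ z, (φ i.castSucc : NCPartition p).Rel a z → z = a ∨ cw a z b) ∧
      ∀ z, (φ i.castSucc : NCPartition p).Rel b z → z = b ∨ cw b z a := by
    intro i
    have hlt : (φ i.castSucc : NCPartition p) < φ i.succ := hmono (Fin.castSucc_lt_succ)
    obtain ⟨π', a, b, h1, h2, h3, h4, h5, h6⟩ := exists_isMerge_of_lt hlt
    have hF : π' ∈ F := by
      rw [Flag.mem_iff_forall_le_or_ge]
      intro ρ hρ
      obtain ⟨j, hj⟩ := φ.surjective ⟨ρ, hρ⟩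
      have hj' : (φ j : NCPartition p) = ρ := congrArg Subtype.val hj
      rcases le_or_gt j i.castSucc with hji | hji
      · right
        rw [← hj']
        exact (hmono.monotone hji).trans h1.le
      · left
        rw [← hj']
        exact h2.trans (hmono.monotone (Fin.castSucc_lt_iff_succ_le.1 hji))
    obtain ⟨j, hj⟩ := φ.surjective ⟨π', hF⟩
    have hj' : (φ j : NCPartition p) = π' := congrArg Subtype.val hj
    have hij : i.castSucc < j := hmono.lt_iff_lt.1 (by simpa [hj'] using h1)
    have hji : j ≤ i.succ := hmono.le_iff_le.1 (by simpa [hj'] using h2)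
    have : j = i.succ := le_antisymm hji (Fin.castSucc_lt_iff_succ_le.1 hij)
    rw [← hj', this] at h4
    exact ⟨a, b, h3, h4, h5, h6⟩
  choose a b hab using hstep
  refine ⟨k, fun i => φ i, a, b, hmono, ?_, ?_, ?_, hab⟩
  · obtain ⟨j, hj⟩ := φ.surjective ⟨⊥, hbot⟩
    have hj' : (φ j : NCPartition p) = ⊥ := congrArg Subtype.val hj
    exact le_antisymm ((hmono.monotone (Fin.zero_le j)).trans hj'.le) bot_le
  · obtain ⟨j, hj⟩ := φ.surjective ⟨⊤, htop⟩
    have hj' : (φ j : NCPartition p) = ⊤ := congrArg Subtype.val hj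
    exact le_antisymm le_top (hj'.ge.trans (hmono.monotone (Fin.le_last j)))
  · intro π hπ
    obtain ⟨j, hj⟩ := φ.surjective ⟨π, hAF hπ⟩
    exact ⟨j, congrArg Subtype.val hj⟩

end NCPartition

open NCPartition NCHypertree in
/-- Every chain of noncrossing partitions lies in a chain that is labelled by a proper ordering of
a noncrossing hypertree. -/
theorem exists_isLabelledChain {A : Set (NCPartition p)} (hA : IsChain (· ≤ ·) A) :
    ∃ (τ : NCHypertree p) (k : ℕ) (e : Fin k → Finset (Fin N)) (c : Fin (k + 1) → NCPartition p),
      τ.IsProperOrdering e ∧ IsLabelledChain c e ∧ A ⊆ Set.range c := by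
  classical
  obtain ⟨k, c, a, b, hmono, h0, hlast, hAc, hstep⟩ := exists_merging_chain hA
  -- Each merging joins two blocks, so all labels have two elements and the hypertree found here is
  -- a tree.
  let e : Fin k → Finset (Fin N) := fun i => {a i, b i}
  have hmem : ∀ {i x}, x ∈ e i ↔ x = a i ∨ x = b i := by
    intro i x; simp [e]
  have hinj : ∀ i, ∀ x ∈ e i, ∀ y ∈ e i, (c i.castSucc).Rel x y → x = y := by
    intro i x hx y hy hxy
    rcases hmem.1 hx with rfl | rfl <;> rcases hmem.1 hy with rfl | rfl
    · rfl
    · exact absurd hxy (hstep i).1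
    · exact absurd hxy.symm (hstep i).1
    · rfl
  have hG : ∀ i, ∀ x ∈ e i, ∀ y ∈ e i, y ≠ x → ∀ z, (c i.castSucc).Rel x z →
      z = x ∨ cw x z y := by
    intro i x hx y hy hxy z hz
    rcases hmem.1 hx with rfl | rfl <;> rcases hmem.1 hy with rfl | rfl
    · exact absurd rfl hxy
    · exact (hstep i).2.2.1 z hz
    · exact (hstep i).2.2.2 z hz
    · exact absurd rfl hxy
  have hne : ∀ i, a i ≠ b i := fun i h => (hstep i).1 (by rw [h]; exact Rel.refl _ _)
  have htwo : ∀ i, (e i).card = 2 := fun i => Finset.card_pair (hne i)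
  have hrel : ∀ i j : Fin k, i < j → ∀ x ∈ e i, ∀ y ∈ e i, (c j.castSucc).Rel x y := by
    intro i j hij x hx y hy
    have h1 : (c i.succ).Rel x y := ((hstep i).2.1 x y).2
      (Or.inr ⟨⟨x, hx, Rel.refl _ _⟩, y, hy, Rel.refl _ _⟩)
    exact le_iff.1 (hmono.monotone (by rw [Fin.le_def]; simpa using hij)) x y h1
  have hconn : ∀ i : Fin (k + 1), ∀ x y, Conn (initial e i) x y ↔ (c i).Rel x y := by
    intro i
    induction i using Fin.induction with
    | zero =>
      intro x y
      have : initial e ((0 : Fin (k + 1)) : ℕ) = ∅ := by simp [initial]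
      rw [this, h0, rel_bot_iff]
      refine ⟨conn_empty, ?_⟩
      rintro rfl
      exact Relation.ReflTransGen.refl
    | succ i ih =>
      intro x y
      rw [Fin.val_succ, initial_succ, conn_insert_iff, (hstep i).2.1 x y]
      simp only [Fin.val_castSucc] at ih
      simp only [ih, e]
  have heinj : Function.Injective e := by
    have key : ∀ i j, i < j → e i ≠ e j := fun i j hij h =>
      (hstep j).1 (hrel i j hij _ (h ▸ hmem.2 (Or.inl rfl)) _ (h ▸ hmem.2 (Or.inr rfl)))
    intro i j hij
    rcases lt_trichotomy i j with h | h | h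
    · exact absurd hij (key i j h)
    · exact h
    · exact absurd hij.symm (key j i h)
  have hcommon : ∀ i j : Fin k, i < j → ∀ x ∈ e i, x ∈ e j → ∀ y ∈ e i, y ∈ e j → x = y :=
    fun i j hij x hx hx' y hy hy' => hinj j x hx' y hy' (hrel i j hij x hx y hy)
  -- If `e i` crossed the later `e j`, noncrossing after the merging would put `e i` into the old
  -- block of an end of `e j`; the clockwise condition keeps this block on one side of `e j`.
  have hcross : ∀ i j : Fin k, i < j → ¬ Interleave (e i) (e j) := by
    rintro i j hij ⟨x, hx, z, hz, y, hy, w, hw, c1, c2⟩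
    have hxy := hrel i j hij x hx y hy
    have hzw : (c j.succ).Rel z w := ((hstep j).2.1 z w).2
      (Or.inr ⟨⟨z, hz, Rel.refl _ _⟩, w, hw, Rel.refl _ _⟩)
    have hxz := (c j.succ).rel_of_cross
      (le_iff.1 (hmono.monotone (Fin.castSucc_lt_succ (i := j)).le) _ _ hxy) hzw c1 c2
    obtain ⟨d, hd, hxd⟩ : ∃ d ∈ e j, (c j.castSucc).Rel x d := by
      rcases ((hstep j).2.1 x z).1 hxz with h | h
      · exact ⟨z, hz, h⟩
      · exact h.1
    have hzw' : z ≠ w := by rintro rfl; simp only [cw] at c1 c2; omega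
    have hd' : d = z ∨ d = w := by
      have := hmem.1 hd
      have := hmem.1 hz
      have := hmem.1 hw
      omega
    rcases hd' with rfl | rfl
    · have h1 := hG j d hd w hw hzw'.symm x hxd.symm
      have h2 := hG j d hd w hw hzw'.symm y (hxd.symm.trans hxy)
      simp only [cw] at *; omega
    · have h1 := hG j d hd z hz hzw' x hxd.symm
      have h2 := hG j d hd z hz hzw' y (hxd.symm.trans hxy)
      simp only [cw] at *; omega
  have hleft : ∀ i j : Fin k, i < j → ∀ v, v ∈ e i → v ∈ e j → LeftFrom v (e i) (e j) := by
    intro i j hij v hvi hvj x hx z hz hxv hzv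
    exact (hG j v hvj z hz hzv x (hrel i j hij v hvi x hx)).resolve_left hxv
  let τ : NCHypertree p := ⟨⟨Finset.univ.image e, by
      intro f hf
      obtain ⟨i, -, rfl⟩ := Finset.mem_image.1 hf
      exact (htwo i).ge⟩, ⟨by
      intro x y
      have h1 := (hconn (Fin.last k) x y).2 (by rw [hlast]; exact rel_top x y)
      refine h1.mono (F := Finset.univ.image e) fun f hf => ?_
      obtain ⟨i, -, rfl⟩ := mem_initial.1 hf
      exact Finset.mem_image_of_mem _ (Finset.mem_univ _), by
      refine Hypergraph.isHyperforest_of_order e (fun f hf => ?_) fun j x hx y hy hxy => ?_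
      · obtain ⟨i, -, rfl⟩ := Finset.mem_image.1 hf
        exact ⟨i, rfl⟩
      · exact hinj j x hx y hy ((hconn j.castSucc x y).1 hxy)⟩, by
      intro f hf g hg hfg
      obtain ⟨i, -, rfl⟩ := Finset.mem_image.1 hf
      obtain ⟨j, -, rfl⟩ := Finset.mem_image.1 hg
      have hij : i ≠ j := fun h => hfg (by rw [h])
      refine p.weaklyNoncrossing_of_not_interleave (htwo i).ge (htwo j).ge ?_ ?_
      · rcases lt_or_gt_of_ne hij with h | h
        · exact hcross i j h
        · exact fun hi => hcross j i h hi.symm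
      · rcases lt_or_gt_of_ne hij with h | h
        · exact hcommon i j h
        · exact fun x hx hx' y hy hy' => hcommon j i h x hx' hx y hy' hy⟩
  have hτ : ∀ {f}, f ∈ τ.edges ↔ ∃ i, e i = f := by
    intro f
    change f ∈ Finset.univ.image e ↔ _
    simp
  refine ⟨τ, k, e, c, ⟨heinj, ?_, ?_⟩, ⟨hmono, h0, hlast, fun i x =>
    (hstep i).2.1.perm_eq (hG i) x⟩, hAc⟩
  · ext f
    exact hτ.symm
  · have key : ∀ f g, τ.EdgeLT f g → ∀ i j, e i = f → e j = g → i < j := by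
      intro f g hfg
      have hone : ∀ f g, (f ∈ τ.edges ∧ g ∈ τ.edges ∧ f ≠ g ∧
          ∃ v, v ∈ f ∧ v ∈ g ∧ p.LeftOf v f g) → ∀ i j, e i = f → e j = g → i < j := by
        rintro f g ⟨hf, hg, hne, v, hvf, hvg, hl⟩ i j rfl rfl
        rcases lt_trichotomy i j with h | rfl | h
        · exact h
        · exact absurd rfl hne
        · exact (not_leftFrom_both hf hg (leftOf_iff.1 hl) (hleft j i h v hvg hvf)).elim
      induction hfg with
      | single h => exact hone _ _ h
      | tail _ h ih =>
        intro i j hi hj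
        obtain ⟨l, hl⟩ := hτ.1 h.1
        exact (ih i l hi hl).trans (hone _ _ h l j hl hj)
    exact fun i j hij => key _ _ hij i j rfl rfl

end Labels

end NCHT
end

noncomputable section

namespace NCHT

/-! ### Counting hyperedges inside a set of vertices -/

section Counting

namespace NCHypertree

variable {n : ℕ} {p : ConvexPolygon (n + 1)} {τ : NCHypertree p} {β γ : BasicNCHypertree p}

theorem rank_top : (⊤ : NCPartition p).rank = n := by
  have h : (⊤ : NCPartition p).1.parts = {Finset.univ} := by
    refine Finset.Subset.antisymm (Finpartition.parts_top_subset _) ?_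
    rw [Finset.singleton_subset_iff]
    have h1 := NCPartition.part_mem (⊤ : NCPartition p) 0
    have h2 : (⊤ : NCPartition p).1.part 0 = Finset.univ :=
      Finset.mem_singleton.1 (Finpartition.parts_top_subset _ h1)
    rwa [h2] at h1
  simp [NCPartition.rank, h]

theorem sum_card_sub_one (τ : NCHypertree p) : ∑ e ∈ τ.edges, (e.card - 1) = n := by
  have h : τ.comp (subset_refl τ.edges) = ⊤ := NCPartition.ext_rel fun x y =>
    rel_comp.trans (iff_of_true (τ.conn x y) (NCPartition.rel_top x y))
  exact (rank_comp _).symm.trans ((congrArg NCPartition.rank h).trans rank_top)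

open Classical in
/-- The rank of the part of a hypertree inside a set of vertices. -/
def rankIn (τ : NCHypertree p) (X : Finset (Fin (n + 1))) : ℕ :=
  ∑ e ∈ τ.edges with e ⊆ X, (e.card - 1)

/-- Hyperedges inside `X` leave each vertex outside `X` alone in its block, and a nonempty `X`
contributes a further block. For empty `X` truncated subtraction gives `0`. -/
theorem rankIn_le (τ : NCHypertree p) (X : Finset (Fin (n + 1))) : τ.rankIn X ≤ X.card - 1 := by
  classical
  rcases X.eq_empty_or_nonempty with rfl | ⟨x₀, hx₀⟩
  · refine (Finset.sum_eq_zero fun e he => ?_).le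
    rw [Finset.mem_filter, Finset.subset_empty] at he
    simp [he.2]
  · have hD : τ.edges.filter (· ⊆ X) ⊆ τ.edges := Finset.filter_subset _ _
    have hin : ∀ x y, Conn (τ.edges.filter (· ⊆ X)) x y → x ≠ y → x ∈ X := by
      intro x y h hxy
      rcases Relation.ReflTransGen.cases_head h with h | ⟨z, ⟨e, he, hx, -⟩, -⟩
      · exact absurd h hxy
      · exact (Finset.mem_filter.1 he).2 hx
    rw [rankIn, ← rank_comp hD, NCPartition.rank]
    set π := τ.comp hD
    have h1 : (insert x₀ (Finset.univ \ X)).card ≤ π.1.parts.card := by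
      refine Finset.card_le_card_of_injOn π.1.part (fun x _ => π.part_mem x) ?_
      intro x hx y hy hxy
      have hxy' : Conn (τ.edges.filter (· ⊆ X)) x y := rel_comp.1 hxy
      by_contra hne
      have hx1 := hin x y hxy' hne
      have hy1 := hin y x hxy'.symm (Ne.symm hne)
      simp only [Finset.coe_insert, Finset.coe_sdiff, Set.mem_insert_iff, Set.mem_sdiff,
        Finset.mem_coe] at hx hy
      exact hne ((hx.resolve_right fun h => h.2 hx1).trans
        (hy.resolve_right fun h => h.2 hy1).symm)
    rw [Finset.card_insert_of_notMem (by simp [hx₀]), Finset.card_sdiff_of_subset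
      (Finset.subset_univ _), Finset.card_univ, Fintype.card_fin] at h1
    have h2 : X.card ≤ n + 1 := by simpa using Finset.card_le_univ X
    have h3 := Finset.card_pos.2 ⟨x₀, hx₀⟩
    omega

theorem _root_.NCHT.BasicNCHypertree.card_inter_lower_add (β : BasicNCHypertree p)
    (X : Finset (Fin (n + 1))) :
    (X ∩ β.lower).card + (X ∩ β.upper).card = X.card + if β.src ∈ X then 1 else 0 := by
  classical
  rw [← Finset.card_union_add_card_inter]
  have h1 : X ∩ β.lower ∪ X ∩ β.upper = X := by
    ext x
    have := β.mem_lower_or_mem_upper x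
    simp only [Finset.mem_union, Finset.mem_inter]
    tauto
  have h2 : X ∩ β.lower ∩ (X ∩ β.upper) = if β.src ∈ X then {β.src} else ∅ := by
    ext x
    have := @BasicNCHypertree.eq_src _ _ β x
    have h3 := β.src_mem_lower
    have h4 := β.src_mem_upper
    split_ifs with h
    · simp only [Finset.mem_inter, Finset.mem_singleton]
      constructor
      · tauto
      · rintro rfl; tauto
    · simp only [Finset.mem_inter, Finset.notMem_empty, iff_false]
      rintro ⟨⟨h5, h6⟩, -, h7⟩
      exact h (this h6 h7 ▸ h5)
  rw [h1, h2]
  split_ifs <;> simp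

/-- Inside the intersection of the lower sides of two cuts, a hypertree has the largest possible
rank. -/
theorem rankIn_inter (hβ : β ∈ τ.verts) (hγ : γ ∈ τ.verts) :
    τ.rankIn (β.lower ∩ γ.lower) = (β.lower ∩ γ.lower).card - 1 := by
  classical
  -- Each hyperedge lies in exactly one of the four intersections, so the ranks add up to `n`. The
  -- bounds of `rankIn_le` add up to at most `n`, so each is attained. If the sources differ, one
  -- intersection may be empty and contributes `0 - 1 = 0`; `q1` and `q2` ensure that three are
  -- nonempty.
  have hsum : τ.rankIn (β.lower ∩ γ.lower) + τ.rankIn (β.lower ∩ γ.upper) +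
      τ.rankIn (β.upper ∩ γ.lower) + τ.rankIn (β.upper ∩ γ.upper) = n := by
    refine Eq.trans ?_ τ.sum_card_sub_one
    simp only [rankIn, Finset.sum_filter, ← Finset.sum_add_distrib]
    refine Finset.sum_congr rfl fun e he => ?_
    have b1 := @not_subset_both _ _ τ β e he
    have g1 := @not_subset_both _ _ τ γ e he
    simp only [Finset.subset_inter_iff]
    rcases subset_or hβ he with h1 | h1 <;> rcases subset_or hγ he with h2 | h2 <;>
      simp only [h1, h2, true_imp_iff] at b1 g1 <;> simp_all
  have r1 := τ.rankIn_le (β.lower ∩ γ.lower)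
  have r2 := τ.rankIn_le (β.lower ∩ γ.upper)
  have r3 := τ.rankIn_le (β.upper ∩ γ.lower)
  have r4 := τ.rankIn_le (β.upper ∩ γ.upper)
  have c1 := γ.card_inter_lower_add β.lower
  have c2 := γ.card_inter_lower_add β.upper
  have c3 := β.card_inter_lower_add Finset.univ
  simp only [Finset.univ_inter, Finset.mem_univ, if_true, Finset.card_univ, Fintype.card_fin] at c3
  have pos : ∀ {x : Fin (n + 1)} {A B : Finset (Fin (n + 1))}, x ∈ A → x ∈ B →
      0 < (A ∩ B).card := fun hA hB => Finset.card_pos.2 ⟨_, Finset.mem_inter.2 ⟨hA, hB⟩⟩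
  have m1 := β.src_mem_lower
  have m2 := β.src_mem_upper
  have m3 := γ.src_mem_lower
  have m4 := γ.src_mem_upper
  by_cases hsrc : γ.src = β.src
  · have q1 := pos m1 (hsrc ▸ m3)
    have q2 := pos m1 (hsrc ▸ m4)
    have q3 := pos m2 (hsrc ▸ m3)
    have q4 := pos m2 (hsrc ▸ m4)
    rw [hsrc, if_pos m1] at c1
    rw [hsrc, if_pos m2] at c2
    omega
  · have hone : (if γ.src ∈ β.lower then 1 else 0) + (if γ.src ∈ β.upper then 1 else 0) = 1 := by
      have h1 := β.mem_lower_or_mem_upper γ.src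
      have h2 := @BasicNCHypertree.eq_src _ _ β γ.src
      split_ifs <;> simp_all
    have q1 : (0 < (β.lower ∩ γ.lower).card ∧ 0 < (β.lower ∩ γ.upper).card) ∨
        (0 < (β.upper ∩ γ.lower).card ∧ 0 < (β.upper ∩ γ.upper).card) :=
      (β.mem_lower_or_mem_upper γ.src).imp (fun h => ⟨pos h m3, pos h m4⟩)
        fun h => ⟨pos h m3, pos h m4⟩
    have q2 : (0 < (β.lower ∩ γ.lower).card ∧ 0 < (β.upper ∩ γ.lower).card) ∨
        (0 < (β.lower ∩ γ.upper).card ∧ 0 < (β.upper ∩ γ.upper).card) :=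
      (γ.mem_lower_or_mem_upper β.src).imp (fun h => ⟨pos m1 h, pos m2 h⟩)
        fun h => ⟨pos m1 h, pos m2 h⟩
    omega

theorem rankIn_lower (hβ : β ∈ τ.verts) : τ.rankIn β.lower = β.lower.card - 1 := by
  have := rankIn_inter hβ hβ
  rwa [Finset.inter_self] at this

end NCHypertree

end Counting

/-! ### Cuts crossed by a noncrossing permutation -/

section PermCuts

variable {N : ℕ} {p : ConvexPolygon N} {τ : NCHypertree p}

/-- The cuts given by the steps of a noncrossing permutation. -/
def NCPartition.IsStep (π : NCPartition p) (β : BasicNCHypertree p) : Prop :=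
  π.perm β.tgt = β.src

namespace NCHypertree

variable {D : Finset (Finset (Fin N))}

theorem IsLower.mem_verts_of_isStep (hL : IsLower τ D) {β : BasicNCHypertree p}
    (h : (τ.comp hL.1).IsStep β) : β ∈ τ.verts := by
  rw [mem_verts]
  intro f hf
  have h1 := hL.subset_or hf (u := β.tgt) (by rw [h]; exact β.tgt_ne.symm)
  rwa [h] at h1

-- Only a cut at the common vertex `z` can separate the two hyperedges, and the permutation has one
-- step into `z`. At `z` the lower side of this cut holds exactly the hyperedges in `D`. This local
-- identity links steps with blocks.
open Classical in
theorem IsLower.sum_isStep_sub (hL : IsLower τ D) {e f : Finset (Fin N)} {z : Fin N}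
    (he : e ∈ τ.edges) (hf : f ∈ τ.edges) (hze : z ∈ e) (hzf : z ∈ f) :
    ∑ β : BasicNCHypertree p, (if (τ.comp hL.1).IsStep β then (1 : ℝ) else 0) *
      ((if e ⊆ β.lower then 1 else 0) - if f ⊆ β.lower then 1 else 0) =
      (if e ∈ D then 1 else 0) - if f ∈ D then 1 else 0 := by
  obtain ⟨u, hu⟩ := Finite.surjective_of_injective (τ.comp hL.1).perm_injective z
  have hother : ∀ β : BasicNCHypertree p, (τ.comp hL.1).IsStep β → β.tgt ≠ u →
      (e ⊆ β.lower ↔ f ⊆ β.lower) := by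
    intro β hβ ht
    have hs : z ≠ β.src := by
      rintro rfl
      exact ht ((τ.comp hL.1).perm_injective (hβ.trans hu.symm))
    rw [subset_lower_iff (hL.mem_verts_of_isStep hβ) he hze hs,
      subset_lower_iff (hL.mem_verts_of_isStep hβ) hf hzf hs]
  have hzero : ∀ β : BasicNCHypertree p, β.tgt ≠ u →
      (if (τ.comp hL.1).IsStep β then (1 : ℝ) else 0) *
      ((if e ⊆ β.lower then 1 else 0) - if f ⊆ β.lower then 1 else 0) = 0 := by
    intro β ht
    by_cases hβ : (τ.comp hL.1).IsStep β
    · simp [hother β hβ ht]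
    · simp [hβ]
  by_cases hx : ∃ x, cw u x z
  · have huz := ne_of_exists_cw hx
    have hstep : (τ.comp hL.1).IsStep (mkBasic p hx) := by
      rw [NCPartition.IsStep, src_mkBasic, tgt_mkBasic, hu]
    rw [Finset.sum_eq_single (mkBasic p hx)]
    · rw [if_pos hstep, one_mul, BasicNCHypertree.lower, src_mkBasic, tgt_mkBasic]
      simp only [hL.subset_arc_iff he hze hu huz, hL.subset_arc_iff hf hzf hu huz]
    · intro β _ hβ
      by_cases ht : β.tgt = u
      · have hns : ¬ (τ.comp hL.1).IsStep β := by
          intro hs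
          refine hβ (BasicNCHypertree.ext_src_tgt ?_ ?_)
          · rw [src_mkBasic, ← hu, ← ht]; exact hs.symm
          · rw [tgt_mkBasic, ht]
        simp [hns]
      · exact hzero β ht
    · exact fun h => absurd (Finset.mem_univ _) h
  · have hall : ∀ β : BasicNCHypertree p, (if (τ.comp hL.1).IsStep β then (1 : ℝ) else 0) *
        ((if e ⊆ β.lower then 1 else 0) - if f ⊆ β.lower then 1 else 0) = 0 := by
      intro β
      by_cases ht : β.tgt = u
      · have hns : ¬ (τ.comp hL.1).IsStep β := by
          intro hs
          have h1 : β.src = z := by rw [← hu, ← ht]; exact hs.symm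
          exact hx (h1 ▸ ht ▸ β.exists_cw)
        simp [hns]
      · exact hzero β ht
    rw [Finset.sum_eq_zero fun β _ => hall β]
    -- The step into `z` is no cut in two cases: `z` is fixed and no hyperedge at `z` is in `D`, or
    -- `u` is the vertex just before `z` and all of them are.
    have hiff : e ∈ D ↔ f ∈ D := by
      by_cases huz : u = z
      · have h0 := ((τ.comp hL.1).perm_spec u).2.2 (hu.trans huz.symm)
        have hno : ∀ g, z ∈ g → g ∈ D → False := by
          intro g hzg hg
          obtain ⟨a, ha, haz⟩ := exists_ne_of_two_le (τ.two_le (hL.1 hg)) z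
          exact haz ((h0 a (rel_comp.2 (Conn.single hg (huz ▸ hzg) ha))).trans huz)
        exact iff_of_false (hno e hze) (hno f hzf)
      · have hall : ∀ g ∈ τ.edges, z ∈ g → g ∈ D := by
          intro g hg hzg
          rw [← hL.subset_arc_iff hg hzg hu huz]
          intro x _
          rw [mem_arc]
          push Not at hx
          have := hx x
          simp only [cw] at *
          omega
        exact iff_of_true (hall e he hze) (hall f hf hzf)
    simp [hiff]

/-- A quantity that agrees on hyperedges with a common vertex is constant. -/
theorem eq_of_forall_inter {α : Type} (φ : Finset (Fin N) → α)
    (h : ∀ e ∈ τ.edges, ∀ f ∈ τ.edges, ∀ z, z ∈ e → z ∈ f → φ e = φ f) {e f : Finset (Fin N)}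
    (he : e ∈ τ.edges) (hf : f ∈ τ.edges) : φ e = φ f := by
  obtain ⟨a, ha, -⟩ := Finset.one_lt_card.1 (τ.two_le he)
  obtain ⟨b, hb, -⟩ := Finset.one_lt_card.1 (τ.two_le hf)
  have key : ∀ c, Conn τ.edges a c → ∀ g ∈ τ.edges, c ∈ g → φ e = φ g := by
    intro c hc
    induction hc with
    | refl => exact fun g hg hag => h e he g hg a ha hag
    | tail _ hcd ih =>
      obtain ⟨k, hk, hck, hdk⟩ := hcd
      exact fun g hg hdg => (ih k hk hck).trans (h k hk g hg _ hdk hdg)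
  exact key b (τ.conn a b) f hf hb

end NCHypertree

end PermCuts

end NCHT
end

noncomputable section

namespace NCHT

/-! ### The potential of a point of the hypertree complex -/

section Potential

variable {n : ℕ} {p : ConvexPolygon (n + 1)} {τ : NCHypertree p} {β γ : BasicNCHypertree p}

namespace BasicNCHypertree

/-- The rank of the lower hyperedge. -/
def wt (β : BasicNCHypertree p) : ℝ := (β.lower.card - 1 : ℕ)

theorem wt_pos_lt (β : BasicNCHypertree p) : 0 < β.wt ∧ β.wt < n := by
  have h1 : 2 ≤ β.lower.card := β.1.two_le β.lower_mem
  have h2 : 2 ≤ β.upper.card := β.1.two_le β.upper_mem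
  have h3 := β.card_inter_lower_add Finset.univ
  simp only [Finset.univ_inter, Finset.mem_univ, if_true, Finset.card_univ, Fintype.card_fin] at h3
  rw [wt, Nat.cast_lt, Nat.cast_pos]
  omega

/-- The norm of the direction of a vertex of the link, before normalization. -/
def nrm (β : BasicNCHypertree p) : ℝ := √(β.wt * (n - β.wt) / n)

theorem nrm_sq_pos (β : BasicNCHypertree p) : 0 < β.wt * (n - β.wt) / n :=
  div_pos (mul_pos β.wt_pos_lt.1 (sub_pos.2 β.wt_pos_lt.2)) (β.wt_pos_lt.1.trans β.wt_pos_lt.2)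

theorem nrm_pos (β : BasicNCHypertree p) : 0 < β.nrm := Real.sqrt_pos.2 β.nrm_sq_pos

theorem nrm_mul_self (β : BasicNCHypertree p) : β.nrm * β.nrm = β.wt * (n - β.wt) / n :=
  Real.mul_self_sqrt β.nrm_sq_pos.le

open Classical in
/-- The indicator of the hyperedges on the lower side of a cut, shifted to have mean zero. -/
def level (β : BasicNCHypertree p) (e : Finset (Fin (n + 1))) : ℝ :=
  (if e ⊆ β.lower then 1 else 0) - β.wt / n

end BasicNCHypertree

open BasicNCHypertree

namespace NCHypertree

/-- The lower side carries total rank `β.wt`, by `rankIn_lower`, and the shift `β.wt / n` spreads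
this evenly over the total rank `n`. -/
theorem sum_rank_mul_level (hβ : β ∈ τ.verts) :
    ∑ e ∈ τ.edges, ((e.card - 1 : ℕ) : ℝ) * β.level e = 0 := by
  classical
  have hn : (n : ℝ) ≠ 0 := (β.wt_pos_lt.1.trans β.wt_pos_lt.2).ne'
  have h1 : ∑ e ∈ τ.edges, ((e.card - 1 : ℕ) : ℝ) = n := by
    rw [← Nat.cast_sum, τ.sum_card_sub_one]
  have h2 : ∑ e ∈ τ.edges, ((e.card - 1 : ℕ) : ℝ) * (if e ⊆ β.lower then 1 else 0) = β.wt := by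
    rw [wt, ← rankIn_lower hβ, rankIn, Nat.cast_sum, Finset.sum_filter]
    exact Finset.sum_congr rfl fun e _ => by split_ifs <;> simp
  simp only [level, mul_sub, Finset.sum_sub_distrib, h2, ← Finset.sum_mul, h1]
  field_simp
  ring

/-- The right side does not involve `τ`: two cuts have the same inner product in every simplex that
contains both, so the shapes agree on common faces. -/
theorem sum_rank_mul_level_mul_level (hβ : β ∈ τ.verts) (hγ : γ ∈ τ.verts) :
    ∑ e ∈ τ.edges, ((e.card - 1 : ℕ) : ℝ) * (β.level e * γ.level e) =
      ((β.lower ∩ γ.lower).card - 1 : ℕ) - β.wt * γ.wt / n := by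
  classical
  have h3 : ∑ e ∈ τ.edges, ((e.card - 1 : ℕ) : ℝ) * (if e ⊆ β.lower then 1 else 0) = β.wt := by
    rw [wt, ← rankIn_lower hβ, rankIn, Nat.cast_sum, Finset.sum_filter]
    exact Finset.sum_congr rfl fun e _ => by split_ifs <;> simp
  have h4 : ∑ e ∈ τ.edges, ((e.card - 1 : ℕ) : ℝ) *
      ((if e ⊆ β.lower then 1 else 0) * if e ⊆ γ.lower then 1 else 0) =
      ((β.lower ∩ γ.lower).card - 1 : ℕ) := by
    rw [← rankIn_inter hβ hγ, rankIn, Nat.cast_sum, Finset.sum_filter]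
    exact Finset.sum_congr rfl fun e _ => by
      simp only [Finset.subset_inter_iff]; by_cases h1 : e ⊆ β.lower <;> by_cases h2 : e ⊆ γ.lower <;>
        simp [h1, h2]
  have h5 : ∀ e, ((e.card - 1 : ℕ) : ℝ) * (β.level e * γ.level e) =
      ((e.card - 1 : ℕ) : ℝ) * ((if e ⊆ β.lower then 1 else 0) * if e ⊆ γ.lower then 1 else 0) -
      (((e.card - 1 : ℕ) : ℝ) * (if e ⊆ β.lower then 1 else 0)) * (γ.wt / n) -
      β.wt / n * (((e.card - 1 : ℕ) : ℝ) * γ.level e) := by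
    intro e; simp only [level]; ring
  simp only [h5, Finset.sum_sub_distrib, ← Finset.sum_mul, ← Finset.mul_sum, h3, h4,
    sum_rank_mul_level hγ]
  ring

end NCHypertree

/-- The potential of a combination of cuts. -/
def potential (y : BasicNCHypertree p → ℝ) (e : Finset (Fin (n + 1))) : ℝ := ∑ β, y β * β.level e

theorem potential_sub (y z : BasicNCHypertree p → ℝ) (e : Finset (Fin (n + 1))) :
    potential (y - z) e = potential y e - potential z e := by
  simp [potential, sub_mul]

theorem potential_smul (c : ℝ) (y : BasicNCHypertree p → ℝ) (e : Finset (Fin (n + 1))) :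
    potential (c • y) e = c * potential y e := by
  simp [potential, mul_assoc, Finset.mul_sum]

namespace NCHypertree

theorem sum_rank_mul_potential {y : BasicNCHypertree p → ℝ} (hy : ∀ β, β ∉ τ.verts → y β = 0) :
    ∑ e ∈ τ.edges, ((e.card - 1 : ℕ) : ℝ) * potential y e = 0 := by
  simp only [potential, Finset.mul_sum]
  rw [Finset.sum_comm]
  refine Finset.sum_eq_zero fun β _ => ?_
  by_cases hβ : β ∈ τ.verts
  · simp only [mul_left_comm _ (y β), ← Finset.mul_sum, sum_rank_mul_level hβ, mul_zero]
  · simp [hy β hβ]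

/-- A combination of the cuts of a hypertree is determined by its potential. -/
theorem eq_zero_of_potential {y : BasicNCHypertree p → ℝ} (hy : ∀ β, β ∉ τ.verts → y β = 0)
    (h : ∀ e ∈ τ.edges, potential y e = 0) : y = 0 := by
  funext β
  by_cases hβ : β ∈ τ.verts
  · obtain ⟨e, he, f, hf, -, -, h1, h2, h3⟩ := exists_corner hβ
    have h4 : potential y e - potential y f = 0 := by rw [h e he, h f hf, sub_zero]
    rw [potential, potential, ← Finset.sum_sub_distrib, Finset.sum_eq_single β] at h4
    · have h5 : ¬ f ⊆ β.lower := fun h => not_subset_both hf h h2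
      simp only [level, h1, h5, if_true, if_false] at h4
      rw [Pi.zero_apply]
      linear_combination h4
    · intro γ _ hγβ
      by_cases hγ : γ ∈ τ.verts
      · simp [level, h3 γ hγ hγβ]
      · simp [hy γ hγ]
    · exact fun h => absurd (Finset.mem_univ _) h
  · exact hy β hβ

theorem eq_of_potential {y z : BasicNCHypertree p → ℝ} (hy : ∀ β, β ∉ τ.verts → y β = 0)
    (hz : ∀ β, β ∉ τ.verts → z β = 0) (h : ∀ e ∈ τ.edges, potential y e = potential z e) :
    y = z :=
  sub_eq_zero.1 (τ.eq_zero_of_potential (fun β hβ => by simp [hy β hβ, hz β hβ]) fun e he => by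
    rw [potential_sub, h e he, sub_self])

/-! ### Euclidean coordinates of a tree simplex. -/

open Classical in
/-- The vector with given coordinates at the hyperedges of a hypertree, scaled by the ranks. -/
def edgeVec (τ : NCHypertree p) (φ : Finset (Fin (n + 1)) → ℝ) :
    EuclideanSpace ℝ (Finset (Fin (n + 1))) :=
  WithLp.toLp 2 fun e => if e ∈ τ.edges then √((e.card - 1 : ℕ) : ℝ) * φ e else 0

theorem inner_edgeVec (φ ψ : Finset (Fin (n + 1)) → ℝ) :
    inner ℝ (τ.edgeVec φ) (τ.edgeVec ψ) =
      ∑ e ∈ τ.edges, ((e.card - 1 : ℕ) : ℝ) * (φ e * ψ e) := by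
  classical
  rw [PiLp.inner_apply]
  rw [← Finset.sum_subset (Finset.subset_univ τ.edges) (fun e _ he => by simp [edgeVec, he])]
  refine Finset.sum_congr rfl fun e he => ?_
  have h := Real.mul_self_sqrt (Nat.cast_nonneg (α := ℝ) (e.card - 1))
  simp only [edgeVec, he, if_true, RCLike.inner_apply, conj_trivial]
  linear_combination (φ e * ψ e) * h

end NCHypertree

/-- Dividing by the norms of the vertex directions. -/
def unscale (x : BasicNCHypertree p → ℝ) : BasicNCHypertree p → ℝ := fun β => x β / β.nrm

namespace NCHypertree

/-- The position of a point of the simplex labelled by a hypertree. -/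
def pointVec (τ : NCHypertree p) (x : BasicNCHypertree p → ℝ) :
    EuclideanSpace ℝ (Finset (Fin (n + 1))) :=
  τ.edgeVec (potential (unscale x))

theorem unscale_eq_zero {x : BasicNCHypertree p → ℝ} (hx : ∀ β, β ∉ τ.verts → x β = 0)
    (β : BasicNCHypertree p) (hβ : β ∉ τ.verts) : unscale x β = 0 := by
  rw [unscale, hx β hβ, zero_div]

end NCHypertree

/-- The cosine of the distance of two vertices. -/
def cosVert (β γ : BasicNCHypertree p) : ℝ :=
  (((β.lower ∩ γ.lower).card - 1 : ℕ) - β.wt * γ.wt / n) / (β.nrm * γ.nrm)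

namespace NCHypertree

theorem inner_pointVec {x y : BasicNCHypertree p → ℝ} (hx : ∀ β, β ∉ τ.verts → x β = 0)
    (hy : ∀ β, β ∉ τ.verts → y β = 0) :
    inner ℝ (τ.pointVec x) (τ.pointVec y) = ∑ β, ∑ γ, x β * y γ * cosVert β γ := by
  rw [pointVec, pointVec, inner_edgeVec]
  simp only [potential, Finset.sum_mul_sum]
  simp only [Finset.mul_sum]
  rw [Finset.sum_comm]
  refine Finset.sum_congr rfl fun β _ => ?_
  rw [Finset.sum_comm]
  refine Finset.sum_congr rfl fun γ _ => ?_
  by_cases hβ : β ∈ τ.verts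
  · by_cases hγ : γ ∈ τ.verts
    · have h1 : ∀ e : Finset (Fin (n + 1)), ((e.card - 1 : ℕ) : ℝ) *
          (unscale x β * β.level e * (unscale y γ * γ.level e)) =
          unscale x β * unscale y γ * (((e.card - 1 : ℕ) : ℝ) * (β.level e * γ.level e)) := by
        intro e; ring
      simp only [h1, ← Finset.mul_sum, sum_rank_mul_level_mul_level hβ hγ]
      rw [unscale, unscale, cosVert]
      ring
    · simp [unscale, hy γ hγ]
  · simp [unscale, hx β hβ]

/-- Ranks of hyperedges are positive, so the vector determines the potential. Hence the vertex
directions of a simplex are linearly independent, which is the positivity of the Gram matrix. -/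
theorem eq_zero_of_pointVec {x : BasicNCHypertree p → ℝ} (hx : ∀ β, β ∉ τ.verts → x β = 0)
    (h : τ.pointVec x = 0) : x = 0 := by
  have h1 : unscale x = 0 := by
    refine τ.eq_zero_of_potential (unscale_eq_zero hx) fun e he => ?_
    have h2 := congrArg (fun v : EuclideanSpace ℝ (Finset (Fin (n + 1))) => v e) h
    have h3 : (0 : ℝ) < ((e.card - 1 : ℕ) : ℝ) := by
      have := τ.two_le he
      rw [Nat.cast_pos]; omega
    simpa [pointVec, edgeVec, he, (Real.sqrt_pos.2 h3).ne'] using h2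
  funext β
  have h2 := congrFun h1 β
  simpa [unscale, β.nrm_pos.ne'] using h2

end NCHypertree

variable (p) in
/-- The piecewise spherical structure of the hypertree complex. -/
def sphericalStructure : PiecewiseSpherical (hypertreeComplex p) where
  cosLength := cosVert
  symm β γ := by rw [cosVert, cosVert, Finset.inter_comm, mul_comm β.wt, mul_comm β.nrm]
  diag β := by
    rw [cosVert, Finset.inter_self, nrm_mul_self]
    have h := β.nrm_sq_pos.ne'
    have hn : (n : ℝ) ≠ 0 := (β.wt_pos_lt.1.trans β.wt_pos_lt.2).ne'
    rw [div_eq_one_iff_eq h]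
    change β.wt - _ = _
    field_simp
  posDef := by
    rintro s ⟨-, τ, hs⟩ t ht hts
    have h : ∀ β, β ∉ τ.verts → t β = 0 := fun β hβ => hts β fun hβs => hβ (hs hβs)
    rw [← τ.inner_pointVec h h, real_inner_self_eq_norm_sq]
    have h1 : τ.pointVec t ≠ 0 := fun h0 => ht (τ.eq_zero_of_pointVec h h0)
    positivity

namespace NCHypertree

theorem angle_eq {x y : BasicNCHypertree p → ℝ} (hx : ∀ β, β ∉ τ.verts → x β = 0)
    (hy : ∀ β, β ∉ τ.verts → y β = 0) :
    (sphericalStructure p).angle x y =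
      InnerProductGeometry.angle (τ.pointVec x) (τ.pointVec y) := by
  have key : ∀ {x y : BasicNCHypertree p → ℝ}, (∀ β, β ∉ τ.verts → x β = 0) →
      (∀ β, β ∉ τ.verts → y β = 0) →
      (sphericalStructure p).form x y = inner ℝ (τ.pointVec x) (τ.pointVec y) :=
    fun hx hy => (inner_pointVec hx hy).symm
  rw [PiecewiseSpherical.angle, InnerProductGeometry.angle, key hx hy, key hx hx, key hy hy,
    ← norm_eq_sqrt_real_inner, ← norm_eq_sqrt_real_inner]

end NCHypertree

end Potential

end NCHT
end

noncomputable section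

namespace NCHT

/-! ### Vectors perpendicular to the long diagonal -/

section LinkVectors

variable {n : ℕ} {p : ConvexPolygon (n + 1)} {τ : NCHypertree p}
  {d d' : NCPartition p → ℝ}

namespace NCPartition

/-- All elements of `e` are in one block. -/
def Under (π : NCPartition p) (e : Finset (Fin (n + 1))) : Prop := ∀ x ∈ e, ∀ y ∈ e, π.Rel x y

theorem not_isStep_bot (β : BasicNCHypertree p) : ¬ (⊥ : NCPartition p).IsStep β := by
  rw [IsStep, perm_bot]
  exact β.tgt_ne

theorem not_isStep_top (β : BasicNCHypertree p) : ¬ (⊤ : NCPartition p).IsStep β := by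
  intro h
  obtain ⟨x, hx⟩ := β.exists_cw
  have h1 := ((⊤ : NCPartition p).perm_spec β.tgt).2.1 x (rel_top _ _)
  rw [h] at h1
  exact h1 hx

theorem rank_le (π : NCPartition p) : π.rank ≤ n := by
  have : 0 < π.1.parts.card := Finset.card_pos.2 ⟨_, π.part_mem 0⟩
  rw [rank]
  omega

theorem bot_ne_top (hn : n ≠ 0) : (⊥ : NCPartition p) ≠ ⊤ := by
  intro h
  have := NCHypertree.rank_top (p := p)
  rw [← h, rank_bot] at this
  exact hn this.symm

end NCPartition

open NCPartition

/-! ### Block weights and step weights. -/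

open Classical in
/-- The weight of the partitions in which `e` is contained in a block. -/
def blockWt (d : NCPartition p → ℝ) (e : Finset (Fin (n + 1))) : ℝ :=
  ∑ π, d π * if π.Under e then 1 else 0

open Classical in
/-- The weight of the partitions with a given step. -/
def stepWt (d : NCPartition p → ℝ) (β : BasicNCHypertree p) : ℝ :=
  ∑ π, d π * if π.IsStep β then 1 else 0

theorem stepWt_smul (c : ℝ) (d : NCPartition p → ℝ) : stepWt (c • d) = c • stepWt d := by
  funext β
  simp [stepWt, Finset.mul_sum]

/-- Up to scaling, the points of the noncrossing partition link. -/
structure IsLinkVec (d : NCPartition p → ℝ) : Prop where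
  nonneg : ∀ π, π ≠ ⊥ → π ≠ ⊤ → 0 ≤ d π
  sum_eq : ∑ π, d π = 0
  chain : IsChain (· ≤ ·) {π | d π ≠ 0}
  perp : ∑ π, d π * π.rank = 0

theorem IsLinkVec.smul (hd : IsLinkVec d) {c : ℝ} (hc : 0 < c) : IsLinkVec (c • d) where
  nonneg π h1 h2 := mul_nonneg hc.le (hd.nonneg π h1 h2)
  sum_eq := by simp [← Finset.mul_sum, hd.sum_eq]
  chain := hd.chain.mono fun π (hπ : c * d π ≠ 0) => right_ne_zero_of_mul hπ
  perp := by simp [mul_assoc, ← Finset.mul_sum, hd.perp]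

theorem IsLinkVec.stepWt_nonneg (hd : IsLinkVec d) (β : BasicNCHypertree p) : 0 ≤ stepWt d β := by
  classical
  refine Finset.sum_nonneg fun π _ => ?_
  by_cases h : π.IsStep β
  · rw [if_pos h, mul_one]
    refine hd.nonneg π ?_ ?_
    · rintro rfl; exact not_isStep_bot β h
    · rintro rfl; exact not_isStep_top β h
  · rw [if_neg h, mul_zero]

namespace NCHypertree

theorem under_comp {D : Finset (Finset (Fin (n + 1)))} (hD : D ⊆ τ.edges)
    {e : Finset (Fin (n + 1))} (he : e ∈ τ.edges) : (τ.comp hD).Under e ↔ e ∈ D := by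
  constructor
  · intro h
    by_contra heD
    obtain ⟨a, ha, b, hb, hab⟩ := Finset.one_lt_card.1 (τ.two_le he)
    exact hab (eq_of_conn_of_notMem hD he heD ha hb (rel_comp.1 (h a ha b hb)))
  · exact fun h x hx y hy => rel_comp.2 (Conn.single h hx hy)

variable {k : ℕ} {e : Fin k → Finset (Fin (n + 1))}

theorem IsProperOrdering.under_chain_iff (h : τ.IsProperOrdering e) {i : Fin (k + 1)}
    {f : Finset (Fin (n + 1))} (hf : f ∈ τ.edges) : (h.chain i).Under f ↔ f ∈ initial e i :=
  under_comp (h.isLower i).1 hf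

theorem IsProperOrdering.chain_injective (h : τ.IsProperOrdering e) :
    Function.Injective h.chain :=
  h.isLabelledChain.1.injective

theorem IsProperOrdering.sum_chain (h : τ.IsProperOrdering e)
    (hd : ∀ π, π ∉ Set.range h.chain → d π = 0) (F : NCPartition p → ℝ) :
    ∑ π, d π * F π = ∑ i, d (h.chain i) * F (h.chain i) := by
  classical
  rw [← Finset.sum_subset (Finset.subset_univ (Finset.univ.image h.chain)),
    Finset.sum_image fun i _ j _ hij => h.chain_injective hij]
  intro π _ hπ
  rw [hd π, zero_mul]
  rintro ⟨i, rfl⟩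
  exact hπ (Finset.mem_image_of_mem _ (Finset.mem_univ _))

theorem IsProperOrdering.stepWt_eq_zero (h : τ.IsProperOrdering e)
    (hd : ∀ π, π ∉ Set.range h.chain → d π = 0) (β : BasicNCHypertree p) (hβ : β ∉ τ.verts) :
    stepWt d β = 0 := by
  classical
  rw [stepWt, h.sum_chain hd]
  refine Finset.sum_eq_zero fun i _ => ?_
  have h1 : ¬ (h.chain i).IsStep β := fun hs => hβ ((h.isLower i).mem_verts_of_isStep hs)
  rw [if_neg h1, mul_zero]

theorem IsProperOrdering.rank_chain (h : τ.IsProperOrdering e) (i : Fin (k + 1)) :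
    ((h.chain i).rank : ℝ) =
      ∑ f ∈ τ.edges, ((f.card - 1 : ℕ) : ℝ) * if f ∈ initial e i then 1 else 0 := by
  rw [IsProperOrdering.chain, rank_comp, Nat.cast_sum]
  simp only [mul_ite, mul_one, mul_zero]
  rw [← Finset.sum_filter, Finset.filter_mem_eq_inter,
    Finset.inter_eq_right.2 (h.isLower i).1]

theorem IsProperOrdering.blockWt_eq (h : τ.IsProperOrdering e)
    (hd : ∀ π, π ∉ Set.range h.chain → d π = 0) {f : Finset (Fin (n + 1))} (hf : f ∈ τ.edges) :
    blockWt d f = ∑ i, d (h.chain i) * if f ∈ initial e i then 1 else 0 := by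
  classical
  rw [blockWt, h.sum_chain hd]
  simp only [h.under_chain_iff hf]

theorem IsProperOrdering.sum_rank_mul_blockWt (h : τ.IsProperOrdering e)
    (hd : ∀ π, π ∉ Set.range h.chain → d π = 0) :
    ∑ f ∈ τ.edges, ((f.card - 1 : ℕ) : ℝ) * blockWt d f = ∑ π, d π * π.rank := by
  rw [h.sum_chain hd, Finset.sum_congr rfl fun f hf => by rw [h.blockWt_eq hd hf]]
  simp only [h.rank_chain, Finset.mul_sum]
  rw [Finset.sum_comm]
  exact Finset.sum_congr rfl fun i _ => Finset.sum_congr rfl fun f _ => by ring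

/-- The potential of the steps recovers the block weights. -/
theorem IsProperOrdering.potential_stepWt (h : τ.IsProperOrdering e)
    (hd : ∀ π, π ∉ Set.range h.chain → d π = 0) (hp : ∑ π, d π * (π.rank : ℝ) = 0)
    {f : Finset (Fin (n + 1))} (hf : f ∈ τ.edges) : potential (stepWt d) f = blockWt d f := by
  classical
  -- By `sum_isStep_sub` the difference of the two functions agrees on adjacent hyperedges and so is
  -- constant. Both have rank-weighted sum zero, the block weights because of perpendicularity, so
  -- the constant is zero.
  have hconst : ∀ f ∈ τ.edges, ∀ g ∈ τ.edges, ∀ z, z ∈ f → z ∈ g →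
      potential (stepWt d) f - blockWt d f = potential (stepWt d) g - blockWt d g := by
    intro f hf g hg z hzf hzg
    have h1 : potential (stepWt d) f - potential (stepWt d) g = blockWt d f - blockWt d g := by
      rw [h.blockWt_eq hd hf, h.blockWt_eq hd hg, potential, potential, ← Finset.sum_sub_distrib,
        ← Finset.sum_sub_distrib]
      simp only [stepWt, h.sum_chain hd, Finset.sum_mul, ← Finset.sum_sub_distrib]
      rw [Finset.sum_comm]
      refine Finset.sum_congr rfl fun i _ => ?_
      rw [← mul_sub, ← (h.isLower i).sum_isStep_sub hf hg hzf hzg, Finset.mul_sum]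
      refine Finset.sum_congr rfl fun β _ => ?_
      simp only [BasicNCHypertree.level]
      rw [← mul_sub, sub_sub_sub_cancel_right, mul_assoc]
      rfl
    linarith
  have h1 := fun g (hg : g ∈ τ.edges) =>
    eq_of_forall_inter (τ := τ) (fun f => potential (stepWt d) f - blockWt d f) hconst hg hf
  have h2 := τ.sum_rank_mul_potential (h.stepWt_eq_zero hd)
  have h3 := h.sum_rank_mul_blockWt hd
  rw [hp] at h3
  have h4 : ∑ g ∈ τ.edges, ((g.card - 1 : ℕ) : ℝ) *
      (potential (stepWt d) g - blockWt d g) = 0 := by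
    simp only [mul_sub, Finset.sum_sub_distrib, h2, h3, sub_zero]
  rw [Finset.sum_congr rfl fun g hg => by rw [h1 g hg], ← Finset.sum_mul] at h4
  have h5 : (0 : ℝ) < ∑ g ∈ τ.edges, ((g.card - 1 : ℕ) : ℝ) := by
    refine Finset.sum_pos (fun g hg => ?_) ⟨f, hf⟩
    have := τ.two_le hg
    rw [Nat.cast_pos]; omega
  exact sub_eq_zero.1 ((mul_eq_zero.1 h4).resolve_left h5.ne')

end NCHypertree

/-! ### A vector is determined by its steps -/

namespace NCHypertree

variable {k : ℕ} {e : Fin k → Finset (Fin (n + 1))}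

theorem IsProperOrdering.blockWt_anti (h : τ.IsProperOrdering e)
    (hd : ∀ π, π ∉ Set.range h.chain → d π = 0) (hv : IsLinkVec d) {i j : Fin k} (hij : i ≤ j) :
    blockWt d (e j) ≤ blockWt d (e i) := by
  classical
  rw [h.blockWt_eq hd (h.mem i), h.blockWt_eq hd (h.mem j)]
  refine Finset.sum_le_sum fun l _ => ?_
  simp only [h.mem_initial_iff]
  rw [Fin.le_def] at hij
  by_cases h1 : (j : ℕ) < l
  · rw [if_pos h1, if_pos (by omega)]
  by_cases h2 : (i : ℕ) < l
  · rw [if_neg h1, if_pos h2, mul_zero, mul_one]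
    refine hv.nonneg _ ?_ ?_
    · rw [← h.isLabelledChain.2.1]
      intro h3
      have := h.chain_injective h3
      simp [this] at h2
    · rw [← h.isLabelledChain.2.2.1]
      intro h3
      have := h.chain_injective h3
      simp only [this, Fin.val_last] at h1
      omega
  · rw [if_neg h1, if_neg h2]

/-- If `x` and `y` get connected by the hyperedge `f`, then every cut above `x` and `y` is above
`f`. -/
theorem subset_lower_of_conn {D : Finset (Finset (Fin (n + 1)))} {f : Finset (Fin (n + 1))}
    (hD : insert f D ⊆ τ.edges) {x y : Fin (n + 1)} (h : Conn (insert f D) x y)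
    (hn : ¬ Conn D x y) {β : BasicNCHypertree p} (hβ : β ∈ τ.verts) (hx : x ∈ β.lower)
    (hy : y ∈ β.lower) : f ⊆ β.lower := by
  classical
  by_contra hf
  have hfu : f ⊆ β.upper := (subset_or hβ (hD (Finset.mem_insert_self _ _))).resolve_left hf
  -- Collapsing the upper side of `β` to `β.src` turns a path from `x` to `y` into one that uses
  -- only hyperedges on the lower side, hence not `f`.
  let ρ : Fin (n + 1) → Fin (n + 1) := fun z => if z ∈ β.lower then z else β.src
  have hup : ∀ z ∈ β.upper, ρ z = β.src := by
    intro z hz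
    by_cases hl : z ∈ β.lower
    · simp only [ρ, if_pos hl]; exact BasicNCHypertree.eq_src hl hz
    · simp only [ρ, if_neg hl]
  have key : ∀ z, Conn (insert f D) x z → Conn D x (ρ z) := by
    intro z hz
    induction hz with
    | refl => simp only [ρ, if_pos hx]; exact Relation.ReflTransGen.refl
    | @tail b c _ hbc ih =>
      obtain ⟨g, hg, hb, hc⟩ := hbc
      rcases subset_or hβ (hD hg) with hgl | hgu
      · have hgD : g ∈ D := (Finset.mem_insert.1 hg).resolve_left fun h => hf (h ▸ hgl)
        simp only [ρ, if_pos (hgl hb), if_pos (hgl hc)] at ih ⊢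
        exact ih.trans (Conn.single hgD hb hc)
      · rw [hup c (hgu hc), ← hup b (hgu hb)]
        exact ih
  have := key y h
  simp only [ρ, if_pos hy] at this
  exact hn this

end NCHypertree

open Classical in
/-- The weight of the partitions above a given one. -/
def upWt (d : NCPartition p → ℝ) (π : NCPartition p) : ℝ := ∑ ρ, d ρ * if π ≤ ρ then 1 else 0

theorem potential_mono {y : BasicNCHypertree p → ℝ} (hy : ∀ β, 0 ≤ y β)
    {e f : Finset (Fin (n + 1))} (h : ∀ β, y β ≠ 0 → e ⊆ β.lower → f ⊆ β.lower) :
    potential y e ≤ potential y f := by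
  classical
  refine Finset.sum_le_sum fun β _ => ?_
  by_cases h0 : y β = 0
  · simp [h0]
  refine mul_le_mul_of_nonneg_left (sub_le_sub_right ?_ _) (hy β)
  by_cases h1 : e ⊆ β.lower
  · rw [if_pos h1, if_pos (h β h0 h1)]
  · rw [if_neg h1]; split_ifs <;> norm_num

-- The right side depends on `d` only through `stepWt d`: the weight above `π` is the highest level
-- at which the pairs of vertices with large potential still connect each block of `π`. No hypertree
-- has to be named, so vectors from different simplices can be compared.
open NCHypertree in
theorem IsLinkVec.le_upWt_iff (hv : IsLinkVec d) {π : NCPartition p} (hπ : π ≠ ⊥) (t : ℝ) :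
    t ≤ upWt d π ↔ ∀ a b, π.Rel a b →
      Relation.ReflTransGen (fun x y => t ≤ potential (stepWt d) {x, y}) a b := by
  classical
  obtain ⟨τ, k, e, c, h, hc, hsub⟩ := exists_isLabelledChain hv.chain
  rw [h.eq_chain hc] at hsub
  have hd : ∀ π, π ∉ Set.range h.chain → d π = 0 := fun ρ hρ => by
    by_contra h0
    exact hρ (hsub h0)
  obtain ⟨h0, hlast, -⟩ := h.isLabelledChain.2
  have hmono := h.isLabelledChain.1
  -- the first element of the chain above `π`
  obtain ⟨i, hi1, hi2⟩ : ∃ i : Fin k, π ≤ h.chain i.succ ∧ ¬ π ≤ h.chain i.castSucc := by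
    by_contra! hcon
    have : ∀ j : Fin (k + 1), ¬ π ≤ h.chain j := by
      intro j
      induction j using Fin.induction with
      | zero => rw [h0]; exact fun hle => hπ (le_bot_iff.1 hle)
      | succ j ih => exact fun hle => ih (hcon j hle)
    exact this (Fin.last k) (hlast ▸ le_top)
  have hle : ∀ j : Fin (k + 1), π ≤ h.chain j ↔ (i : ℕ) < j := by
    intro j
    constructor
    · intro hj
      by_contra hij
      exact hi2 (hj.trans (hmono.monotone (by rw [Fin.le_def]; simpa using hij)))
    · exact fun hij => hi1.trans (hmono.monotone (by rw [Fin.le_def]; simpa using hij))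
  -- Along the chain, being above `π` and having `e i` inside a block start at the same element.
  have hup : upWt d π = blockWt d (e i) := by
    rw [upWt, h.sum_chain hd, h.blockWt_eq hd (h.mem i)]
    simp only [hle, h.mem_initial_iff]
  have hpot : ∀ j, potential (stepWt d) (e j) = blockWt d (e j) :=
    fun j => h.potential_stepWt hd hv.perp (h.mem j)
  rw [hup]
  constructor
  · intro ht a b hab
    have h1 : Conn (initial e (i.succ : Fin (k + 1))) a b := rel_comp.1 (le_iff.1 hi1 a b hab)
    clear hab
    induction h1 with
    | refl => exact Relation.ReflTransGen.refl
    | @tail x y _ hxy ih =>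
      refine ih.tail ?_
      obtain ⟨f, hf, hx, hy⟩ := hxy
      obtain ⟨j, hj, rfl⟩ := mem_initial.1 hf
      refine ht.trans ((h.blockWt_anti hd hv (j := i) (i := j) ?_).trans ?_)
      · rw [Fin.le_def]; rw [Fin.val_succ] at hj; omega
      · rw [← hpot j]
        refine potential_mono hv.stepWt_nonneg fun β _ hβ => ?_
        rw [Finset.insert_subset_iff, Finset.singleton_subset_iff]
        exact ⟨hβ hx, hβ hy⟩
  -- Some pair `x`, `y` on the path is still separated just before step `i` and gets joined at a
  -- step `j ≥ i`. Cuts of `τ` above this pair are above `e j`, so its potential is at most that of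
  -- `e j`.
  · intro hR
    rw [le_iff] at hi2
    push Not at hi2
    obtain ⟨a, b, hab, hn⟩ := hi2
    obtain ⟨x, y, -, hxy, hx, hy⟩ := exists_step (hR a b hab)
      (P := fun x => (h.chain i.castSucc).Rel a x) (Rel.refl _ _) hn
    have hn' : ¬ (h.chain i.castSucc).Rel x y := fun h' => hy (hx.trans h')
    obtain ⟨j, hj1, hj2⟩ : ∃ j : Fin k, (h.chain j.succ).Rel x y ∧
        ¬ (h.chain j.castSucc).Rel x y := by
      by_contra! hcon
      have : ∀ j : Fin (k + 1), ¬ (h.chain j).Rel x y := by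
        intro j
        induction j using Fin.induction with
        | zero =>
          rw [h0]
          exact fun h' => hn' (le_iff.1 bot_le x y h')
        | succ j ih => exact fun hle => ih (hcon j hle)
      exact this (Fin.last k) (hlast ▸ rel_top x y)
    have hij : i ≤ j := by
      by_contra hlt
      refine hn' (le_iff.1 (hmono.monotone ?_) x y hj1)
      rw [Fin.le_def]
      rw [Fin.le_def] at hlt
      simp only [Fin.val_succ, Fin.val_castSucc]
      omega
    refine hxy.trans (le_trans ?_ (h.blockWt_anti hd hv hij))
    rw [← hpot j]
    refine potential_mono hv.stepWt_nonneg fun β hβ hxyβ => ?_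
    rw [Finset.insert_subset_iff, Finset.singleton_subset_iff] at hxyβ
    have hβτ : β ∈ τ.verts := by
      by_contra hc
      exact hβ (h.stepWt_eq_zero hd β hc)
    have h1 := rel_comp.1 hj1
    have h2 : ¬ Conn _ x y := fun h' => hj2 (rel_comp.2 h')
    have h3 : initial e (j.succ : Fin (k + 1)) = insert (e j) (initial e (j.castSucc : Fin (k + 1))) :=
      initial_succ e j
    rw [h3] at h1
    exact subset_lower_of_conn (h3 ▸ (h.isLower _).1) h1 h2 hβτ hxyβ.1 hxyβ.2

/-- Möbius inversion: the equations are triangular from the top down. -/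
theorem eq_of_upWt_eq (h : ∀ π, upWt d π = upWt d' π) : d = d' := by
  classical
  funext π
  induction π using (wellFounded_gt (α := NCPartition p)).induction with
  | _ π ih =>
    have key : ∀ d : NCPartition p → ℝ, upWt d π = d π + ∑ ρ, d ρ * if π < ρ then 1 else 0 := by
      intro d
      have h1 : d π = ∑ ρ, d ρ * if ρ = π then 1 else 0 := by simp
      rw [upWt, h1, ← Finset.sum_add_distrib]
      refine Finset.sum_congr rfl fun ρ _ => ?_
      rw [← mul_add]
      congr 1
      by_cases h2 : ρ = π
      · simp [h2]
      · have : π ≤ ρ ↔ π < ρ := ⟨fun h => lt_of_le_of_ne h (Ne.symm h2), le_of_lt⟩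
        simp [h2, this]
    have h1 := h π
    rw [key, key] at h1
    have h2 : ∑ ρ, d ρ * (if π < ρ then 1 else 0) = ∑ ρ, d' ρ * if π < ρ then 1 else 0 := by
      refine Finset.sum_congr rfl fun ρ _ => ?_
      by_cases hlt : π < ρ
      · rw [ih ρ hlt]
      · simp [hlt]
    linarith

theorem IsLinkVec.eq_of_stepWt_eq (hd : IsLinkVec d) (hd' : IsLinkVec d')
    (h : stepWt d = stepWt d') : d = d' := by
  refine eq_of_upWt_eq fun π => ?_
  -- The level criterion excludes `⊥`, where the weight above is the total sum `0`.
  by_cases hπ : π = ⊥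
  · subst hπ
    simp [upWt, hd.sum_eq, hd'.sum_eq]
  · refine eq_of_forall_le_iff fun t => ?_
    rw [hd.le_upWt_iff hπ, hd'.le_upWt_iff hπ, h]

end LinkVectors

end NCHT
end

noncomputable section

namespace NCHT

/-! ### The noncrossing partition link in coordinates -/

section LinkCoordinates

variable {n : ℕ} {p : ConvexPolygon (n + 1)} {τ : NCHypertree p}
  {d d' : NCPartition p → ℝ}

open NCPartition

theorem inner_corner {r s : ℕ} (hr : r ≤ n) :
    inner ℝ (corner n r) (corner n s) = (min r s : ℕ) := by
  have h : ∀ i : Fin n, (corner n s) i * (corner n r) i = if (i : ℕ) < min r s then 1 else 0 := by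
    intro i
    simp only [corner, lt_min_iff]
    split_ifs <;> simp_all
  rw [PiLp.inner_apply]
  simp only [RCLike.inner_apply, conj_trivial, h]
  rw [Finset.sum_boole, Fin.card_filter_val_lt, min_eq_right (by omega)]

theorem inner_develop (d d' : NCPartition p → ℝ) :
    inner ℝ (develop n NCPartition.rank d) (develop n NCPartition.rank d') =
      ∑ π, d π * ∑ ρ, d' ρ * (min π.rank ρ.rank : ℕ) := by
  simp only [develop, sum_inner, inner_sum, real_inner_smul_left, real_inner_smul_right,
    inner_corner (rank_le _), Finset.mul_sum]
  rw [Finset.sum_comm]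
  exact Finset.sum_congr rfl fun π _ => Finset.sum_congr rfl fun ρ _ => by ring

theorem inner_develop_diagonal (d : NCPartition p → ℝ) :
    inner ℝ (develop n NCPartition.rank d)
      (corner n (⊤ : NCPartition p).rank - corner n (⊥ : NCPartition p).rank) =
      ∑ π, d π * π.rank := by
  rw [NCHypertree.rank_top, NCPartition.rank_bot, inner_sub_right]
  simp only [develop, sum_inner, real_inner_smul_left, inner_corner (rank_le _),
    ← Finset.sum_sub_distrib]
  refine Finset.sum_congr rfl fun π _ => ?_
  simp [min_eq_left (rank_le π)]

theorem midpoint_apply_of_ne {π : NCPartition p} (h1 : π ≠ ⊥) (h2 : π ≠ ⊤) :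
    midpoint (NCPartition p) π = 0 := by
  simp [midpoint, h1, h2]

/-- The midpoint has positive coordinates at `⊥` and `⊤`, so pointing into the complex restricts
only the signs at the other elements, besides the total sum and the support. -/
theorem mem_ncLink_iff (hn : n ≠ 0) {d : NCPartition p → ℝ} :
    d ∈ ncLink p ↔ IsLinkVec d ∧ ‖develop n NCPartition.rank d‖ = 1 := by
  classical
  have hbt := bot_ne_top (p := p) hn
  have hsum : ∑ π, midpoint (NCPartition p) π = 1 := by
    simp only [midpoint, Pi.add_apply, Pi.smul_apply, smul_eq_mul, Finset.sum_add_distrib,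
      ← Finset.mul_sum, Finset.sum_pi_single', Finset.mem_univ, if_true]
    norm_num
  have hbot : midpoint (NCPartition p) ⊥ = 1 / 2 := by simp [midpoint, hbt]
  have htop : midpoint (NCPartition p) ⊤ = 1 / 2 := by simp [midpoint, hbt.symm]
  rw [ncLink, link, Set.mem_ofPred_eq, inner_develop_diagonal]
  constructor
  · rintro ⟨⟨ε, hε, h0, h1, s, ⟨-, hs⟩, hs0⟩, h2, h3⟩
    refine ⟨⟨fun π hπ1 hπ2 => ?_, ?_, ?_, h2⟩, h3⟩
    · have := h0 π
      rw [Pi.add_apply, midpoint_apply_of_ne hπ1 hπ2, zero_add] at this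
      exact nonneg_of_mul_nonneg_right this hε
    · simp only [Pi.add_apply, Finset.sum_add_distrib, hsum, Pi.smul_apply, smul_eq_mul,
        ← Finset.mul_sum] at h1
      have : ε * ∑ π, d π = 0 := by linarith
      exact (mul_eq_zero.1 this).resolve_left hε.ne'
    · intro π hπ ρ hρ hne
      have key : ∀ π, d π ≠ 0 → π ≠ ⊥ → π ≠ ⊤ → π ∈ s := by
        intro π hπ h1 h2
        by_contra hc
        have := hs0 π hc
        rw [Pi.add_apply, midpoint_apply_of_ne h1 h2, zero_add] at this
        exact hπ ((mul_eq_zero.1 this).resolve_left hε.ne')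
      by_cases a1 : π = ⊥
      · exact Or.inl (a1 ▸ bot_le)
      by_cases a2 : π = ⊤
      · exact Or.inr (a2 ▸ le_top)
      by_cases b1 : ρ = ⊥
      · exact Or.inr (b1 ▸ bot_le)
      by_cases b2 : ρ = ⊤
      · exact Or.inl (b2 ▸ le_top)
      exact hs (key π hπ a1 a2) (key ρ hρ b1 b2) hne
  · rintro ⟨⟨h1, h2, h3, h4⟩, h5⟩
    refine ⟨?_, h4, h5⟩
    have hpos : 0 < 2 * (|d ⊥| + |d ⊤| + 1) := by positivity
    -- Small enough to keep the coordinates at `⊥` and `⊤`, which start at `1 / 2`, nonnegative.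
    refine ⟨(2 * (|d ⊥| + |d ⊤| + 1))⁻¹, inv_pos.2 hpos, fun π => ?_, ?_,
      insert ⊥ (insert ⊤ (Finset.univ.filter fun π => d π ≠ 0)), ⟨⟨⊥, by simp⟩, ?_⟩, ?_⟩
    · have key : ∀ x : ℝ, |x| ≤ |d ⊥| + |d ⊤| → 0 ≤ 1 / 2 + (2 * (|d ⊥| + |d ⊤| + 1))⁻¹ * x := by
        intro x hx
        have hx' := neg_abs_le x
        have : 1 / 2 + (2 * (|d ⊥| + |d ⊤| + 1))⁻¹ * x =
            (2 * (|d ⊥| + |d ⊤| + 1))⁻¹ * (|d ⊥| + |d ⊤| + 1 + x) := by field_simp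
        rw [this]
        exact mul_nonneg (inv_pos.2 hpos).le (by linarith)
      rw [Pi.add_apply, Pi.smul_apply, smul_eq_mul]
      by_cases a1 : π = ⊥
      · rw [a1, hbot]; exact key _ (le_add_of_nonneg_right (abs_nonneg _))
      by_cases a2 : π = ⊤
      · rw [a2, htop]; exact key _ (le_add_of_nonneg_left (abs_nonneg _))
      rw [midpoint_apply_of_ne a1 a2, zero_add]
      exact mul_nonneg (inv_pos.2 hpos).le (h1 π a1 a2)
    · simp only [Pi.add_apply, Finset.sum_add_distrib, hsum, Pi.smul_apply, smul_eq_mul,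
        ← Finset.mul_sum, h2, mul_zero, add_zero]
    · have : ((insert ⊥ (insert ⊤ (Finset.univ.filter fun π => d π ≠ 0)) :
          Finset (NCPartition p)) : Set (NCPartition p)) = insert ⊥ (insert ⊤ {π | d π ≠ 0}) := by
        simp
      rw [this]
      exact (h3.insert fun b _ _ => Or.inr le_top).insert fun b _ _ => Or.inl bot_le
    · intro π hπ
      simp only [Finset.mem_insert, Finset.mem_filter, Finset.mem_univ, true_and, not_or,
        not_not] at hπ
      rw [Pi.add_apply, midpoint_apply_of_ne hπ.1 hπ.2.1, zero_add, Pi.smul_apply, hπ.2.2,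
        smul_zero]

/-- For `n = 0` the ambient space has no unit vectors and the link is empty. -/
theorem ne_zero_of_mem_ncLink (hd : d ∈ ncLink p) : n ≠ 0 := by
  rintro rfl
  have h : ‖develop 0 NCPartition.rank d‖ = 1 := hd.2.2
  rw [Subsingleton.elim (develop 0 NCPartition.rank d) 0, norm_zero] at h
  exact zero_ne_one h

theorem isLinkVec_of_mem_ncLink (hd : d ∈ ncLink p) : IsLinkVec d :=
  ((mem_ncLink_iff (ne_zero_of_mem_ncLink hd)).1 hd).1

theorem norm_develop_of_mem_ncLink (hd : d ∈ ncLink p) : ‖develop n NCPartition.rank d‖ = 1 :=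
  hd.2.2

namespace NCHypertree

variable {k : ℕ} {e : Fin k → Finset (Fin (n + 1))}

/-- Initial segments are nested, so the smaller rank is the total rank of their intersection. -/
theorem IsProperOrdering.min_rank (h : τ.IsProperOrdering e) (i j : Fin (k + 1)) :
    ((min (h.chain i).rank (h.chain j).rank : ℕ) : ℝ) = ∑ f ∈ τ.edges, ((f.card - 1 : ℕ) : ℝ) *
      ((if f ∈ initial e i then 1 else 0) * if f ∈ initial e j then 1 else 0) := by
  have hle : ∀ {i j : Fin (k + 1)}, i ≤ j → initial e i ⊆ initial e j := by
    intro i j hij f hf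
    obtain ⟨l, hl, rfl⟩ := mem_initial.1 hf
    exact mem_initial.2 ⟨l, lt_of_lt_of_le hl hij, rfl⟩
  have hrk : ∀ {i j : Fin (k + 1)}, i ≤ j → (h.chain i).rank ≤ (h.chain j).rank := by
    intro i j hij
    rw [IsProperOrdering.chain, IsProperOrdering.chain, rank_comp, rank_comp]
    exact Finset.sum_le_sum_of_subset (hle hij)
  have main : ∀ {i j : Fin (k + 1)}, i ≤ j → ((h.chain i).rank : ℝ) =
      ∑ f ∈ τ.edges, ((f.card - 1 : ℕ) : ℝ) *
      ((if f ∈ initial e i then 1 else 0) * if f ∈ initial e j then 1 else 0) := by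
    intro i j hij
    rw [h.rank_chain]
    refine Finset.sum_congr rfl fun f _ => ?_
    by_cases hf : f ∈ initial e i
    · simp [hf, hle hij hf]
    · simp [hf]
  rcases le_total i j with hij | hij
  · rw [min_eq_left (hrk hij), main hij]
  · rw [min_eq_right (hrk hij), main hij]
    exact Finset.sum_congr rfl fun f _ => by ring

/-- On the simplex of a chain the inner product is read off from the block weights. -/
theorem IsProperOrdering.inner_develop_eq (h : τ.IsProperOrdering e)
    (hd : ∀ π, π ∉ Set.range h.chain → d π = 0) (hd' : ∀ π, π ∉ Set.range h.chain → d' π = 0) :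
    inner ℝ (develop n NCPartition.rank d) (develop n NCPartition.rank d') =
      inner ℝ (τ.edgeVec (blockWt d)) (τ.edgeVec (blockWt d')) := by
  rw [inner_develop, inner_edgeVec, h.sum_chain hd]
  simp only [h.sum_chain hd', h.min_rank, Finset.mul_sum]
  have h1 : ∀ f ∈ τ.edges, ((f.card - 1 : ℕ) : ℝ) * (blockWt d f * blockWt d' f) =
      ∑ i, ∑ j, d (h.chain i) * (d' (h.chain j) * (((f.card - 1 : ℕ) : ℝ) *
        ((if f ∈ initial e i then 1 else 0) * if f ∈ initial e j then 1 else 0))) := by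
    intro f hf
    rw [h.blockWt_eq hd hf, h.blockWt_eq hd' hf, Finset.sum_mul_sum, Finset.mul_sum]
    refine Finset.sum_congr rfl fun i _ => ?_
    rw [Finset.mul_sum]
    exact Finset.sum_congr rfl fun j _ => by ring
  refine Eq.trans ?_ (Finset.sum_congr rfl h1).symm
  conv_rhs => rw [Finset.sum_comm]
  exact Finset.sum_congr rfl fun i _ => Finset.sum_comm

theorem IsProperOrdering.norm_develop (h : τ.IsProperOrdering e)
    (hd : ∀ π, π ∉ Set.range h.chain → d π = 0) :
    ‖develop n NCPartition.rank d‖ = ‖τ.edgeVec (blockWt d)‖ := by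
  rw [norm_eq_sqrt_real_inner, h.inner_develop_eq hd hd, ← norm_eq_sqrt_real_inner]

theorem IsProperOrdering.angle_develop (h : τ.IsProperOrdering e)
    (hd : ∀ π, π ∉ Set.range h.chain → d π = 0) (hd' : ∀ π, π ∉ Set.range h.chain → d' π = 0) :
    InnerProductGeometry.angle (develop n NCPartition.rank d) (develop n NCPartition.rank d') =
      InnerProductGeometry.angle (τ.edgeVec (blockWt d)) (τ.edgeVec (blockWt d')) := by
  rw [InnerProductGeometry.angle, InnerProductGeometry.angle, h.inner_develop_eq hd hd',
    h.norm_develop hd, h.norm_develop hd']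

end NCHypertree

end LinkCoordinates

end NCHT
end

noncomputable section

namespace NCHT

/-! ### The map from the link to the hypertree complex -/

section LinkMap

variable {n : ℕ} {p : ConvexPolygon (n + 1)} {τ : NCHypertree p}
  {d d' : NCPartition p → ℝ}

open NCPartition

/-- The total weight of the steps, with the cuts scaled by their norms. -/
def stepSum (d : NCPartition p → ℝ) : ℝ := ∑ β : BasicNCHypertree p, β.nrm * stepWt d β

/-- The barycentric coordinates, in the hypertree complex, of a point of the link. -/
def toTree (d : NCPartition p → ℝ) (β : BasicNCHypertree p) : ℝ :=
  β.nrm * stepWt d β / stepSum d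

theorem exists_chain_of_isLinkVec (hd : IsLinkVec d) : ∃ (τ : NCHypertree p) (k : ℕ)
    (e : Fin k → Finset (Fin (n + 1))) (h : τ.IsProperOrdering e),
    ∀ π, π ∉ Set.range h.chain → d π = 0 := by
  obtain ⟨τ, k, e, c, h, hc, hsub⟩ := exists_isLabelledChain hd.chain
  rw [h.eq_chain hc] at hsub
  refine ⟨τ, k, e, h, fun π hπ => ?_⟩
  by_contra h0
  exact hπ (hsub h0)

namespace NCHypertree

theorem edgeVec_congr {φ ψ : Finset (Fin (n + 1)) → ℝ} (h : ∀ e ∈ τ.edges, φ e = ψ e) :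
    τ.edgeVec φ = τ.edgeVec ψ := by
  ext e
  simp only [edgeVec]
  split_ifs with he
  · rw [h e he]
  · rfl

theorem edgeVec_smul (c : ℝ) (φ : Finset (Fin (n + 1)) → ℝ) :
    τ.edgeVec (fun e => c * φ e) = c • τ.edgeVec φ := by
  ext e
  simp only [edgeVec, PiLp.smul_apply, smul_eq_mul]
  split_ifs
  · ring
  · rw [mul_zero]

theorem edgeVec_zero : τ.edgeVec (fun _ => 0) = 0 := by
  ext e
  simp [edgeVec]

end NCHypertree

/-- If all steps had weight zero, the potential and with it the block weights would vanish, against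
unit length. -/
theorem stepSum_pos (hd : d ∈ ncLink p) : 0 < stepSum d := by
  have hv := isLinkVec_of_mem_ncLink hd
  have h0 : ∀ β : BasicNCHypertree p, 0 ≤ β.nrm * stepWt d β := fun β =>
    mul_nonneg β.nrm_pos.le (hv.stepWt_nonneg β)
  refine lt_of_le_of_ne (Finset.sum_nonneg fun β _ => h0 β) fun hz => ?_
  have h1 : ∀ β : BasicNCHypertree p, stepWt d β = 0 := fun β =>
    (mul_eq_zero.1 ((Finset.sum_eq_zero_iff_of_nonneg fun β _ => h0 β).1 hz.symm β
      (Finset.mem_univ β))).resolve_left β.nrm_pos.ne'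
  obtain ⟨τ, k, e, h, hs⟩ := exists_chain_of_isLinkVec hv
  have h2 := norm_develop_of_mem_ncLink hd
  rw [h.norm_develop hs, τ.edgeVec_congr (ψ := fun _ => 0), NCHypertree.edgeVec_zero,
    norm_zero] at h2
  · exact zero_ne_one h2
  · intro f hf
    rw [← h.potential_stepWt hs hv.perp hf, potential]
    exact Finset.sum_eq_zero fun β _ => by rw [h1, zero_mul]

theorem NCHypertree.mem_realization {x : BasicNCHypertree p → ℝ} (h0 : ∀ β, 0 ≤ x β)
    (h1 : ∑ β, x β = 1) (hx : ∀ β, β ∉ τ.verts → x β = 0) :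
    x ∈ realization (hypertreeComplex p) := by
  refine ⟨h0, h1, τ.verts, ⟨?_, τ, subset_rfl⟩, hx⟩
  by_contra hne
  rw [Finset.not_nonempty_iff_eq_empty] at hne
  rw [Finset.sum_eq_zero fun β _ => hx β (by simp [hne])] at h1
  exact zero_ne_one h1

theorem toTree_mem (hd : d ∈ ncLink p) : toTree d ∈ realization (hypertreeComplex p) := by
  have hv := isLinkVec_of_mem_ncLink hd
  have hZ := stepSum_pos hd
  obtain ⟨τ, k, e, h, hs⟩ := exists_chain_of_isLinkVec hv
  refine τ.mem_realization
    (fun β => div_nonneg (mul_nonneg β.nrm_pos.le (hv.stepWt_nonneg β)) hZ.le) ?_ fun β hβ => ?_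
  · simp only [toTree, ← Finset.sum_div]
    exact div_self hZ.ne'
  · rw [toTree, h.stepWt_eq_zero hs β hβ, mul_zero, zero_div]

/-- Normalization forgets only the scale of `stepWt d`, and unit length restores it. -/
theorem toTree_injOn : Set.InjOn toTree (ncLink p) := by
  intro d hd d' hd' heq
  have hZ := stepSum_pos hd
  have hZ' := stepSum_pos hd'
  set c := stepSum d / stepSum d' with hc
  have hcpos : 0 < c := div_pos hZ hZ'
  have h1 : d = c • d' := by
    refine (isLinkVec_of_mem_ncLink hd).eq_of_stepWt_eq
      ((isLinkVec_of_mem_ncLink hd').smul hcpos) ?_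
    rw [stepWt_smul]
    funext β
    have h2 := congrFun heq β
    rw [toTree, toTree, div_eq_div_iff hZ.ne' hZ'.ne'] at h2
    have h3 : stepWt d β * stepSum d' = stepWt d' β * stepSum d :=
      mul_left_cancel₀ β.nrm_pos.ne' (by linarith)
    rw [Pi.smul_apply, smul_eq_mul, hc, div_mul_eq_mul_div, eq_div_iff hZ'.ne']
    linarith
  have h2 : develop n NCPartition.rank d = c • develop n NCPartition.rank d' := by
    rw [h1]
    simp [develop, Finset.smul_sum, mul_smul]
  have h3 := norm_develop_of_mem_ncLink hd
  rw [h2, norm_smul, norm_develop_of_mem_ncLink hd', mul_one, Real.norm_of_nonneg hcpos.le] at h3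
  rw [h1, h3, one_smul]

namespace NCHypertree

variable {k : ℕ} {e : Fin k → Finset (Fin (n + 1))}

theorem IsProperOrdering.sum_edges (h : τ.IsProperOrdering e) (G : Finset (Fin (n + 1)) → ℝ) :
    ∑ f ∈ τ.edges, G f = ∑ i, G (e i) := by
  classical
  have h1 : τ.edges = Finset.univ.image e := by
    ext f
    rw [Finset.mem_image]
    refine ⟨fun hf => ?_, ?_⟩
    · obtain ⟨i, rfl⟩ := h.exists_eq hf
      exact ⟨i, Finset.mem_univ i, rfl⟩
    · rintro ⟨i, -, rfl⟩; exact h.mem i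
  rw [h1, Finset.sum_image fun i _ j _ hij => h.1 hij]

/-! ### The inverse map on one partition simplex. -/

open Classical in
/-- The vector with given block weights on the simplex of a proper ordering. -/
def IsProperOrdering.vec (h : τ.IsProperOrdering e) (φ : Fin k → ℝ) (π : NCPartition p) : ℝ :=
  ∑ i, φ i * ((if π = h.chain i.succ then 1 else 0) - if π = h.chain i.castSucc then 1 else 0)

section

variable (h : τ.IsProperOrdering e) (φ : Fin k → ℝ)

theorem IsProperOrdering.sum_vec_mul (F : NCPartition p → ℝ) :
    ∑ π, h.vec φ π * F π = ∑ i, φ i * (F (h.chain i.succ) - F (h.chain i.castSucc)) := by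
  classical
  simp only [IsProperOrdering.vec, Finset.sum_mul]
  rw [Finset.sum_comm]
  refine Finset.sum_congr rfl fun i _ => ?_
  simp [mul_assoc, ← Finset.mul_sum, sub_mul, Finset.sum_sub_distrib]

theorem IsProperOrdering.vec_eq_zero (π : NCPartition p) (hπ : π ∉ Set.range h.chain) :
    h.vec φ π = 0 := by
  classical
  refine Finset.sum_eq_zero fun i _ => ?_
  rw [if_neg fun h' => hπ ⟨_, h'.symm⟩, if_neg fun h' => hπ ⟨_, h'.symm⟩, sub_zero, mul_zero]

theorem IsProperOrdering.indicator_sub (h : τ.IsProperOrdering e) (i j : Fin k) :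
    ((if e j ∈ initial e (i.succ : Fin (k + 1)) then (1 : ℝ) else 0) -
      if e j ∈ initial e (i.castSucc : Fin (k + 1)) then 1 else 0) = if j = i then 1 else 0 := by
  simp only [h.mem_initial_iff, Fin.val_succ, Fin.val_castSucc, Fin.ext_iff]
  split_ifs <;> first | omega | norm_num

theorem IsProperOrdering.blockWt_vec (j : Fin k) : blockWt (h.vec φ) (e j) = φ j := by
  classical
  rw [blockWt, h.sum_vec_mul]
  simp only [h.under_chain_iff (h.mem j), h.indicator_sub]
  simp

/-- By Abel summation the coefficient at an inner element of the chain is the drop of `φ` between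
consecutive hyperedges, so a decreasing `φ` points into the simplex. The weighted sum in `h0` is the
product with the long diagonal. -/
theorem IsProperOrdering.isLinkVec_vec (hφ : Antitone φ)
    (h0 : ∑ i, (((e i).card - 1 : ℕ) : ℝ) * φ i = 0) : IsLinkVec (h.vec φ) where
  nonneg π h1 h2 := by
    classical
    by_cases hπ : π ∈ Set.range h.chain
    · obtain ⟨l, rfl⟩ := hπ
      obtain ⟨i, rfl⟩ := Fin.exists_succ_eq.2 (fun hl : l = 0 => h1 (hl ▸ h.isLabelledChain.2.1))
      obtain ⟨j, hj⟩ := Fin.exists_castSucc_eq.2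
        (fun hl : i.succ = Fin.last k => h2 (hl ▸ h.isLabelledChain.2.2.1))
      have hij : i ≤ j := by
        have := congrArg Fin.val hj
        simp only [Fin.val_succ, Fin.val_castSucc] at this
        rw [Fin.le_def]; omega
      have key : h.vec φ (h.chain i.succ) = φ i - φ j := by
        rw [IsProperOrdering.vec]
        simp only [h.chain_injective.eq_iff, mul_sub, Finset.sum_sub_distrib]
        conv_lhs => arg 2; rw [← hj]
        simp only [(Fin.succ_injective k).eq_iff, (Fin.castSucc_injective k).eq_iff]
        simp
      rw [key]
      exact sub_nonneg.2 (hφ hij)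
    · exact (h.vec_eq_zero φ π hπ).ge
  sum_eq := by simpa using h.sum_vec_mul φ fun _ => 1
  chain := by
    refine IsChain.mono ?_ h.isLabelledChain.1.monotone.isChain_range
    intro π hπ
    by_contra hc
    exact hπ (h.vec_eq_zero φ π hc)
  perp := by
    rw [h.sum_vec_mul, ← h0]
    refine Finset.sum_congr rfl fun i _ => ?_
    rw [h.rank_chain, h.rank_chain, ← Finset.sum_sub_distrib]
    simp only [← mul_sub]
    rw [h.sum_edges fun f => ((f.card - 1 : ℕ) : ℝ) *
      ((if f ∈ initial e (i.succ : Fin (k + 1)) then (1 : ℝ) else 0) -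
      if f ∈ initial e (i.castSucc : Fin (k + 1)) then 1 else 0)]
    simp only [h.indicator_sub]
    simp [mul_comm]

end

/-- A point of the simplex of `τ` whose potential decreases along a proper ordering comes from the
simplex of the link given by this ordering. -/
theorem IsProperOrdering.exists_toTree_eq (h : τ.IsProperOrdering e)
    {x : BasicNCHypertree p → ℝ} (hx1 : ∑ β, x β = 1) (hx : ∀ β, β ∉ τ.verts → x β = 0)
    (hφ : Antitone fun i => potential (unscale x) (e i)) :
    ∃ d ∈ ncLink p, (∀ π, π ∉ Set.range h.chain → d π = 0) ∧ toTree d = x := by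
  set φ : Fin k → ℝ := fun i => potential (unscale x) (e i) with hφdef
  have hu := τ.unscale_eq_zero hx
  have hv : IsLinkVec (h.vec φ) := h.isLinkVec_vec φ hφ (by
    rw [← τ.sum_rank_mul_potential hu, h.sum_edges])
  have hb : ∀ f ∈ τ.edges, blockWt (h.vec φ) f = potential (unscale x) f := by
    intro f hf
    obtain ⟨j, rfl⟩ := h.exists_eq hf
    exact h.blockWt_vec φ j
  have hnorm : ‖develop n NCPartition.rank (h.vec φ)‖ = ‖τ.pointVec x‖ := by
    rw [h.norm_develop (h.vec_eq_zero φ), τ.edgeVec_congr hb, pointVec]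
  have hpos : 0 < ‖τ.pointVec x‖ := by
    rw [norm_pos_iff]
    intro h0
    rw [τ.eq_zero_of_pointVec hx h0] at hx1
    simp at hx1
  set c := ‖τ.pointVec x‖⁻¹ with hc
  have hcpos : 0 < c := inv_pos.2 hpos
  have hn : n ≠ 0 := by
    rintro rfl
    rw [Subsingleton.elim (develop 0 NCPartition.rank (h.vec φ)) 0, norm_zero] at hnorm
    exact hpos.ne hnorm
  have hd : c • h.vec φ ∈ ncLink p := by
    rw [mem_ncLink_iff hn]
    refine ⟨hv.smul hcpos, ?_⟩
    have h2 : develop n NCPartition.rank (c • h.vec φ) =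
        c • develop n NCPartition.rank (h.vec φ) := by
      simp [develop, Finset.smul_sum, mul_smul]
    rw [h2, norm_smul, hnorm, Real.norm_of_nonneg hcpos.le, hc, inv_mul_cancel₀ hpos.ne']
  refine ⟨c • h.vec φ, hd, fun π hπ => ?_, ?_⟩
  · rw [Pi.smul_apply, h.vec_eq_zero φ π hπ, smul_zero]
  -- Both sides are combinations of cuts of `τ` with the same potential on its hyperedges.
  · have hstep : stepWt (h.vec φ) = unscale x :=
      τ.eq_of_potential (h.stepWt_eq_zero (h.vec_eq_zero φ)) hu fun f hf => by
        rw [h.potential_stepWt (h.vec_eq_zero φ) hv.perp hf, hb f hf]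
    have hβ : ∀ β : BasicNCHypertree p, β.nrm * stepWt (c • h.vec φ) β = c * x β := by
      intro β
      rw [stepWt_smul, hstep, Pi.smul_apply, smul_eq_mul, unscale]
      have := β.nrm_pos.ne'
      field_simp
    funext β
    rw [toTree, stepSum]
    simp only [hβ, ← Finset.mul_sum, hx1, mul_one]
    exact mul_div_cancel_left₀ _ hcpos.ne'

/-- The potential of a point of the simplex of a hypertree decreases along the local orders. -/
theorem potential_le_of_leftFrom {x : BasicNCHypertree p → ℝ} (hx0 : ∀ β, 0 ≤ x β)
    (hx : ∀ β, β ∉ τ.verts → x β = 0) {e f : Finset (Fin (n + 1))} {v : Fin (n + 1)}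
    (he : e ∈ τ.edges) (hf : f ∈ τ.edges) (hve : v ∈ e) (hvf : v ∈ f) (h : LeftFrom v e f) :
    potential (unscale x) f ≤ potential (unscale x) e := by
  refine potential_mono (fun β => div_nonneg (hx0 β) β.nrm_pos.le) fun β hβ => ?_
  refine subset_lower_of_leftFrom he hf hve hvf h ?_
  by_contra hc
  exact hβ (τ.unscale_eq_zero hx β hc)

end NCHypertree

end LinkMap

end NCHT
end

noncomputable section

namespace NCHT

/-! ### The homeomorphism -/

section Homeo

variable {n : ℕ} {p : ConvexPolygon (n + 1)} {τ : NCHypertree p}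

open NCPartition

theorem NCPartition.exists_chain_eq (π : NCPartition p) : ∃ (τ : NCHypertree p) (k : ℕ)
    (e : Fin k → Finset (Fin (n + 1))) (h : τ.IsProperOrdering e) (i : Fin (k + 1)),
    h.chain i = π := by
  have h0 : IsChain (· ≤ ·) {π} := Set.subsingleton_singleton.isChain
  obtain ⟨τ, k, e, c, h, hc, hsub⟩ := exists_isLabelledChain h0
  obtain ⟨i, hi⟩ := hsub rfl
  exact ⟨τ, k, e, h, i, h.eq_chain hc ▸ hi⟩

theorem NCPartition.rank_pos {π : NCPartition p} (hπ : π ≠ ⊥) : 0 < π.rank := by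
  obtain ⟨τ, k, e, h, i, rfl⟩ := π.exists_chain_eq
  obtain ⟨j, rfl⟩ := Fin.exists_succ_eq.2 (fun hl : i = 0 => hπ (hl ▸ h.isLabelledChain.2.1))
  rw [NCHypertree.IsProperOrdering.chain, NCHypertree.rank_comp]
  have h1 : e j ∈ NCHypertree.initial e (j.succ : Fin (k + 1)) := by
    rw [h.mem_initial_iff]; simp
  have h2 := τ.two_le (h.mem j)
  exact Finset.sum_pos' (fun _ _ => Nat.zero_le _) ⟨e j, h1, by omega⟩

theorem NCPartition.rank_lt {π : NCPartition p} (hπ : π ≠ ⊤) : π.rank < n := by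
  obtain ⟨τ, k, e, h, i, rfl⟩ := π.exists_chain_eq
  obtain ⟨j, rfl⟩ := Fin.exists_castSucc_eq.2
    (fun hl : i = Fin.last k => hπ (hl ▸ h.isLabelledChain.2.2.1))
  have h1 : e j ∉ NCHypertree.initial e (j.castSucc : Fin (k + 1)) := by
    rw [h.mem_initial_iff]; simp
  have h2 := τ.two_le (h.mem j)
  rw [NCHypertree.IsProperOrdering.chain, NCHypertree.rank_comp]
  exact (Finset.sum_lt_sum_of_subset (h.isLower _).1 (h.mem j) h1 (by omega)
    fun _ _ _ => Nat.zero_le _).trans_eq τ.sum_card_sub_one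

/-! ### Compactness of the link. -/

theorem isClosed_ncLink : IsClosed (ncLink p) := by
  by_cases hn : n = 0
  · subst hn
    rw [Set.eq_empty_of_forall_notMem fun d hd => ne_zero_of_mem_ncLink hd rfl]
    exact isClosed_empty
  have h : ncLink p = {d | (∀ π, π ≠ ⊥ → π ≠ ⊤ → 0 ≤ d π) ∧ ∑ π, d π = 0 ∧
      (∀ π ρ, ¬ π ≤ ρ → ¬ ρ ≤ π → d π * d ρ = 0) ∧ ∑ π, d π * (π.rank : ℝ) = 0 ∧
      ‖develop n NCPartition.rank d‖ = 1} := by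
    ext d
    rw [mem_ncLink_iff hn]
    constructor
    · rintro ⟨⟨h1, h2, h3, h4⟩, h5⟩
      refine ⟨h1, h2, fun π ρ hπρ hρπ => ?_, h4, h5⟩
      by_contra h0
      rcases h3.total (left_ne_zero_of_mul h0) (right_ne_zero_of_mul h0) with h | h
      · exact hπρ h
      · exact hρπ h
    · rintro ⟨h1, h2, h3, h4, h5⟩
      refine ⟨⟨h1, h2, fun π hπ ρ hρ _ => ?_, h4⟩, h5⟩
      by_contra! hc
      exact mul_ne_zero hπ hρ (h3 π ρ hc.1 hc.2)
  rw [h]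
  simp only [Set.ofPred_and, Set.ofPred_forall]
  refine IsClosed.inter ?_ (IsClosed.inter ?_ (IsClosed.inter ?_ (IsClosed.inter ?_ ?_)))
  · exact isClosed_iInter fun π => isClosed_iInter fun _ => isClosed_iInter fun _ =>
      isClosed_le continuous_const (continuous_apply π)
  · exact isClosed_eq (by fun_prop) continuous_const
  · exact isClosed_iInter fun π => isClosed_iInter fun ρ => isClosed_iInter fun _ =>
      isClosed_iInter fun _ => isClosed_eq (by fun_prop) continuous_const
  · exact isClosed_eq (by fun_prop) continuous_const
  · refine isClosed_eq (Continuous.norm ?_) continuous_const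
    unfold develop
    fun_prop

/-- Only `⊤` has rank `n`, so the last coordinate of the developed unit vector is `d ⊤`.
Perpendicularity then bounds the nonnegative inner coefficients, and the sum zero bounds `d ⊥`. -/
theorem exists_bound_ncLink : ∃ C : ℝ, ∀ d ∈ ncLink p, ∀ π, |d π| ≤ C := by
  classical
  set v := corner n n - corner n (n - 1) with hv
  refine ⟨n * ‖v‖ + ‖v‖, fun d hd => ?_⟩
  have hn := ne_zero_of_mem_ncLink hd
  have hL := isLinkVec_of_mem_ncLink hd
  have hbt := bot_ne_top (p := p) hn
  have htop : |d ⊤| ≤ ‖v‖ := by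
    have h1 : inner ℝ (develop n NCPartition.rank d) v = d ⊤ := by
      rw [hv, inner_sub_right]
      simp only [develop, sum_inner, real_inner_smul_left, inner_corner (rank_le _),
        ← Finset.sum_sub_distrib]
      rw [Finset.sum_eq_single ⊤]
      · rw [NCHypertree.rank_top, min_self, min_eq_right (by omega), Nat.cast_sub (by omega)]
        rw [Nat.cast_one]
        ring
      · intro π _ hπ
        have h2 : π.rank ≤ n - 1 := Nat.le_sub_one_of_lt (rank_lt hπ)
        rw [min_eq_left (rank_le π), min_eq_left h2, sub_self]
      · exact fun h => absurd (Finset.mem_univ _) h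
    have h2 := abs_real_inner_le_norm (develop n NCPartition.rank d) v
    rwa [h1, norm_develop_of_mem_ncLink hd, one_mul] at h2
  set I := (Finset.univ.erase (⊤ : NCPartition p)).erase ⊥ with hI
  have hI0 : ∀ π ∈ I, 0 ≤ d π := fun π hπ => by
    simp only [hI, Finset.mem_erase] at hπ
    exact hL.nonneg π hπ.1 hπ.2.1
  have hbmem : (⊥ : NCPartition p) ∈ Finset.univ.erase ⊤ := by simp [hbt]
  have hsplit : ∀ F : NCPartition p → ℝ, ∑ π, F π = F ⊤ + (F ⊥ + ∑ π ∈ I, F π) := fun F => by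
    rw [hI, Finset.add_sum_erase _ _ hbmem, Finset.add_sum_erase _ _ (Finset.mem_univ _)]
  have hp := hL.perp
  have hs := hL.sum_eq
  rw [hsplit] at hp hs
  rw [NCHypertree.rank_top, NCPartition.rank_bot, Nat.cast_zero, mul_zero, zero_add] at hp
  have hle : ∑ π ∈ I, d π ≤ ∑ π ∈ I, d π * (π.rank : ℝ) := by
    refine Finset.sum_le_sum fun π hπ => le_mul_of_one_le_right (hI0 π hπ) ?_
    simp only [hI, Finset.mem_erase] at hπ
    exact_mod_cast rank_pos hπ.1
  have hIn : ∑ π ∈ I, d π ≤ n * ‖v‖ := by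
    have h1 : -(d ⊤) * n ≤ ‖v‖ * n :=
      mul_le_mul_of_nonneg_right ((neg_le_abs _).trans htop) (Nat.cast_nonneg n)
    linarith
  have hIpos := Finset.sum_nonneg hI0
  have hv0 := norm_nonneg v
  intro π
  by_cases h1 : π = ⊤
  · rw [h1]
    exact htop.trans (le_add_of_nonneg_left (by positivity))
  by_cases h2 : π = ⊥
  · rw [h2, show d ⊥ = -(d ⊤ + ∑ π ∈ I, d π) by linarith, abs_neg]
    refine (abs_add_le _ _).trans ?_
    rw [abs_of_nonneg hIpos]
    linarith
  · have hπ : π ∈ I := by simp [hI, h1, h2]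
    rw [abs_of_nonneg (hI0 π hπ)]
    linarith [Finset.single_le_sum hI0 hπ]

instance : CompactSpace (ncLink p) := by
  rw [← isCompact_iff_compactSpace]
  obtain ⟨C, hC⟩ := exists_bound_ncLink (p := p)
  refine Metric.isCompact_of_isClosed_isBounded isClosed_ncLink ?_
  refine (Metric.isBounded_closedBall (x := (0 : NCPartition p → ℝ)) (r := max C 0)).subset ?_
  intro d hd
  rw [mem_closedBall_zero_iff, pi_norm_le_iff_of_nonneg (le_max_right _ _)]
  exact fun π => (hC d hd π).trans (le_max_left _ _)

/-- The map from the link to the realization of the hypertree complex. -/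
def toRealization (d : ncLink p) : realization (hypertreeComplex p) := ⟨toTree d.1, toTree_mem d.2⟩

theorem continuous_stepWt (β : BasicNCHypertree p) :
    Continuous fun d : NCPartition p → ℝ => stepWt d β :=
  continuous_finsetSum _ fun π _ => (continuous_apply π).mul continuous_const

/-- Each `stepWt · β` is one linear function on the whole link, so nothing has to be glued over
simplices. -/
theorem continuous_toRealization : Continuous (toRealization (p := p)) := by
  have h1 : ∀ β : BasicNCHypertree p,
      Continuous fun d : NCPartition p → ℝ => β.nrm * stepWt d β :=
    fun β => continuous_const.mul (continuous_stepWt β)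
  refine Continuous.subtype_mk (continuous_pi fun β => ?_) _
  refine Continuous.div ((h1 β).comp continuous_subtype_val) ?_ fun d => (stepSum_pos d.2).ne'
  exact (continuous_finsetSum _ fun β _ => h1 β).comp continuous_subtype_val

namespace NCHypertree

variable {k : ℕ} {e : Fin k → Finset (Fin (n + 1))}

theorem exists_isProperOrdering_potential {x : BasicNCHypertree p → ℝ} (hx0 : ∀ β, 0 ≤ x β)
    (hx : ∀ β, β ∉ τ.verts → x β = 0) : ∃ (k : ℕ) (e : Fin k → Finset (Fin (n + 1))),
      τ.IsProperOrdering e ∧ Antitone fun i => potential (unscale x) (e i) :=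
  exists_isProperOrdering (potential (unscale x)) fun _ he _ hf _ hve hvf h =>
    potential_le_of_leftFrom hx0 hx he hf hve hvf h

end NCHypertree

theorem exists_mem_closedSimplex (x : realization (hypertreeComplex p)) :
    ∃ τ : NCHypertree p, x ∈ τ.closedSimplex := by
  obtain ⟨s, ⟨-, τ, hs⟩, h0⟩ := x.2.2.2
  exact ⟨τ, fun β hβ => h0 β fun h => hβ (hs h)⟩

/-- Injectivity is global. For surjectivity one simplex suffices: sorting its hyperedges by the
potential of the point gives a proper ordering. -/
theorem bijective_toRealization : Function.Bijective (toRealization (p := p)) := by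
  constructor
  · intro d d' h
    exact Subtype.ext (toTree_injOn d.2 d'.2 (congrArg Subtype.val h))
  · intro x
    obtain ⟨τ, hτ⟩ := exists_mem_closedSimplex x
    obtain ⟨k, e, h, hφ⟩ := τ.exists_isProperOrdering_potential x.2.1 hτ
    obtain ⟨d, hd, -, hdx⟩ := h.exists_toTree_eq x.2.2.1 hτ hφ
    exact ⟨⟨d, hd⟩, Subtype.ext hdx⟩

variable (p) in
/-- The natural homeomorphism from the hypertree complex to the link. -/
def treeHomeo : realization (hypertreeComplex p) ≃ₜ ncLink p :=
  (Continuous.homeoOfEquivCompactToT2 (f := Equiv.ofBijective _ bijective_toRealization)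
    continuous_toRealization).symm

theorem toTree_treeHomeo (x : realization (hypertreeComplex p)) :
    toTree (treeHomeo p x).1 = x.1 :=
  congrArg Subtype.val ((treeHomeo p).symm_apply_apply x)

namespace NCHypertree

variable {k : ℕ} {e : Fin k → Finset (Fin (n + 1))}

theorem IsProperOrdering.treeHomeo_mem (h : τ.IsProperOrdering e)
    {x : realization (hypertreeComplex p)} (hx : x ∈ τ.closedSimplex)
    (hφ : Antitone fun i => potential (unscale x.1) (e i)) :
    treeHomeo p x ∈ linkCell n NCPartition.rank (Set.range h.chain) := by
  obtain ⟨d, hd, hs, hdx⟩ := h.exists_toTree_eq x.2.2.1 hx hφ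
  have h1 : (treeHomeo p x).1 = d :=
    toTree_injOn (treeHomeo p x).2 hd ((toTree_treeHomeo x).trans hdx.symm)
  intro π hπ
  rw [h1, hs π hπ]

theorem IsProperOrdering.mem_closedSimplex (h : τ.IsProperOrdering e)
    {x : realization (hypertreeComplex p)}
    (hx : treeHomeo p x ∈ linkCell n NCPartition.rank (Set.range h.chain)) :
    x ∈ τ.closedSimplex := by
  intro β hβ
  rw [← toTree_treeHomeo, toTree, h.stepWt_eq_zero hx β hβ, mul_zero, zero_div]

theorem mem_partitionCells_iff {K : Set (ncLink p)} : K ∈ τ.partitionCells ↔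
    ∃ (k : ℕ) (e : Fin k → Finset (Fin (n + 1))) (h : τ.IsProperOrdering e),
      K = linkCell n NCPartition.rank (Set.range h.chain) := by
  constructor
  · rintro ⟨k, e, c, h, hc, rfl⟩
    exact ⟨k, e, h, by rw [h.eq_chain hc]⟩
  · rintro ⟨k, e, h, rfl⟩
    exact ⟨k, e, h.chain, h, h.isLabelledChain, rfl⟩

theorem image_closedSimplex (τ : NCHypertree p) :
    treeHomeo p '' τ.closedSimplex = ⋃₀ τ.partitionCells := by
  ext c
  constructor
  · rintro ⟨x, hx, rfl⟩
    obtain ⟨k, e, h, hφ⟩ := τ.exists_isProperOrdering_potential x.2.1 hx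
    exact ⟨_, mem_partitionCells_iff.2 ⟨k, e, h, rfl⟩, h.treeHomeo_mem hx hφ⟩
  · rintro ⟨K, hK, hc⟩
    obtain ⟨k, e, h, rfl⟩ := mem_partitionCells_iff.1 hK
    obtain ⟨x, rfl⟩ := (treeHomeo p).surjective c
    exact ⟨x, h.mem_closedSimplex hc, rfl⟩

/-- The homeomorphism is an isometry on each partition simplex. -/
theorem IsProperOrdering.linkAngle_eq (h : τ.IsProperOrdering e)
    {x y : realization (hypertreeComplex p)}
    (hx : treeHomeo p x ∈ linkCell n NCPartition.rank (Set.range h.chain))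
    (hy : treeHomeo p y ∈ linkCell n NCPartition.rank (Set.range h.chain)) :
    linkAngle n NCPartition.rank (treeHomeo p x) (treeHomeo p y) =
      (sphericalStructure p).angle x.1 y.1 := by
  -- The vector of the tree point is a positive multiple of the block weight vector, and block
  -- weights compute the inner products in the link; angles ignore the factor.
  have key : ∀ {x : realization (hypertreeComplex p)},
      treeHomeo p x ∈ linkCell n NCPartition.rank (Set.range h.chain) →
      ∃ r : ℝ, 0 < r ∧ τ.pointVec x.1 = r • τ.edgeVec (blockWt (treeHomeo p x).1) := by
    intro x hx
    have hd := (treeHomeo p x).2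
    refine ⟨(stepSum (treeHomeo p x).1)⁻¹, inv_pos.2 (stepSum_pos hd), ?_⟩
    rw [pointVec, ← edgeVec_smul]
    refine edgeVec_congr fun f hf => ?_
    have h1 : unscale x.1 = (stepSum (treeHomeo p x).1)⁻¹ • stepWt (treeHomeo p x).1 := by
      funext β
      rw [unscale, ← toTree_treeHomeo, toTree, Pi.smul_apply, smul_eq_mul]
      have := β.nrm_pos.ne'
      field_simp
    rw [h1, potential_smul, h.potential_stepWt hx (isLinkVec_of_mem_ncLink hd).perp hf]
  obtain ⟨r, hr, hxr⟩ := key hx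
  obtain ⟨s, hs, hys⟩ := key hy
  rw [linkAngle, h.angle_develop hx hy, τ.angle_eq (h.mem_closedSimplex hx)
    (h.mem_closedSimplex hy), hxr, hys, InnerProductGeometry.angle_smul_left_of_pos _ _ hr,
    InnerProductGeometry.angle_smul_right_of_pos _ _ hs]

end NCHypertree

end Homeo

end NCHT
end

noncomputable section

namespace NCHT

/-! ### Length metrics -/

section PathDist

open scoped ENNReal

variable {X : Type} {cells : Set (Set X)} {d : X → X → ℝ}

theorem pathDist_self (x : X) : pathDist cells d x x = 0 := by
  refine le_antisymm ?_ zero_le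
  refine iInf_le_of_le 0 (iInf_le_of_le (fun _ => x) (iInf_le_of_le ⟨rfl, rfl, fun i => i.elim0⟩ ?_))
  simp

/-- A function that grows in each cell at most by the distance is bounded by the path metric. -/
theorem le_add_pathDist {F : X → ℝ≥0∞}
    (hF : ∀ A ∈ cells, ∀ w ∈ A, ∀ w' ∈ A, F w' ≤ F w + ENNReal.ofReal (d w w')) (x y : X) :
    F y ≤ F x + pathDist cells d x y := by
  have key : ∀ (m : ℕ) (z : Fin (m + 1) → X),
      (∀ i : Fin m, ∃ A ∈ cells, z i.castSucc ∈ A ∧ z i.succ ∈ A) →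
      F (z (Fin.last m)) ≤ F (z 0) + ∑ i : Fin m, ENNReal.ofReal (d (z i.castSucc) (z i.succ)) := by
    intro m
    induction m with
    | zero => intro z _; simp
    | succ m ih =>
      intro z hz
      obtain ⟨A, hA, h1, h2⟩ := hz (Fin.last m)
      have h3 := ih (fun i => z i.castSucc) fun i => hz i.castSucc
      rw [Fin.sum_univ_castSucc, ← add_assoc]
      exact (hF A hA _ h1 _ h2).trans (add_le_add_left h3 _)
  simp only [pathDist, ENNReal.add_iInf]
  refine le_iInf fun m => le_iInf fun z => le_iInf fun ⟨h0, h1, h2⟩ => ?_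
  rw [← h0, ← h1]
  exact key m z h2

theorem pathDist_le_add {A : Set X} (hA : A ∈ cells) (x : X) {w w' : X} (hw : w ∈ A)
    (hw' : w' ∈ A) :
    pathDist cells d x w' ≤ pathDist cells d x w + ENNReal.ofReal (d w w') := by
  conv_rhs => rw [pathDist]
  simp only [ENNReal.iInf_add]
  refine le_iInf fun m => le_iInf fun z => le_iInf fun ⟨h0, h1, h2⟩ => ?_
  refine iInf_le_of_le (m + 1) (iInf_le_of_le (Fin.snoc (α := fun _ => X) z w')
    (iInf_le_of_le ⟨?_, ?_, fun i => ?_⟩ ?_))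
  · rw [← Fin.castSucc_zero, Fin.snoc_castSucc, h0]
  · rw [Fin.snoc_last]
  · induction i using Fin.lastCases with
    | last =>
      refine ⟨A, hA, ?_, ?_⟩
      · rw [Fin.snoc_castSucc, h1]; exact hw
      · rw [Fin.succ_last, Fin.snoc_last]; exact hw'
    | cast i =>
      rw [Fin.snoc_castSucc, Fin.succ_castSucc, Fin.snoc_castSucc]
      exact h2 i
  · rw [Fin.sum_univ_castSucc]
    simp only [Fin.succ_castSucc, Fin.snoc_castSucc, Fin.succ_last, Fin.snoc_last, h1, le_refl]

theorem pathDist_le_of_mem {A : Set X} (hA : A ∈ cells) {x y : X} (hx : x ∈ A) (hy : y ∈ A) :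
    pathDist cells d x y ≤ ENNReal.ofReal (d x y) := by
  simpa [pathDist_self] using pathDist_le_add (d := d) hA x hx hy

theorem pathDist_triangle (x y z : X) :
    pathDist cells d x z ≤ pathDist cells d x y + pathDist cells d y z :=
  le_add_pathDist (fun _ hA _ hw _ hw' => pathDist_le_add hA x hw hw') y z

end PathDist

end NCHT
end

noncomputable section

namespace NCHT

/-! ### The induced metric -/

section Metric

open scoped ENNReal

variable {n : ℕ} {p : ConvexPolygon (n + 1)} {τ : NCHypertree p}

theorem potential_unscale_add_smul (x y : BasicNCHypertree p → ℝ) (s t : ℝ)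
    (e : Finset (Fin (n + 1))) : potential (unscale (s • x + t • y)) e =
      s * potential (unscale x) e + t * potential (unscale y) e := by
  simp only [potential, unscale, Finset.mul_sum, ← Finset.sum_add_distrib]
  refine Finset.sum_congr rfl fun β _ => ?_
  simp only [Pi.add_apply, Pi.smul_apply, smul_eq_mul]
  ring

namespace NCHypertree

theorem pointVec_add_smul (x y : BasicNCHypertree p → ℝ) (s t : ℝ) :
    τ.pointVec (s • x + t • y) = s • τ.pointVec x + t • τ.pointVec y := by
  ext e
  simp only [pointVec, edgeVec, potential_unscale_add_smul, PiLp.add_apply, PiLp.smul_apply,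
    smul_eq_mul]
  split_ifs <;> ring

theorem pointVec_ne_zero {x : realization (hypertreeComplex p)} (hx : x ∈ τ.closedSimplex) :
    τ.pointVec x.1 ≠ 0 := by
  intro h
  have h1 := x.2.2.1
  rw [τ.eq_zero_of_pointVec hx h] at h1
  simp at h1

/-- If the potentials of two points order no two hyperedges differently, then the points lie in a
common partition simplex. -/
theorem exists_common_isProperOrdering {x y : realization (hypertreeComplex p)}
    (hx : x ∈ τ.closedSimplex) (hy : y ∈ τ.closedSimplex)
    (h : ∀ e ∈ τ.edges, ∀ f ∈ τ.edges, potential (unscale x.1) e < potential (unscale x.1) f →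
      potential (unscale y.1) e ≤ potential (unscale y.1) f) :
    ∃ (k : ℕ) (e : Fin k → Finset (Fin (n + 1))) (h : τ.IsProperOrdering e),
      treeHomeo p x ∈ linkCell n NCPartition.rank (Set.range h.chain) ∧
      treeHomeo p y ∈ linkCell n NCPartition.rank (Set.range h.chain) := by
  obtain ⟨k, e, he, hanti⟩ := exists_isProperOrdering (τ := τ)
    (fun e => potential (unscale x.1) e + potential (unscale y.1) e)
    fun e he f hf v hve hvf hl => add_le_add
      (potential_le_of_leftFrom x.2.1 hx he hf hve hvf hl)
      (potential_le_of_leftFrom y.2.1 hy he hf hve hvf hl)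
  refine ⟨k, e, he, he.treeHomeo_mem hx fun i j hij => ?_, he.treeHomeo_mem hy fun i j hij => ?_⟩
  · by_contra! hc
    have h1 := h _ (he.mem i) _ (he.mem j) hc
    have h2 := hanti hij
    simp only [Function.comp_apply] at h2
    linarith
  · by_contra! hc
    have h2 := hanti hij
    simp only [Function.comp_apply] at h2
    have h1 := h _ (he.mem j) _ (he.mem i) (by linarith)
    linarith

/-- Induction on the number of pairs of hyperedges that `x` and `y` sort oppositely. With no such
pair they lie in one partition simplex. Otherwise the geodesic is divided where the potentials of
such a pair coincide: the angles add up, and both parts have fewer such pairs. -/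
theorem partitionCells_dist_le {x y : realization (hypertreeComplex p)}
    (hx : x ∈ τ.closedSimplex) (hy : y ∈ τ.closedSimplex) :
    pathDist τ.partitionCells (linkAngle n NCPartition.rank) (treeHomeo p x) (treeHomeo p y) ≤
      ENNReal.ofReal ((sphericalStructure p).angle x.1 y.1) := by
  classical
  let disc : (BasicNCHypertree p → ℝ) → (BasicNCHypertree p → ℝ) →
      Finset (Finset (Fin (n + 1)) × Finset (Fin (n + 1))) := fun x y =>
    (τ.edges ×ˢ τ.edges).filter fun q => potential (unscale x) q.1 < potential (unscale x) q.2 ∧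
      potential (unscale y) q.2 < potential (unscale y) q.1
  obtain ⟨N, hN⟩ : ∃ N, (disc x.1 y.1).card ≤ N := ⟨_, le_rfl⟩
  induction N generalizing x y with
  | zero =>
    have h0 := Finset.card_eq_zero.1 (Nat.le_zero.1 hN)
    obtain ⟨k, e, h, hxc, hyc⟩ := exists_common_isProperOrdering hx hy fun e he f hf hef => by
      by_contra! hc
      have : (e, f) ∈ disc x.1 y.1 := by simp [disc, he, hf, hef, hc]
      rw [h0] at this
      exact absurd this (Finset.notMem_empty _)
    rw [← h.linkAngle_eq hxc hyc]
    exact pathDist_le_of_mem (mem_partitionCells_iff.2 ⟨k, e, h, rfl⟩) hxc hyc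
  | succ N ih =>
    rcases (disc x.1 y.1).eq_empty_or_nonempty with h0 | ⟨⟨e, f⟩, hef⟩
    · exact ih hx hy (by rw [h0]; simp)
    obtain ⟨hmem, hxef, hyef⟩ := Finset.mem_filter.1 hef
    simp only at hxef hyef
    set a := potential (unscale x.1) f - potential (unscale x.1) e with ha
    set b := potential (unscale y.1) e - potential (unscale y.1) f with hb
    have ha0 : 0 < a := sub_pos.2 hxef
    have hb0 : 0 < b := sub_pos.2 hyef
    have hab : 0 < a + b := add_pos ha0 hb0
    -- These weights give `e` and `f` the same potential at `z`.
    set s := b / (a + b) with hs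
    set t := a / (a + b) with ht
    have hs0 : 0 < s := div_pos hb0 hab
    have ht0 : 0 < t := div_pos ha0 hab
    have hst : s + t = 1 := by rw [hs, ht]; field_simp; ring
    have hz0 : ∀ β, β ∉ τ.verts → (s • x.1 + t • y.1) β = 0 := fun β hβ => by
      simp [hx β hβ, hy β hβ]
    let z : realization (hypertreeComplex p) := ⟨s • x.1 + t • y.1, τ.mem_realization
      (fun β => add_nonneg (mul_nonneg hs0.le (x.2.1 β)) (mul_nonneg ht0.le (y.2.1 β))) (by
        simp only [Pi.add_apply, Pi.smul_apply, smul_eq_mul, Finset.sum_add_distrib,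
          ← Finset.mul_sum, x.2.2.1, y.2.2.1, mul_one, hst]) hz0⟩
    have hz : z ∈ τ.closedSimplex := hz0
    have hpz : ∀ g, potential (unscale z.1) g =
        s * potential (unscale x.1) g + t * potential (unscale y.1) g :=
      potential_unscale_add_smul x.1 y.1 s t
    have hzef : potential (unscale z.1) e = potential (unscale z.1) f := by
      rw [hpz, hpz]
      have : s * a = t * b := by rw [hs, ht]; ring
      rw [ha, hb] at this
      linarith
    have hnot : (e, f) ∉ disc x.1 z.1 ∧ (e, f) ∉ disc z.1 y.1 := by
      simp [disc, hzef]
    have hsub1 : disc x.1 z.1 ⊂ disc x.1 y.1 := by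
      refine (Finset.ssubset_iff_of_subset fun q hq => ?_).2 ⟨_, hef, hnot.1⟩
      simp only [disc, Finset.mem_filter, hpz] at hq ⊢
      refine ⟨hq.1, hq.2.1, ?_⟩
      have h1 := mul_lt_mul_of_pos_left hq.2.1 hs0
      have h2 : t * potential (unscale y.1) q.2 < t * potential (unscale y.1) q.1 := by
        linarith [hq.2.2]
      exact lt_of_mul_lt_mul_left h2 ht0.le
    have hsub2 : disc z.1 y.1 ⊂ disc x.1 y.1 := by
      refine (Finset.ssubset_iff_of_subset fun q hq => ?_).2 ⟨_, hef, hnot.2⟩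
      simp only [disc, Finset.mem_filter, hpz] at hq ⊢
      refine ⟨hq.1, ?_, hq.2.2⟩
      have h1 := mul_lt_mul_of_pos_left hq.2.2 ht0
      have h2 : s * potential (unscale x.1) q.1 < s * potential (unscale x.1) q.2 := by
        linarith [hq.2.1]
      exact lt_of_mul_lt_mul_left h2 hs0.le
    have hi1 := ih hx hz (by have := Finset.card_lt_card hsub1; omega)
    have hi2 := ih hz hy (by have := Finset.card_lt_card hsub2; omega)
    have hadd : (sphericalStructure p).angle x.1 y.1 =
        (sphericalStructure p).angle x.1 z.1 + (sphericalStructure p).angle z.1 y.1 := by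
      rw [τ.angle_eq hx hy, τ.angle_eq hx hz, τ.angle_eq hz hy]
      refine InnerProductGeometry.angle_eq_angle_add_add_angle_add_of_mem_span
        (pointVec_ne_zero hz) ?_
      rw [Submodule.mem_span_pair]
      refine ⟨⟨s, hs0.le⟩, ⟨t, ht0.le⟩, ?_⟩
      exact (τ.pointVec_add_smul x.1 y.1 s t).symm
    rw [hadd, ENNReal.ofReal_add]
    · exact (pathDist_triangle _ _ _).trans (add_le_add hi1 hi2)
    · exact Real.arccos_nonneg _
    · exact Real.arccos_nonneg _

/-- The homeomorphism is an isometry on each simplex. -/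
theorem angle_eq_partitionCells_dist {x y : realization (hypertreeComplex p)}
    (hx : x ∈ τ.closedSimplex) (hy : y ∈ τ.closedSimplex) :
    ENNReal.ofReal ((sphericalStructure p).angle x.1 y.1) =
    pathDist τ.partitionCells (linkAngle n NCPartition.rank) (treeHomeo p x) (treeHomeo p y) := by
  refine le_antisymm ?_ (partitionCells_dist_le hx hy)
  -- By the triangle inequality for angles, the angle from `x` grows within a partition simplex by
  -- at most the angle measured there.
  have h := le_add_pathDist (cells := τ.partitionCells) (d := linkAngle n NCPartition.rank)
    (F := fun c => ENNReal.ofReal ((sphericalStructure p).angle x.1 ((treeHomeo p).symm c).1))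
    (fun A hA w hw w' hw' => ?_) (treeHomeo p x) (treeHomeo p y)
  · simp only [Homeomorph.symm_apply_apply] at h
    rwa [τ.angle_eq hx hx, InnerProductGeometry.angle_self (pointVec_ne_zero hx),
      ENNReal.ofReal_zero, zero_add] at h
  · obtain ⟨k, e, h, rfl⟩ := mem_partitionCells_iff.1 hA
    obtain ⟨u, rfl⟩ := (treeHomeo p).surjective w
    obtain ⟨v, rfl⟩ := (treeHomeo p).surjective w'
    simp only [Homeomorph.symm_apply_apply]
    have hu := h.mem_closedSimplex hw
    have hv := h.mem_closedSimplex hw'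
    rw [h.linkAngle_eq hw hw', τ.angle_eq hx hu, τ.angle_eq hx hv, τ.angle_eq hu hv,
      ← ENNReal.ofReal_add (InnerProductGeometry.angle_nonneg _ _)
        (InnerProductGeometry.angle_nonneg _ _)]
    exact ENNReal.ofReal_le_ofReal (InnerProductGeometry.angle_le_angle_add_angle _ _ _)

end NCHypertree

/-- Each cell of the link lies in a partition simplex of some hypertree, hence in the image of one
tree simplex, with the same angles. -/
theorem dist_le_linkDist (x y : realization (hypertreeComplex p)) :
    (sphericalStructure p).dist x y ≤
      linkDist n NCPartition.rank (treeHomeo p x) (treeHomeo p y) := by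
  have h := le_add_pathDist
    (cells := {K | ∃ A : Set (NCPartition p), IsChain (· ≤ ·) A ∧ ⊥ ∈ A ∧ ⊤ ∈ A ∧
      K = linkCell n NCPartition.rank A}) (d := linkAngle n NCPartition.rank)
    (F := fun c => (sphericalStructure p).dist x ((treeHomeo p).symm c))
    (fun A hA w hw w' hw' => ?_) (treeHomeo p x) (treeHomeo p y)
  · simp only [Homeomorph.symm_apply_apply] at h
    rw [show (sphericalStructure p).dist x x = 0 from pathDist_self x, zero_add] at h
    exact h
  · obtain ⟨A, hA, -, -, rfl⟩ := hA
    obtain ⟨τ, k, e, c, h, hc, hsub⟩ := exists_isLabelledChain hA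
    rw [h.eq_chain hc] at hsub
    obtain ⟨u, rfl⟩ := (treeHomeo p).surjective w
    obtain ⟨v, rfl⟩ := (treeHomeo p).surjective w'
    simp only [Homeomorph.symm_apply_apply]
    have hu : treeHomeo p u ∈ linkCell n NCPartition.rank (Set.range h.chain) :=
      fun π hπ => hw π fun h' => hπ (hsub h')
    have hv : treeHomeo p v ∈ linkCell n NCPartition.rank (Set.range h.chain) :=
      fun π hπ => hw' π fun h' => hπ (hsub h')
    rw [h.linkAngle_eq hu hv]
    have hu' := h.mem_closedSimplex hu
    have hne : τ.verts.Nonempty := by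
      by_contra hne
      rw [Finset.not_nonempty_iff_eq_empty] at hne
      have h1 := u.2.2.1
      rw [Finset.sum_eq_zero fun β _ => hu' β (by simp [hne])] at h1
      exact zero_ne_one h1
    have hcell : τ.closedSimplex ∈ {A | ∃ s ∈ (hypertreeComplex p).faces,
        A = {x : realization (hypertreeComplex p) | ∀ v, v ∉ s → x.1 v = 0}} :=
      ⟨τ.verts, ⟨hne, τ, subset_rfl⟩, rfl⟩
    exact pathDist_le_add hcell x hu' (h.mem_closedSimplex hv)

theorem linkDist_le_partitionCells_dist (τ : NCHypertree p) (c c' : ncLink p) :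
    linkDist n NCPartition.rank c c' ≤
      pathDist τ.partitionCells (linkAngle n NCPartition.rank) c c' := by
  have h := le_add_pathDist (cells := τ.partitionCells) (d := linkAngle n NCPartition.rank)
    (F := fun w => linkDist n NCPartition.rank c w) (fun A hA w hw w' hw' => ?_) c c'
  · rw [show linkDist n NCPartition.rank c c = 0 from pathDist_self c, zero_add] at h
    exact h
  · obtain ⟨k, e, h, rfl⟩ := NCHypertree.mem_partitionCells_iff.1 hA
    obtain ⟨hmono, h0, h1, -⟩ := h.isLabelledChain
    have hcell : linkCell n NCPartition.rank (Set.range h.chain) ∈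
        {K | ∃ A : Set (NCPartition p), IsChain (· ≤ ·) A ∧ ⊥ ∈ A ∧ ⊤ ∈ A ∧
          K = linkCell n NCPartition.rank A} :=
      ⟨_, hmono.monotone.isChain_range, ⟨_, h0⟩, ⟨_, h1⟩, rfl⟩
    exact pathDist_le_add hcell c hw hw'

/-- Within one tree simplex the angle bounds the length distance through its partition simplices,
which are cells of the link. -/
theorem linkDist_le_dist (x y : realization (hypertreeComplex p)) :
    linkDist n NCPartition.rank (treeHomeo p x) (treeHomeo p y) ≤
      (sphericalStructure p).dist x y := by
  have h := le_add_pathDist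
    (cells := {A | ∃ s ∈ (hypertreeComplex p).faces,
      A = {x : realization (hypertreeComplex p) | ∀ v, v ∉ s → x.1 v = 0}})
    (d := fun x y => (sphericalStructure p).angle x.1 y.1)
    (F := fun w => linkDist n NCPartition.rank (treeHomeo p x) (treeHomeo p w))
    (fun A hA w hw w' hw' => ?_) x y
  · rw [show linkDist n NCPartition.rank (treeHomeo p x) (treeHomeo p x) = 0 from
      pathDist_self _, zero_add] at h
    exact h
  · obtain ⟨s, ⟨-, τ, hs⟩, rfl⟩ := hA
    have hu : w ∈ τ.closedSimplex := fun β hβ => hw β fun h' => hβ (hs h')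
    have hv : w' ∈ τ.closedSimplex := fun β hβ => hw' β fun h' => hβ (hs h')
    refine (pathDist_triangle _ (treeHomeo p w) _).trans (add_le_add_right ?_ _)
    exact (linkDist_le_partitionCells_dist τ _ _).trans (NCHypertree.partitionCells_dist_le hu hv)

end Metric

/-! ### The vertices -/

section Vertices

variable {n : ℕ} {p : ConvexPolygon (n + 1)}

-- A hypertree with two hyperedges has a chain with one inner element, whose only nontrivial block
-- is the first hyperedge; the proper ordering makes this the lower one.
open NCHypertree in
theorem hyperedges_treeHomeo (β : BasicNCHypertree p) {e f : Finset (Fin (n + 1))}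
    (hlt : β.1.EdgeLT e f) (x : realization (hypertreeComplex p)) (hx : x.1 β = 1)
    (π : NCPartition p) (hπ : (treeHomeo p x).1 π ≠ 0) :
    π = ⊥ ∨ π = ⊤ ∨ π.hyperedges = {e} := by
  classical
  have hx0 : ∀ γ, γ ≠ β → x.1 γ = 0 := by
    intro γ hγ
    have h1 := x.2.2.1
    rw [← Finset.add_sum_erase _ _ (Finset.mem_univ β), hx] at h1
    have h2 : ∑ γ ∈ Finset.univ.erase β, x.1 γ = 0 := by linarith
    exact (Finset.sum_eq_zero_iff_of_nonneg fun γ _ => x.2.1 γ).1 h2 γ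
      (Finset.mem_erase.2 ⟨hγ, Finset.mem_univ γ⟩)
  have hxβ : x ∈ β.1.closedSimplex := by
    intro γ hγ
    refine hx0 γ ?_
    rintro rfl
    exact hγ (mem_verts_iff_le.2 le_rfl)
  obtain ⟨k, g, h, hφ⟩ := exists_isProperOrdering_potential x.2.1 hxβ
  have hcell := h.treeHomeo_mem hxβ hφ
  have hπr : π ∈ Set.range h.chain := by
    by_contra hc
    exact hπ (hcell π hc)
  obtain ⟨i, rfl⟩ := hπr
  have hk : k = 2 := by
    have h2 : ∑ f ∈ β.1.edges, (1 : ℝ) = ∑ _i : Fin k, (1 : ℝ) := h.sum_edges fun _ => 1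
    simp only [Finset.sum_const, Finset.card_univ, Fintype.card_fin, nsmul_eq_mul, mul_one] at h2
    rw [β.2] at h2
    exact_mod_cast h2.symm
  subst hk
  have hmem : ∀ {e f}, β.1.EdgeLT e f → e ∈ β.1.edges ∧ f ∈ β.1.edges := by
    intro e f h
    induction h with
    | single h => exact ⟨h.1, h.2.1⟩
    | tail _ h ih => exact ⟨ih.1, h.2.1⟩
  obtain ⟨a, rfl⟩ := h.exists_eq (hmem hlt).1
  obtain ⟨b, rfl⟩ := h.exists_eq (hmem hlt).2
  have hab := h.2.2 a b hlt
  have ha : a = 0 := by omega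
  subst ha
  by_cases h0 : i = 0
  · exact Or.inl (h0 ▸ h.isLabelledChain.2.1)
  by_cases h2 : i = Fin.last 2
  · exact Or.inr (Or.inl (h2 ▸ h.isLabelledChain.2.2.1))
  have hi : i = 1 := by
    rw [Fin.ext_iff] at h0 h2 ⊢
    simp at h0 h2 ⊢
    omega
  subst hi
  refine Or.inr (Or.inr ?_)
  have hinit : initial g ((1 : Fin 3) : ℕ) = {g 0} := by
    ext f
    rw [mem_initial, Finset.mem_singleton]
    constructor
    · rintro ⟨j, hj, rfl⟩
      have : j = 0 := by rw [Fin.ext_iff]; simp at hj ⊢; omega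
      rw [this]
    · rintro rfl
      exact ⟨0, by simp, rfl⟩
  have hrel : ∀ x y, (h.chain 1).Rel x y ↔ x = y ∨ x ∈ g 0 ∧ y ∈ g 0 := by
    intro x y
    rw [IsProperOrdering.chain, rel_comp, hinit]
    constructor
    · intro hc
      induction hc with
      | refl => exact Or.inl rfl
      | tail _ hbc ih =>
        obtain ⟨f, hf, hb, hc⟩ := hbc
        rw [Finset.mem_singleton] at hf
        subst hf
        rcases ih with rfl | ih
        · exact Or.inr ⟨hb, hc⟩
        · exact Or.inr ⟨ih.1, hc⟩
    · rintro (rfl | ⟨hx, hy⟩)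
      · exact Relation.ReflTransGen.refl
      · exact Conn.single (Finset.mem_singleton_self _) hx hy
  have htwo := β.1.two_le (h.mem 0)
  have hpart : ∀ x ∈ g 0, (h.chain 1).1.part x = g 0 := by
    intro x hx
    ext y
    rw [NCPartition.mem_part_iff, hrel]
    exact ⟨fun h => h.elim (fun h => h ▸ hx) And.right, fun hy => Or.inr ⟨hx, hy⟩⟩
  ext b
  rw [NCPartition.hyperedges, Finset.mem_filter, Finset.mem_singleton]
  constructor
  · rintro ⟨hb, hcard⟩
    obtain ⟨x, rfl⟩ := NCPartition.exists_part_eq hb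
    obtain ⟨y, hy, hyx⟩ := exists_ne_of_two_le hcard x
    rw [NCPartition.mem_part_iff, hrel] at hy
    exact hpart x (hy.resolve_left hyx.symm).1
  · rintro rfl
    obtain ⟨x, hx, -⟩ := exists_ne_of_two_le htwo 0
    exact ⟨hpart x hx ▸ NCPartition.part_mem _ x, htwo⟩

end Vertices

end NCHT
end

/-! ### The main theorem. -/

theorem mainTheorem1 (n : ℕ) (p : NCHT.ConvexPolygon (n + 1)) :
    -- the dual of the noncrossing hypertree poset is the face lattice of the complex
    (∀ σ τ : NCHT.NCHypertree p, τ.verts ⊆ σ.verts ↔ σ ≤ τ) ∧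
    (∀ s ∈ (NCHT.hypertreeComplex p).faces, ∃ τ : NCHT.NCHypertree p, τ.verts = s) ∧
    -- the natural homeomorphism
    ∃ h : NCHT.realization (NCHT.hypertreeComplex p) ≃ₜ NCHT.ncLink p,
      -- a vertex is sent to the vertex given by its lower hyperedge
      (∀ (β : NCHT.BasicNCHypertree p) (e f : Finset (Fin (n + 1))), β.1.EdgeLT e f →
        ∀ x : NCHT.realization (NCHT.hypertreeComplex p), x.1 β = 1 →
          ∀ π : NCHT.NCPartition p, (h x).1 π ≠ 0 → π = ⊥ ∨ π = ⊤ ∨ π.hyperedges = {e}) ∧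
      -- a tree simplex is sent onto the union of the partition simplices labelled by the proper
      -- orderings of the same hypertree
      (∀ τ : NCHT.NCHypertree p, h '' τ.closedSimplex = ⋃₀ τ.partitionCells) ∧
      -- the induced piecewise spherical structure
      ∃ S : NCHT.PiecewiseSpherical (NCHT.hypertreeComplex p),
        (∀ τ : NCHT.NCHypertree p, ∀ x ∈ τ.closedSimplex, ∀ y ∈ τ.closedSimplex,
          ENNReal.ofReal (S.angle x.1 y.1) =
            NCHT.pathDist τ.partitionCells (NCHT.linkAngle n NCHT.NCPartition.rank)
              (h x) (h y)) ∧
        (∀ x y, S.dist x y = NCHT.linkDist n NCHT.NCPartition.rank (h x) (h y)) := by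
  refine ⟨fun σ τ => NCHT.NCHypertree.verts_subset_verts_iff, ?_, NCHT.treeHomeo p, ?_,
    NCHT.NCHypertree.image_closedSimplex, NCHT.sphericalStructure p, ?_, ?_⟩
  · rintro s ⟨-, τ, hs⟩
    exact NCHT.NCHypertree.exists_verts_eq hs
  · exact fun β e f hlt x hx π hπ => NCHT.hyperedges_treeHomeo β hlt x hx π hπ
  · exact fun τ x hx y hy => NCHT.NCHypertree.angle_eq_partitionCells_dist hx hy
  · exact fun x y => le_antisymm (NCHT.dist_le_linkDist x y) (NCHT.linkDist_le_dist x y)
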